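/- Let $0<H<1$, $\sigma>0$, let $0\le q<p$ be integers, and let $\alpha_0,\dots,\alpha_p,\beta_1,\dots,\beta_q$ be real numbers with $\alpha_1\ne0$ and (if $q\ge1$) $\beta_q\neq0$. Put $\beta_0=1$ and $\beta_j=0$ for $j>q$; let $$\alpha(z)=z^p-\alpha_pz^{p-1}-\dots-\alpha_1,\qquad \beta(z)=1+\beta_1z+\dots+\beta_qz^q,$$ $\delta_p=(0,\dots,0,1)'\in\mathbb R^p$, $\beta=(1,\beta_1,\dots,\beta_{p-1})'\in\mathbb R^p$, and let $A$ be the $p\times p$ companion matrix with ones on the first superdiagonal, last row $(\alpha_1,\dots,\alpha_p)$ and zeros elsewhere. Assume that all eigenvalues of $A$ have negative real parts. Let $\{B^H_t,t\ge0\}$ be a standard fractional Brownian motion with Hurst parameter $H$: a centred Gaussian process with continuous paths, $B^H_0=0$ and $E(B^H_tB^H_s)=\frac12\{t^{2H}+s^{2H}-|t-s|^{2H}\}$. Let $\{Y_t,t\ge0\}$ be a stationary CARFIMA$(p,H,q)$ process, that is, $Y_t=\beta'X_t$, where $X$ is a continuous $\mathbb R^p$-valued process, with an arbitrary random initial value $X_0$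 (possibly dependent on $B^H$), that solves $$X_t=X_0+\int_0^t(AX_s+\alpha_0\delta_p)\,ds+\sigma\delta_pB^H_t,\qquad t\ge0,$$ and $Y$ is stationary: $Y_t$ has finite variance, and $E(Y_t)$ and $\operatorname{cov}(Y_{t+h},Y_t)$ do not depend on $t\geq 0$. Write $\gamma_Y(h)=\operatorname{cov}(Y_{t+h},Y_t)$ for $h\ge0$. (a) For all $h\ge0$ the following integrals converge absolutely and $$\gamma_Y(h)=H\beta'Ae^{Ah}\Big(\int_0^he^{-Au}u^{2H-1}du\Big)V^*\beta-H\beta'Ae^{-Ah}\Big(\int_h^\infty e^{Au}u^{2H-1}du\Big)V^*\beta-H\beta'Ae^{Ah}\Big(\int_0^\infty e^{Au}u^{2H-1}du\Big)V^*\beta,$$ where $V^*=\sigma^2\int_0^\infty e^{Au}\delta_p\delta_p'e^{A'u}du$. (b) If the eigenvalues $\lambda_1,\dots,\lambda_p$ of $A$ are distinct, then for all $h\ge0$ $$\gamma_Y(h)=\frac{\sigma^2}2\Gamma(2H+1)\sum_{i=1}^p\frac{\beta(\lambda_i)\beta(-\lambda_i)}{\alpha^{(1)}(\lambda_i)\alpha(-\lambda_i)}u(H,\lambda_i,h),$$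 where $\alpha^{(1)}$ is the derivative of $\alpha$, $$u(H,\lambda,h)=2(-\lambda)^{1-2H}\cosh(\lambda h)+\lambda^{1-2H}e^{\lambda h}P(2H,\lambda h)-(-\lambda)^{1-2H}e^{-\lambda h}P(2H,-\lambda h),$$ and $P(a,z)=\Gamma(a)^{-1}\int_0^ze^{-w}w^{a-1}dw$, the integral being taken along the segment from $0$ to $z$ in the complex plane; complex powers are principal. (c) If $H\ne1/2$, then $$\gamma_Y(h)\sim\sigma^2H(2H-1)\frac{\beta(0)^2}{\alpha(0)^2}h^{2H-2}\qquad(h\to\infty),$$ that is, the ratio of the two sides tends to $1$. Moreover, if $H<1/2$, then $Y$ is antipersistent: $\gamma_Y(h)<0$ for all large $h$, $\gamma_Y$ is integrable on $(0,\infty)$ and $\int_0^\infty\gamma_Y(h)\,dh=0$ (equivalently, $\int_{-\infty}^\infty\gamma_Y(h)\,dh=0$ for the even extension). If $H>1/2$, then $Y$ has long memory: $\gamma_Y(h)>0$ for all large $h$ and $\int_0^T\gamma_Y(h)\,dh\to\infty$ as $T\to\infty$. -/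

import Mathlib

open MeasureTheory ProbabilityTheory Filter Topology

noncomputable section

namespace Carfima

/-! ### Fractional Brownian motion, stationarity

Processes on `[0, ∞)` are written as functions of a real time; only times `t ≥ 0` matter. -/

/-- `B` is a standard fractional Brownian motion on `[0, ∞)` with Hurst parameter `H`:
a centred Gaussian process with `B_0 = 0`, covariance
`(|t|^{2H} + |s|^{2H} - |t-s|^{2H}) / 2` and (almost surely) continuous paths. -/
structure IsFractionalBrownianMotion {Ω : Type*} [MeasurableSpace Ω] (H : ℝ)
    (B : ℝ → Ω → ℝ) (P : Measure Ω) : Prop where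
  gaussian : IsGaussianProcess (fun t : Set.Ici (0 : ℝ) => B t) P
  start : ∀ᵐ ω ∂P, B 0 ω = 0
  mean : ∀ t, 0 ≤ t → ∫ ω, B t ω ∂P = 0
  kernel : ∀ s t, 0 ≤ s → 0 ≤ t → ∫ ω, B t ω * B s ω ∂P =
    (1 / 2) * (|t| ^ (2 * H) + |s| ^ (2 * H) - |t - s| ^ (2 * H))
  paths : ∀ᵐ ω ∂P, ContinuousOn (fun t => B t ω) (Set.Ici 0)

/-- The covariance `cov(Y_{t+h}, Y_t)`. -/
def autocov {Ω : Type*} [MeasurableSpace Ω] (P : Measure Ω) (Y : ℝ → Ω → ℝ) (t h : ℝ) : ℝ :=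
  covariance (Y (t + h)) (Y t) P

/-- Stationarity of a finite-variance process on `[0, ∞)`: the mean does not depend on time, and
`cov(Y_{t+h}, Y_t)` depends only on `h`. A strictly stationary process with finite variance
has this property. -/
structure IsStationary {Ω : Type*} [MeasurableSpace Ω] (Y : ℝ → Ω → ℝ) (P : Measure Ω) :
    Prop where
  memLp : ∀ t, 0 ≤ t → MemLp (Y t) 2 P
  mean : ∀ t, 0 ≤ t → ∫ ω, Y t ω ∂P = ∫ ω, Y 0 ω ∂P
  cov : ∀ t h, 0 ≤ t → 0 ≤ h → autocov P Y t h = autocov P Y 0 h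

/-! ### The model

The coefficients are `α 0, …, α p` and `β 1, …, β q`; other values of `α`, `β` are never used. -/

/-- The coefficients of the moving average part: `1, β_1, …, β_q, 0, 0, …`. -/
def maCoeff (q : ℕ) (β : ℕ → ℝ) (j : ℕ) : ℝ :=
  if j = 0 then 1 else if j ≤ q then β j else 0

/-- The companion matrix `A`, with last row `α_1, …, α_p` and ones above the diagonal. -/
def companion (p : ℕ) (α : ℕ → ℝ) : Matrix (Fin p) (Fin p) ℝ :=
  Matrix.of fun i j =>
    if (i : ℕ) + 1 = p then α ((j : ℕ) + 1) else if (j : ℕ) = (i : ℕ) + 1 then 1 else 0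

/-- `A` as a complex matrix. -/
def companionC (p : ℕ) (α : ℕ → ℝ) : Matrix (Fin p) (Fin p) ℂ :=
  (companion p α).map Complex.ofReal

/-- The vector `δ_p = (0, …, 0, 1)'`. -/
def delta (p : ℕ) : Fin p → ℝ := fun i => if (i : ℕ) + 1 = p then 1 else 0

/-- The vector `β = (1, β_1, …, β_{p-1})'`, where `β_j = 0` for `j > q`. -/
def maVec (p q : ℕ) (β : ℕ → ℝ) : Fin p → ℝ := fun j => maCoeff q β j

/-- `α(z) = z^p - α_p z^{p-1} - ⋯ - α_1`. -/
def arPoly (p : ℕ) (α : ℕ → ℝ) : Polynomial ℝ :=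
  Polynomial.X ^ p - ∑ j ∈ Finset.range p, Polynomial.C (α (j + 1)) * Polynomial.X ^ j

/-- `β(z) = 1 + β_1 z + ⋯ + β_q z^q`. -/
def maPoly (q : ℕ) (β : ℕ → ℝ) : Polynomial ℝ :=
  ∑ j ∈ Finset.range (q + 1), Polynomial.C (maCoeff q β j) * Polynomial.X ^ j

/-- `X` solves the state equation `dX_t = (A X_t + α_0 δ_p) dt + σ δ_p dB_t` on `[0, ∞)`, in the
integrated form, with an arbitrary random initial value `X_0`. -/
structure IsStateSolution {Ω : Type*} [MeasurableSpace Ω] (p : ℕ) (α : ℕ → ℝ) (σ : ℝ)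
    (B : ℝ → Ω → ℝ) (P : Measure Ω) (X : ℝ → Ω → Fin p → ℝ) : Prop where
  aemeasurable : ∀ t, 0 ≤ t → AEMeasurable (X t) P
  paths : ∀ᵐ ω ∂P, ContinuousOn (fun t => X t ω) (Set.Ici 0)
  equation : ∀ᵐ ω ∂P, ∀ t, 0 ≤ t → ∀ i,
    X t ω i = X 0 ω i
      + (∫ s in (0 : ℝ)..t, ((companion p α).mulVec (X s ω) i + α 0 * delta p i))
      + σ * delta p i * (B t ω - B 0 ω)

/-- `Y` is a CARFIMA`(p, H, q)` process driven by `B`: `Y_t = β' X_t` for a solution `X` of the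
state equation. -/
def IsCarfima {Ω : Type*} [MeasurableSpace Ω] (p q : ℕ) (α β : ℕ → ℝ) (σ : ℝ)
    (B : ℝ → Ω → ℝ) (P : Measure Ω) (Y : ℝ → Ω → ℝ) : Prop :=
  ∃ X : ℝ → Ω → Fin p → ℝ, IsStateSolution p α σ B P X ∧
    ∀ t, 0 ≤ t → ∀ᵐ ω ∂P, Y t ω = dotProduct (maVec p q β) (X t ω)

/-! ### The formulas for the autocovariance function -/

/-- All entries of the matrix-valued function `F` are integrable on `S`. -/
def MatIntegrableOn {p : ℕ} (F : ℝ → Matrix (Fin p) (Fin p) ℝ) (S : Set ℝ) : Prop :=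
  ∀ i j, IntegrableOn (fun u => F u i j) S

/-- The entrywise integral of a matrix-valued function. -/
def matIntegral {p : ℕ} (F : ℝ → Matrix (Fin p) (Fin p) ℝ) (S : Set ℝ) :
    Matrix (Fin p) (Fin p) ℝ :=
  Matrix.of fun i j => ∫ u in S, F u i j

/-- The matrix exponential `e^{At}`. -/
def expA {p : ℕ} (A : Matrix (Fin p) (Fin p) ℝ) (t : ℝ) : Matrix (Fin p) (Fin p) ℝ :=
  NormedSpace.exp (t • A)

/-- The integrand `σ² e^{Au} δ_p δ_p' e^{A'u}` of `V*`. -/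
def vStarIntegrand {p : ℕ} (A : Matrix (Fin p) (Fin p) ℝ) (σ : ℝ) (u : ℝ) :
    Matrix (Fin p) (Fin p) ℝ :=
  σ ^ 2 • (expA A u * Matrix.vecMulVec (delta p) (delta p) * expA A.transpose u)

/-- `V* = σ² ∫_0^∞ e^{Au} δ_p δ_p' e^{A'u} du`. -/
def vStar {p : ℕ} (A : Matrix (Fin p) (Fin p) ℝ) (σ : ℝ) : Matrix (Fin p) (Fin p) ℝ :=
  matIntegral (vStarIntegrand A σ) (Set.Ioi 0)

/-- `P(a, z) = Γ(a)⁻¹ ∫_0^z e^{-w} w^{a-1} dw` along the segment `w = s z`, `0 < s < 1`. -/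
def incGammaP (a : ℝ) (z : ℂ) : ℂ :=
  (∫ s in (0 : ℝ)..1, Complex.exp (-((s : ℂ) * z)) * ((s : ℂ) * z) ^ ((a : ℂ) - 1) * z)
    / (Real.Gamma a : ℂ)

/-- `u(H, λ, h) = 2 (-λ)^{1-2H} cosh(λh) + λ^{1-2H} e^{λh} P(2H, λh)
- (-λ)^{1-2H} e^{-λh} P(2H, -λh)`, with principal powers. -/
def uFun (H : ℝ) (l : ℂ) (h : ℝ) : ℂ :=
  2 * (-l) ^ (1 - 2 * (H : ℂ)) * Complex.cosh (l * h)
    + l ^ (1 - 2 * (H : ℂ)) * Complex.exp (l * h) * incGammaP (2 * H) (l * h)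
    - (-l) ^ (1 - 2 * (H : ℂ)) * Complex.exp (-(l * h)) * incGammaP (2 * H) (-(l * h))

/-! ### Antipersistence and long memory

Both are properties of an autocovariance function `γ`, given on `[0, ∞)` and even. -/

/-- Antipersistence: `γ` is integrable with total integral zero (over the line, or equivalently
over `(0, ∞)` because `γ` is even), and negative at all large lags. -/
def IsAntipersistent (γ : ℝ → ℝ) : Prop :=
  IntegrableOn γ (Set.Ioi 0) ∧ (∫ h in Set.Ioi 0, γ h) = 0 ∧ ∀ᶠ h in atTop, γ h < 0

/-- Long memory: `γ` is positive at all large lags and its integral diverges to `+∞`. -/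
def IsLongMemory (γ : ℝ → ℝ) : Prop :=
  (∀ᶠ h in atTop, 0 < γ h) ∧ Tendsto (fun T => ∫ h in (0 : ℝ)..T, γ h) atTop atTop

end Carfima

end

/-!
By the variation of constants formula, integrated by parts, `Y_s` is the moving average
`∫_0^s f(u) (B_{s-u} - B_s) du` of backward increments, where `f` is the derivative of
`u ↦ σ b' e^{Au} δ_p`, plus a part depending on `X_0` and `B_s` whose variance vanishes as
`s → ∞`. Stationarity forces `γ_Y(h)` to equal its limit as `s → ∞`, from which the arbitrary
initial value has disappeared. Collapsing the double integral along the diagonal gives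
`γ_Y(h) = ½ ∫_0^∞ k(w) (φ(h-w) + φ(h+w) - 2φ(h)) dw` with `φ(x) = |x|^{2H}` and
`k(w) = b' A² e^{Aw} V* b`. Integration by parts gives (a), and expanding `e^{Aw} δ_p` in
eigenvectors of `A` gives (b). At infinity the second difference of `φ` is `w² φ''(h)` to leading
order, which gives (c) because `∫_0^∞ w² k(w) dw = σ² (b' A⁻¹ δ_p)² = σ² β(0)² / α(0)²`.
-/

namespace Carfima

open scoped Matrix

section MatrixExponential

attribute [local instance] Matrix.linftyOpNormedRing Matrix.linftyOpNormedAlgebra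

section Real

variable {p : ℕ} (A : Matrix (Fin p) (Fin p) ℝ)

lemma expA_zero : expA A 0 = 1 := by
  simp [expA]

lemma expA_add (s t : ℝ) : expA A (s + t) = expA A s * expA A t := by
  rw [expA, add_smul]
  exact Matrix.exp_add_of_commute _ _ (((Commute.refl A).smul_left s).smul_right t)

lemma expA_transpose (t : ℝ) : expA Aᵀ t = (expA A t)ᵀ := by
  rw [expA, ← Matrix.transpose_smul, Matrix.exp_transpose, expA]

lemma hasDerivAt_expA (t : ℝ) : HasDerivAt (expA A) (expA A t * A) t :=
  hasDerivAt_exp_smul_const A t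

lemma commute_expA {A M : Matrix (Fin p) (Fin p) ℝ} (hM : Commute M A) (t : ℝ) :
    Commute M (expA A t) :=
  (hM.smul_right t).exp_right

lemma expA_map_ofReal (t : ℝ) :
    (expA A t).map Complex.ofReal = NormedSpace.exp ((t : ℂ) • A.map Complex.ofReal) := by
  have hcont : Continuous (Complex.ofRealHom.mapMatrix : Matrix (Fin p) (Fin p) ℝ →+* _) :=
    continuous_id.matrix_map Complex.continuous_ofReal
  rw [expA, ← show (t • A).map Complex.ofReal = (t : ℂ) • A.map Complex.ofReal by ext; simp]
  exact NormedSpace.map_exp Complex.ofRealHom.mapMatrix hcont (t • A)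

end Real

section Complex

variable {n : Type*} [Fintype n] [DecidableEq n] (M : Matrix n n ℂ)

lemma hasSum_exp_mulVec (y : n → ℂ) :
    HasSum (fun j : ℕ => ((j.factorial : ℂ)⁻¹ • M ^ j) *ᵥ y) (NormedSpace.exp M *ᵥ y) :=
  (NormedSpace.exp_series_hasSum_exp' (𝕂 := ℂ) M).map
    (AddMonoidHom.mk' (fun N : Matrix n n ℂ => N *ᵥ y) fun N N' => Matrix.add_mulVec N N' y)
    (continuous_id.matrix_mulVec continuous_const)

lemma exp_smul_mulVec_of_sub_pow_mulVec_eq_zero {l : ℂ} {k : ℕ} {y : n → ℂ}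
    (hy : (M - l • 1) ^ k *ᵥ y = 0) (z : ℂ) :
    NormedSpace.exp (z • M) *ᵥ y =
      ∑ j ∈ Finset.range k,
        (Complex.exp (z * l) * (z ^ j / j.factorial)) • ((M - l • 1) ^ j *ᵥ y) := by
  set N := M - l • (1 : Matrix n n ℂ) with hN
  have hsplit : z • M = (z * l) • (1 : Matrix n n ℂ) + z • N := by
    rw [hN, smul_sub, smul_smul, add_sub_cancel]
  have hexp : NormedSpace.exp (z • M) = Complex.exp (z * l) • NormedSpace.exp (z • N) := by
    rw [hsplit, Matrix.exp_add_of_commute _ _ ((Commute.one_left _).smul_left _),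
      ← Algebra.algebraMap_eq_smul_one,
      Complex.exp_eq_exp_ℂ, Algebra.smul_def (NormedSpace.exp (z * l))]
    exact congrArg (· * NormedSpace.exp (z • N))
      (NormedSpace.algebraMap_exp_comm (z * l)).symm
  have hzero : ∀ j ∉ Finset.range k, ((j.factorial : ℂ)⁻¹ • (z • N) ^ j) *ᵥ y = 0 := by
    intro j hj
    obtain ⟨i, rfl⟩ := Nat.exists_eq_add_of_le' (by simpa using hj : k ≤ j)
    rw [smul_pow, smul_smul, Matrix.smul_mulVec, pow_add N, ← Matrix.mulVec_mulVec, hy,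
      Matrix.mulVec_zero, smul_zero]
  have hsum : NormedSpace.exp (z • N) *ᵥ y =
      ∑ j ∈ Finset.range k, ((j.factorial : ℂ)⁻¹ • (z • N) ^ j) *ᵥ y :=
    (hasSum_exp_mulVec (z • N) y).unique (hasSum_sum_of_ne_finset_zero hzero)
  rw [hexp, Matrix.smul_mulVec, hsum, Finset.smul_sum]
  refine Finset.sum_congr rfl fun j _ => ?_
  rw [smul_pow, smul_smul, Matrix.smul_mulVec, smul_smul, div_eq_inv_mul]

lemma exp_smul_mulVec_of_eigenvector {l : ℂ} {y : n → ℂ} (hy : M *ᵥ y = l • y) (z : ℂ) :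
    NormedSpace.exp (z • M) *ᵥ y = Complex.exp (z * l) • y := by
  have h : (M - l • 1) ^ 1 *ᵥ y = 0 := by
    rw [pow_one, Matrix.sub_mulVec, Matrix.smul_mulVec, Matrix.one_mulVec, hy, sub_self]
  simpa using exp_smul_mulVec_of_sub_pow_mulVec_eq_zero M h z

lemma isBigO_cexp_mul_pow {l : ℂ} {ε : ℝ} (hl : l.re < -ε) (c : ℂ) (j : ℕ) :
    (fun t : ℝ => Complex.exp (t * l) * ((t : ℂ) ^ j / c))
      =O[atTop] fun t => Real.exp (-ε * t) := by
  have hpow : (fun t : ℝ => (t : ℂ) ^ j / c) =O[atTop] fun t : ℝ => Real.exp ((-ε - l.re) * t) := by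
    have h : (fun t : ℝ => c⁻¹ * (t : ℂ) ^ j) =O[atTop] fun t : ℝ => t ^ j :=
      (Asymptotics.isBigO_of_le _ fun t => by simp).const_mul_left c⁻¹
    simp only [div_eq_inv_mul]
    exact h.trans (isLittleO_pow_exp_pos_mul_atTop j (by linarith)).isBigO
  have hexp : (fun t : ℝ => Complex.exp (t * l)) =O[atTop] fun t => Real.exp (l.re * t) :=
    Asymptotics.IsBigO.of_norm_le fun t => by simp [Complex.norm_exp, mul_comm]
  refine (hexp.mul hpow).congr_right fun t => ?_
  rw [← Real.exp_add]
  ring_nf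

lemma mem_spectrum_of_mem_maxGenEigenspace {l : ℂ} {y : n → ℂ}
    (hy : y ∈ Module.End.maxGenEigenspace (Matrix.toLin' M) l) (hy0 : y ≠ 0) :
    l ∈ spectrum ℂ M := by
  have hgen : Module.End.HasUnifEigenvalue (Matrix.toLin' M) l ⊤ := fun h =>
    hy0 (by simpa [Module.End.maxGenEigenspace, h] using hy)
  have heig : Module.End.HasEigenvalue (Matrix.toLin' M) l := hgen.lt zero_lt_one
  simpa only [Matrix.spectrum_toLin'] using heig.mem_spectrum

lemma exists_forall_mem_spectrum_re_lt (hM : ∀ z ∈ spectrum ℂ M, z.re < 0) :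
    ∃ ε > 0, ∀ z ∈ spectrum ℂ M, z.re < -ε := by
  have hgap : ∀ᶠ ε in 𝓝[>] (0 : ℝ), ∀ z ∈ spectrum ℂ M, z.re < -ε :=
    (Filter.eventually_all_finite (Matrix.finite_spectrum M)).2 fun z hz =>
      nhdsWithin_le_nhds <| (continuous_neg.tendsto' _ _ neg_zero).eventually_const_lt (hM z hz)
  obtain ⟨ε, h, hε⟩ := (hgap.and self_mem_nhdsWithin).exists
  exact ⟨ε, hε, h⟩

lemma isBigO_exp_smul_mulVec_of_spectrum_re_lt {ε : ℝ} (hM : ∀ z ∈ spectrum ℂ M, z.re < -ε)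
    (y : n → ℂ) :
    (fun t : ℝ => NormedSpace.exp ((t : ℂ) • M) *ᵥ y) =O[atTop] fun t => Real.exp (-ε * t) := by
  let S : Submodule ℂ (n → ℂ) :=
    { carrier := {y | (fun t : ℝ => NormedSpace.exp ((t : ℂ) • M) *ᵥ y)
        =O[atTop] fun t => Real.exp (-ε * t)}
      zero_mem' := (Asymptotics.isBigO_zero _ _).congr_left fun t => (Matrix.mulVec_zero _).symm
      add_mem' := fun hy hz => (hy.add hz).congr_left fun t => (Matrix.mulVec_add _ _ _).symm
      smul_mem' := fun c _ hy =>
        (hy.const_smul_left c).congr_left fun t => (Matrix.mulVec_smul _ c _).symm }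
  suffices h : ⊤ ≤ S from h Submodule.mem_top
  rw [← Module.End.iSup_maxGenEigenspace_eq_top (Matrix.toLin' M), iSup_le_iff]
  intro l y hy
  rcases eq_or_ne y 0 with rfl | hy0
  · exact S.zero_mem
  have hl : l.re < -ε := hM l (mem_spectrum_of_mem_maxGenEigenspace M hy hy0)
  obtain ⟨k, hk⟩ := (Module.End.mem_maxGenEigenspace _ _ _).1 hy
  have hk' : (M - l • 1) ^ k *ᵥ y = 0 := by
    rw [← hk, ← Matrix.toLin'_apply, Matrix.toLin'_pow, map_sub, map_smul, Matrix.toLin'_one]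
    rfl
  have hterm : ∀ j ∈ Finset.range k, (fun t : ℝ =>
      (Complex.exp (t * l) * ((t : ℂ) ^ j / j.factorial)) • ((M - l • 1) ^ j *ᵥ y))
        =O[atTop] fun t => Real.exp (-ε * t) := fun j _ => by
    refine ((isBigO_cexp_mul_pow hl j.factorial j).smul
      (Asymptotics.isBigO_const_const ((M - l • 1) ^ j *ᵥ y) (one_ne_zero (α := ℝ)) _)).congr_right
      fun t => ?_
    rw [smul_eq_mul, mul_one]
  refine (Asymptotics.IsBigO.sum hterm).congr_left fun t => ?_
  rw [Finset.sum_apply, exp_smul_mulVec_of_sub_pow_mulVec_eq_zero M hk']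

end Complex

section Forms

variable {p : ℕ} (A : Matrix (Fin p) (Fin p) ℝ) (x y : Fin p → ℝ)

/-- The matrix coefficient `t ↦ x' e^{At} y` of the one-parameter group `e^{At}`. All the scalar
functions attached to the model (impulse response, kernel of the autocovariance, …) have this
form. -/
noncomputable def expForm (t : ℝ) : ℝ :=
  x ⬝ᵥ expA A t *ᵥ y

lemma expForm_zero : expForm A x y 0 = x ⬝ᵥ y := by
  rw [expForm, expA_zero, Matrix.one_mulVec]

lemma expForm_single (i j : Fin p) (t : ℝ) :
    expForm A (Pi.single i 1) (Pi.single j 1) t = expA A t i j := by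
  simp [expForm]

lemma hasDerivAt_expForm (t : ℝ) : HasDerivAt (expForm A x y) (expForm A x (A *ᵥ y) t) t := by
  let L : Matrix (Fin p) (Fin p) ℝ →ₗ[ℝ] ℝ :=
    dotProductBilin ℝ ℝ x ∘ₗ (Matrix.mulVecBilin ℝ ℝ).flip y
  have h : HasDerivAt (fun t => L (expA A t)) (L (expA A t * A)) t :=
    L.toContinuousLinearMap.hasFDerivAt.comp_hasDerivAt t (hasDerivAt_expA A t)
  rw [expForm, Matrix.mulVec_mulVec]
  exact h

lemma continuous_expForm : Continuous (expForm A x y) :=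
  continuous_iff_continuousAt.2 fun t => (hasDerivAt_expForm A x y t).continuousAt

lemma ofReal_expForm (t : ℝ) :
    (expForm A x y t : ℂ) = (Complex.ofReal ∘ x) ⬝ᵥ
      NormedSpace.exp ((t : ℂ) • A.map Complex.ofReal) *ᵥ (Complex.ofReal ∘ y) := by
  rw [expForm, ← expA_map_ofReal, ← Complex.ofRealHom_eq_coe, RingHom.map_dotProduct]
  congr 1
  funext i
  exact RingHom.map_mulVec Complex.ofRealHom (expA A t) y i

/-- A real matrix is stable (Hurwitz) if its complex eigenvalues have negative real parts. -/
def IsStable : Prop :=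
  ∀ z ∈ spectrum ℂ (A.map Complex.ofReal), z.re < 0

variable {A}

lemma IsStable.isUnit_det (hA : IsStable A) : IsUnit A.det := by
  have hzero : (0 : ℂ) ∉ spectrum ℂ (A.map Complex.ofReal) := fun h => lt_irrefl _ (hA 0 h)
  have hunit : IsUnit (A.map Complex.ofReal).det :=
    (Matrix.isUnit_iff_isUnit_det _).1 ((spectrum.zero_notMem_iff ℂ).1 hzero)
  have hdet : (A.map Complex.ofReal).det = A.det := (Complex.ofRealHom.map_det A).symm
  simpa [hdet] using hunit

lemma IsStable.exists_isBigO_expForm (hA : IsStable A) :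
    ∃ ε > 0, expForm A x y =O[atTop] fun t => Real.exp (-ε * t) := by
  obtain ⟨ε, hε, hlt⟩ := exists_forall_mem_spectrum_re_lt _ hA
  refine ⟨ε, hε, ?_⟩
  have hvec := isBigO_exp_smul_mulVec_of_spectrum_re_lt _ hlt (Complex.ofReal ∘ y)
  have hC := ((LinearMap.toContinuousLinearMap
    (dotProductBilin ℂ ℂ (Complex.ofReal ∘ x))).isBigO_comp _ _).trans hvec
  exact (hC.congr_left fun t => (ofReal_expForm A x y t).symm).norm_left.congr_left
    (fun t => Complex.norm_real _) |>.of_norm_left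

end Forms

end MatrixExponential

/-- Continuous functions on the line of polynomial growth: the class of increment variances
`φ`, such as `|x| ^ (2 * H)`, against which exponentially decaying kernels are integrated. -/
structure PolyGrowth (φ : ℝ → ℝ) : Prop where
  continuous : Continuous φ
  bound : ∃ C, ∃ n : ℕ, ∀ x, |φ x| ≤ C * (1 + |x|) ^ n

lemma one_add_abs_add_le (x y : ℝ) : 1 + |x + y| ≤ (1 + |x|) * (1 + |y|) := by
  have h := abs_add_le x y
  nlinarith [mul_nonneg (abs_nonneg x) (abs_nonneg y)]

lemma one_add_abs_sub_le (x y : ℝ) : 1 + |x - y| ≤ (1 + |x|) * (1 + |y|) := by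
  simpa [sub_eq_add_neg] using one_add_abs_add_le x (-y)

namespace PolyGrowth

variable {φ ψ : ℝ → ℝ}

lemma exists_nonneg_bound (hφ : PolyGrowth φ) :
    ∃ C, 0 ≤ C ∧ ∃ n : ℕ, ∀ x, |φ x| ≤ C * (1 + |x|) ^ n := by
  obtain ⟨C, n, h⟩ := hφ.bound
  exact ⟨C, by simpa using (abs_nonneg _).trans (h 0), n, h⟩

lemma one_add_abs_pow (n : ℕ) : PolyGrowth fun x => (1 + |x|) ^ n :=
  ⟨by fun_prop, 1, n, fun x => by rw [one_mul, abs_of_nonneg (by positivity)]⟩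

lemma const (c : ℝ) : PolyGrowth fun _ => c :=
  ⟨continuous_const, |c|, 0, fun _ => by simp⟩

lemma pow (n : ℕ) : PolyGrowth fun x => x ^ n :=
  ⟨by fun_prop, 1, n, fun x => by rw [abs_pow, one_mul]; gcongr; linarith⟩

lemma abs_rpow {a : ℝ} (ha : 0 < a) : PolyGrowth fun x => |x| ^ a := by
  refine ⟨continuous_abs.rpow_const fun _ => Or.inr ha.le, 1, ⌈a⌉₊, fun x => ?_⟩
  rw [abs_of_nonneg (by positivity), one_mul, ← Real.rpow_natCast]
  calc |x| ^ a ≤ (1 + |x|) ^ a := by gcongr; linarith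
    _ ≤ (1 + |x|) ^ (⌈a⌉₊ : ℝ) :=
      Real.rpow_le_rpow_of_exponent_le (by linarith [abs_nonneg x]) (Nat.le_ceil a)

lemma mul (hφ : PolyGrowth φ) (hψ : PolyGrowth ψ) : PolyGrowth fun x => φ x * ψ x := by
  obtain ⟨C, hC, n, hn⟩ := hφ.exists_nonneg_bound
  obtain ⟨D, m, hm⟩ := hψ.bound
  refine ⟨hφ.continuous.mul hψ.continuous, C * D, n + m, fun x => ?_⟩
  calc |φ x * ψ x| = |φ x| * |ψ x| := abs_mul _ _
    _ ≤ (C * (1 + |x|) ^ n) * (D * (1 + |x|) ^ m) := by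
      gcongr
      exacts [hn x, hm x]
    _ = C * D * (1 + |x|) ^ (n + m) := by ring

lemma add (hφ : PolyGrowth φ) (hψ : PolyGrowth ψ) : PolyGrowth fun x => φ x + ψ x := by
  obtain ⟨C, hC, n, hn⟩ := hφ.exists_nonneg_bound
  obtain ⟨D, hD, m, hm⟩ := hψ.exists_nonneg_bound
  refine ⟨hφ.continuous.add hψ.continuous, C + D, n + m, fun x => ?_⟩
  have h1 : (1 : ℝ) ≤ 1 + |x| := by linarith [abs_nonneg x]
  calc |φ x + ψ x| ≤ |φ x| + |ψ x| := abs_add_le _ _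
    _ ≤ C * (1 + |x|) ^ n + D * (1 + |x|) ^ m := add_le_add (hn x) (hm x)
    _ ≤ C * (1 + |x|) ^ (n + m) + D * (1 + |x|) ^ (n + m) := by gcongr <;> omega
    _ = (C + D) * (1 + |x|) ^ (n + m) := by ring

lemma comp_add_left (hφ : PolyGrowth φ) (h : ℝ) : PolyGrowth fun x => φ (h + x) := by
  obtain ⟨C, hC, n, hn⟩ := hφ.exists_nonneg_bound
  refine ⟨hφ.continuous.comp (by fun_prop), C * (1 + |h|) ^ n, n, fun x => (hn _).trans ?_⟩
  rw [mul_assoc, ← mul_pow]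
  gcongr
  exact one_add_abs_add_le h x

lemma comp_neg (hφ : PolyGrowth φ) : PolyGrowth fun x => φ (-x) := by
  obtain ⟨C, n, hn⟩ := hφ.bound
  exact ⟨hφ.continuous.comp continuous_neg, C, n, fun x => by simpa using hn (-x)⟩

lemma comp_sub_left (hφ : PolyGrowth φ) (h : ℝ) : PolyGrowth fun x => φ (h - x) := by
  simpa only [sub_eq_add_neg] using (hφ.comp_add_left h).comp_neg

lemma isBigO_exp (hφ : PolyGrowth φ) {ε : ℝ} (hε : 0 < ε) :
    φ =O[atTop] fun t => Real.exp (ε * t) := by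
  obtain ⟨C, hC, n, hn⟩ := hφ.exists_nonneg_bound
  have hpow : φ =O[atTop] fun t : ℝ => t ^ n := by
    refine Asymptotics.IsBigO.of_bound (C * 2 ^ n) ?_
    filter_upwards [eventually_ge_atTop 1] with t ht
    have h2 : 1 + |t| ≤ 2 * |t| := by linarith [le_abs_self t]
    calc ‖φ t‖ ≤ C * (1 + |t|) ^ n := hn t
      _ ≤ C * (2 * |t|) ^ n := by gcongr
      _ = C * 2 ^ n * ‖t ^ n‖ := by rw [norm_pow, Real.norm_eq_abs, mul_pow, mul_assoc]
  exact hpow.trans (isLittleO_pow_exp_pos_mul_atTop n hε).isBigO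

end PolyGrowth

/-- Continuous functions on the line that decay exponentially at `+∞`; nothing is required at
`-∞`. -/
structure ExpDecay (f : ℝ → ℝ) : Prop where
  continuous : Continuous f
  isBigO : ∃ ε > 0, f =O[atTop] fun t => Real.exp (-ε * t)

lemma IsStable.expDecay_expForm {p : ℕ} {A : Matrix (Fin p) (Fin p) ℝ} (hA : IsStable A)
    (x y : Fin p → ℝ) : ExpDecay (expForm A x y) :=
  ⟨continuous_expForm A x y, hA.exists_isBigO_expForm x y⟩

namespace ExpDecay

variable {f g φ : ℝ → ℝ}

lemma integrableOn (hf : ExpDecay f) : IntegrableOn f (Set.Ioi 0) :=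
  let ⟨_, hε, h⟩ := hf.isBigO
  integrable_of_isBigO_exp_neg hε hf.continuous.continuousOn h

lemma tendsto_zero (hf : ExpDecay f) : Tendsto f atTop (𝓝 0) := by
  obtain ⟨ε, hε, h⟩ := hf.isBigO
  exact h.trans_tendsto
    (Real.tendsto_exp_atBot.comp (tendsto_id.const_mul_atTop_of_neg (neg_lt_zero.2 hε)))

lemma const_mul (hf : ExpDecay f) (c : ℝ) : ExpDecay fun t => c * f t :=
  let ⟨ε, hε, h⟩ := hf.isBigO
  ⟨hf.continuous.const_mul c, ε, hε, h.const_mul_left c⟩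

lemma polyGrowth_mul (hf : ExpDecay f) (hφ : PolyGrowth φ) : ExpDecay fun t => φ t * f t := by
  obtain ⟨ε, hε, h⟩ := hf.isBigO
  refine ⟨hφ.continuous.mul hf.continuous, ε / 2, by positivity, ?_⟩
  refine ((hφ.isBigO_exp (half_pos hε)).mul h).congr_right fun t => ?_
  rw [← Real.exp_add]
  ring_nf

lemma mul (hf : ExpDecay f) (hg : ExpDecay g) : ExpDecay fun t => f t * g t := by
  obtain ⟨ε, hε, h⟩ := hf.isBigO
  obtain ⟨δ, hδ, h'⟩ := hg.isBigO
  refine ⟨hf.continuous.mul hg.continuous, ε + δ, by positivity, (h.mul h').congr_right fun t => ?_⟩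
  rw [← Real.exp_add]
  ring_nf

lemma comp_add_right (hf : ExpDecay f) (w : ℝ) : ExpDecay fun t => f (t + w) := by
  obtain ⟨ε, hε, h⟩ := hf.isBigO
  refine ⟨hf.continuous.comp (by fun_prop), ε, hε, ?_⟩
  have hw : (fun t => f (t + w)) =O[atTop] fun t => Real.exp (-ε * (t + w)) :=
    h.comp_tendsto (tendsto_atTop_add_const_right atTop w tendsto_id)
  refine hw.trans (Asymptotics.isBigO_of_le' (c := Real.exp (-ε * w)) _ fun t => ?_)
  rw [mul_add, Real.exp_add, norm_mul, mul_comm, Real.norm_of_nonneg (Real.exp_nonneg _)]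

lemma integrableOn_rpow_mul (hf : ExpDecay f) {s : ℝ} (hs : -1 < s) :
    IntegrableOn (fun t => t ^ s * f t) (Set.Ioi 0) := by
  obtain ⟨ε, hε, h⟩ := hf.isBigO
  have hzero : f =O[𝓝[>] 0] fun t => t ^ (-(0 : ℝ)) := by
    simpa using (hf.continuous.continuousAt.isBigO_one ℝ).mono nhdsWithin_le_nhds
  have htop : f =O[atTop] fun t => t ^ (-(s + 2)) :=
    h.trans (isLittleO_exp_neg_mul_rpow_atTop hε _).isBigO
  simpa using mellin_convergent_of_isBigO_scalar (s := s + 1)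
    (hf.continuous.locallyIntegrable.locallyIntegrableOn _) htop (by linarith) hzero (by linarith)

lemma integral_deriv {f' : ℝ → ℝ} (hf : ExpDecay f) (hf' : ExpDecay f')
    (hd : ∀ t, HasDerivAt f (f' t) t) : ∫ t in Set.Ioi (0 : ℝ), f' t = -f 0 := by
  rw [integral_Ioi_of_hasDerivAt_of_tendsto' (fun t _ => hd t) hf'.integrableOn hf.tendsto_zero,
    zero_sub]

end ExpDecay

section HalfLine

lemma setIntegral_Ioi_comp_add_right {E : Type*} [NormedAddCommGroup E] [NormedSpace ℝ E]
    (f : ℝ → E) (a c : ℝ) : ∫ x in Set.Ioi a, f (x + c) = ∫ x in Set.Ioi (a + c), f x := by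
  simpa using (measurePreserving_add_right volume c).setIntegral_preimage_emb
    (measurableEmbedding_addRight c) f (Set.Ioi (a + c))

lemma integral_eq_setIntegral_Ioi_add_neg {f : ℝ → ℝ} (hf : Integrable f) :
    ∫ x, f x = ∫ x in Set.Ioi (0 : ℝ), (f x + f (-x)) := by
  have hneg : IntegrableOn (fun x => f (-x)) (Set.Ioi 0) := hf.comp_neg.integrableOn
  rw [integral_add hf.integrableOn hneg, integral_comp_neg_Ioi, neg_zero, add_comm,
    intervalIntegral.integral_Iic_add_Ioi hf.integrableOn hf.integrableOn]

end HalfLine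

section Quadrant

variable {g k φ : ℝ → ℝ}

/-- Lebesgue measure on the half line `(0, ∞)`; its square is Lebesgue measure on the quadrant. -/
noncomputable abbrev halfLine : Measure ℝ := volume.restrict (Set.Ioi (0 : ℝ))

lemma integrable_quadrant (hg : ExpDecay g) (hk : ExpDecay k) (hφ : PolyGrowth φ) :
    Integrable (fun z : ℝ × ℝ => g z.1 * k z.2 * φ (z.1 - z.2)) (halfLine.prod halfLine) := by
  obtain ⟨C, hC, n, hn⟩ := hφ.exists_nonneg_bound
  have hweight : Integrable (fun z : ℝ × ℝ => (1 + |z.1|) ^ n * g z.1 * ((1 + |z.2|) ^ n * k z.2))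
      (halfLine.prod halfLine) :=
    Integrable.mul_prod (hg.polyGrowth_mul (.one_add_abs_pow n)).integrableOn
      (hk.polyGrowth_mul (.one_add_abs_pow n)).integrableOn
  have hcont : Continuous fun z : ℝ × ℝ => g z.1 * k z.2 * φ (z.1 - z.2) := by
    have := hg.continuous
    have := hk.continuous
    have := hφ.continuous
    fun_prop
  refine (hweight.norm.const_mul C).mono' hcont.aestronglyMeasurable (ae_of_all _ fun z => ?_)
  have hbound : |φ (z.1 - z.2)| ≤ C * ((1 + |z.1|) ^ n * (1 + |z.2|) ^ n) := by
    refine (hn _).trans ?_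
    rw [← mul_pow]
    gcongr
    exact one_add_abs_sub_le z.1 z.2
  calc ‖g z.1 * k z.2 * φ (z.1 - z.2)‖ = |g z.1| * |k z.2| * |φ (z.1 - z.2)| := by
        simp only [norm_mul, Real.norm_eq_abs]
    _ ≤ |g z.1| * |k z.2| * (C * ((1 + |z.1|) ^ n * (1 + |z.2|) ^ n)) := by gcongr
    _ = C * ‖(1 + |z.1|) ^ n * g z.1 * ((1 + |z.2|) ^ n * k z.2)‖ := by
      simp only [norm_mul, Real.norm_eq_abs]
      rw [abs_of_nonneg (a := (1 + |z.1|) ^ n) (by positivity),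
        abs_of_nonneg (a := (1 + |z.2|) ^ n) (by positivity)]
      ring

lemma integral_mul_comp_add_neg (g : ℝ → ℝ) (w : ℝ) :
    ∫ v, g v * g (v + -w) = ∫ v, g v * g (v + w) := by
  rw [← integral_add_right_eq_self (fun v => g v * g (v + -w)) w]
  simp only [add_neg_cancel_right, mul_comm]

lemma integral_mul_mul_comp_sub (h : Integrable fun z : ℝ × ℝ => g z.1 * g z.2 * φ (z.1 - z.2)) :
    ∫ z : ℝ × ℝ, g z.1 * g z.2 * φ (z.1 - z.2) =
      ∫ w in Set.Ioi (0 : ℝ), (∫ v, g v * g (v + w)) * (φ w + φ (-w)) := by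
  have hshear : MeasurePreserving (fun z : ℝ × ℝ => (z.1 + z.2, z.2)) volume volume :=
    measurePreserving_add_prod volume volume
  have hdiag (z : ℝ × ℝ) : g (z.1 + z.2) * g z.2 * φ (z.1 + z.2 - z.2) =
      g z.2 * g (z.2 + z.1) * φ z.1 := by
    rw [add_sub_cancel_right, add_comm z.1, mul_comm (g _)]
  have hint : Integrable fun z : ℝ × ℝ => g z.2 * g (z.2 + z.1) * φ z.1 := by
    simpa only [Function.comp_def, hdiag] using hshear.integrable_comp_of_integrable h
  have hfst : Integrable fun w => (∫ v, g v * g (v + w)) * φ w := by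
    simpa only [integral_mul_const] using hint.integral_prod_left
  calc ∫ z : ℝ × ℝ, g z.1 * g z.2 * φ (z.1 - z.2)
      = ∫ z : ℝ × ℝ, g z.2 * g (z.2 + z.1) * φ z.1 := by
        conv_lhs => rw [← hshear.map_eq]
        rw [integral_map hshear.aemeasurable (by rw [hshear.map_eq]; exact h.aestronglyMeasurable)]
        simp only [hdiag]
    _ = ∫ w, (∫ v, g v * g (v + w)) * φ w := by
      rw [Measure.volume_eq_prod, integral_prod _ hint]
      simp only [integral_mul_const]
    _ = _ := by
      rw [integral_eq_setIntegral_Ioi_add_neg hfst]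
      simp only [integral_mul_comp_add_neg, mul_add]

lemma integral_indicator_Ioi_mul_comp_add (g : ℝ → ℝ) {w : ℝ} (hw : 0 < w) :
    ∫ v, (Set.Ioi 0).indicator g v * (Set.Ioi 0).indicator g (v + w) =
      ∫ v in Set.Ioi (0 : ℝ), g v * g (v + w) := by
  rw [← integral_indicator measurableSet_Ioi]
  congr 1 with v
  rcases lt_or_ge 0 v with hv | hv
  · simp [hv, add_pos hv hw]
  · simp [hv]

lemma integral_quadrant_mul_mul_comp_sub (hg : ExpDecay g) (hφ : PolyGrowth φ) :
    ∫ z, g z.1 * g z.2 * φ (z.1 - z.2) ∂(halfLine.prod halfLine) =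
      ∫ w in Set.Ioi (0 : ℝ), (∫ v in Set.Ioi (0 : ℝ), g v * g (v + w)) * (φ w + φ (-w)) := by
  set G : ℝ → ℝ := (Set.Ioi 0).indicator g with hG
  have hms : MeasurableSet (Set.Ioi (0 : ℝ) ×ˢ Set.Ioi (0 : ℝ)) :=
    measurableSet_Ioi.prod measurableSet_Ioi
  have hind : (Set.Ioi (0 : ℝ) ×ˢ Set.Ioi (0 : ℝ)).indicator
      (fun z => g z.1 * g z.2 * φ (z.1 - z.2)) = fun z => G z.1 * G z.2 * φ (z.1 - z.2) := by
    funext z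
    by_cases h1 : 0 < z.1 <;> by_cases h2 : 0 < z.2 <;> simp [hG, h1, h2]
  have hint := integrable_quadrant hg hg hφ
  rw [Measure.prod_restrict] at hint ⊢
  rw [← IntegrableOn, ← integrable_indicator_iff hms, hind] at hint
  rw [← integral_indicator hms, hind]
  refine (integral_mul_mul_comp_sub hint).trans (setIntegral_congr_fun measurableSet_Ioi ?_)
  intro w hw
  dsimp only
  rw [hG, integral_indicator_Ioi_mul_comp_add g hw]

end Quadrant

section KernelCov

variable {φ k g : ℝ → ℝ}

/-- The symmetric second difference of `φ` at `h` with step `w`. -/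
def secondDiff (φ : ℝ → ℝ) (h w : ℝ) : ℝ :=
  φ (h - w) + φ (h + w) - 2 * φ h

/-- The covariance at lag `h` of the stationary moving average of a process with stationary
increments. Here `φ` is the variance of the increments and `k` is the second derivative of the
deterministic autocorrelation of the moving average kernel. -/
noncomputable def kernelCov (φ k : ℝ → ℝ) (h : ℝ) : ℝ :=
  1 / 2 * ∫ w in Set.Ioi (0 : ℝ), k w * secondDiff φ h w

/-- The covariance of the increments over `(t + h - u, t + h]` and `(t - v, t]` of a process with
stationary increments, where `φ` is the (even) variance of its increments. -/
noncomputable def incrementCov (φ : ℝ → ℝ) (h u v : ℝ) : ℝ :=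
  1 / 2 * (φ (h - u) + φ (h + v) - φ (h - u + v) - φ h)

lemma polyGrowth_secondDiff (hφ : PolyGrowth φ) (h : ℝ) : PolyGrowth (secondDiff φ h) := by
  have hsum := ((hφ.comp_sub_left h).add (hφ.comp_add_left h)).add (.const (-(2 * φ h)))
  simp only [← sub_eq_add_neg] at hsum
  exact hsum

lemma integrableOn_mul_polyGrowth (hφ : PolyGrowth φ) (hg : ExpDecay g) :
    IntegrableOn (fun u => g u * φ u) (Set.Ioi 0) := by
  simpa only [mul_comm] using (hg.polyGrowth_mul hφ).integrableOn

lemma integrableOn_mul_secondDiff (hφ : PolyGrowth φ) (hk : ExpDecay k) (h : ℝ) :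
    IntegrableOn (fun w => k w * secondDiff φ h w) (Set.Ioi 0) :=
  integrableOn_mul_polyGrowth (polyGrowth_secondDiff hφ h) hk

lemma mul_mul_incrementCov (φ g : ℝ → ℝ) (h u v : ℝ) :
    g u * g v * incrementCov φ h u v =
      1 / 2 * (g u * φ (h - u) * g v + g u * (g v * φ (h + v)) -
        g u * g v * φ (h - (u - v)) - φ h * (g u * g v)) := by
  rw [incrementCov, sub_sub_eq_add_sub, sub_add_eq_add_sub]
  ring

lemma integrable_quadrant_incrementCov (hφ : PolyGrowth φ) (hg : ExpDecay g) (h : ℝ) :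
    Integrable (fun z : ℝ × ℝ => g z.1 * g z.2 * incrementCov φ h z.1 z.2)
      (halfLine.prod halfLine) := by
  have hgi : Integrable g halfLine := hg.integrableOn
  simp only [mul_mul_incrementCov]
  exact (((((integrableOn_mul_polyGrowth (hφ.comp_sub_left h) hg).mul_prod hgi).add
    (hgi.mul_prod (integrableOn_mul_polyGrowth (hφ.comp_add_left h) hg))).sub
    (integrable_quadrant hg hg (hφ.comp_sub_left h))).sub
    ((hgi.mul_prod hgi).const_mul (φ h))).const_mul (1 / 2)

lemma integral_quadrant_incrementCov (hφ : PolyGrowth φ) (hg : ExpDecay g) (h : ℝ) :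
    ∫ z, g z.1 * g z.2 * incrementCov φ h z.1 z.2 ∂(halfLine.prod halfLine) =
      1 / 2 * ((∫ u in Set.Ioi (0 : ℝ), g u) *
          ((∫ u in Set.Ioi (0 : ℝ), g u * (φ (h - u) + φ (h + u))) -
            (∫ u in Set.Ioi (0 : ℝ), g u) * φ h) -
        ∫ w in Set.Ioi (0 : ℝ), (∫ v in Set.Ioi (0 : ℝ), g v * g (v + w)) *
          (φ (h - w) + φ (h + w))) := by
  have hgi : Integrable g halfLine := hg.integrableOn
  have hsub := integrableOn_mul_polyGrowth (hφ.comp_sub_left h) hg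
  have hadd := integrableOn_mul_polyGrowth (hφ.comp_add_left h) hg
  have hfst : Integrable (fun z : ℝ × ℝ => g z.1 * φ (h - z.1) * g z.2)
      (halfLine.prod halfLine) := hsub.mul_prod hgi
  have hsnd : Integrable (fun z : ℝ × ℝ => g z.1 * (g z.2 * φ (h + z.2)))
      (halfLine.prod halfLine) := hgi.mul_prod hadd
  have hdiag := integrable_quadrant hg hg (hφ.comp_sub_left h)
  have hdiag_eq := integral_quadrant_mul_mul_comp_sub hg (hφ.comp_sub_left h)
  simp only [sub_neg_eq_add] at hdiag_eq
  have hadd_eq : ∫ u in Set.Ioi (0 : ℝ), g u * (φ (h - u) + φ (h + u)) =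
      (∫ u in Set.Ioi (0 : ℝ), g u * φ (h - u)) + ∫ u in Set.Ioi (0 : ℝ), g u * φ (h + u) := by
    simp only [mul_add]
    exact integral_add hsub hadd
  simp only [mul_mul_incrementCov]
  rw [integral_const_mul, integral_sub, integral_sub, integral_add hfst hsnd, integral_const_mul,
    hdiag_eq, hadd_eq, integral_prod_mul (fun u => g u * φ (h - u)) g,
    integral_prod_mul g fun v => g v * φ (h + v), integral_prod_mul g g]
  · ring
  · exact hfst.add hsnd
  · exact hdiag
  · exact (hfst.add hsnd).sub hdiag
  · exact (hgi.mul_prod hgi).const_mul _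

lemma integral_quadrant_incrementCov_eq_kernelCov (hφ : PolyGrowth φ) (hg : ExpDecay g)
    (hk : ExpDecay k) {c : ℝ} (hgc : ∫ u in Set.Ioi (0 : ℝ), g u = -c)
    (hkc : 2 * ∫ w in Set.Ioi (0 : ℝ), k w = c ^ 2)
    (hgk : ∀ w, 0 < w → ∫ v in Set.Ioi (0 : ℝ), g v * g (v + w) = -(c * g w) - k w) (h : ℝ) :
    ∫ z, g z.1 * g z.2 * incrementCov φ h z.1 z.2 ∂(halfLine.prod halfLine) =
      kernelCov φ k h := by
  have hgχ : IntegrableOn (fun w => g w * (φ (h - w) + φ (h + w))) (Set.Ioi 0) :=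
    integrableOn_mul_polyGrowth ((hφ.comp_sub_left h).add (hφ.comp_add_left h)) hg
  have hautocorr : ∫ w in Set.Ioi (0 : ℝ), (∫ v in Set.Ioi (0 : ℝ), g v * g (v + w)) *
      (φ (h - w) + φ (h + w)) =
      ∫ w in Set.Ioi (0 : ℝ), (-c * (g w * (φ (h - w) + φ (h + w))) -
        k w * secondDiff φ h w - k w * (2 * φ h)) := by
    refine setIntegral_congr_fun measurableSet_Ioi fun w hw => ?_
    simp only [hgk w hw, secondDiff]
    ring
  have hksd := integrableOn_mul_secondDiff hφ hk h
  have hgk : IntegrableOn (fun w => -c * (g w * (φ (h - w) + φ (h + w))) -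
    k w * secondDiff φ h w) (Set.Ioi 0) := (hgχ.const_mul (-c)).sub hksd
  rw [integral_quadrant_incrementCov hφ hg, hautocorr,
    integral_sub hgk (hk.integrableOn.mul_const _), integral_sub (hgχ.const_mul _) hksd,
    integral_const_mul, integral_mul_const, hgc, kernelCov]
  linear_combination (1 / 2 * φ h) * hkc

end KernelCov

section IntegrationByParts

variable {θ k : ℝ → ℝ}

lemma integral_mul_eq_neg_integral_mul_deriv {ψ ψ' : ℝ → ℝ} {s : Set ℝ} (hs : s.Countable)
    (hθ : ExpDecay θ) (hk : ExpDecay k) (hd : ∀ t, HasDerivAt θ (k t) t) (hψ : PolyGrowth ψ)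
    (hψ0 : ψ 0 = 0) (hψd : ∀ x, 0 < x → x ∉ s → HasDerivAt ψ (ψ' x) x)
    (hint : IntegrableOn (fun x => θ x * ψ' x) (Set.Ioi 0)) :
    ∫ x in Set.Ioi (0 : ℝ), k x * ψ x = -∫ x in Set.Ioi (0 : ℝ), θ x * ψ' x := by
  have hkψ : IntegrableOn (fun x => k x * ψ x) (Set.Ioi 0) := integrableOn_mul_polyGrowth hψ hk
  have hsum : IntegrableOn (fun x => k x * ψ x + θ x * ψ' x) (Set.Ioi 0) := hkψ.add hint
  have hfinite : ∀ᶠ T in atTop,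
      ψ T * θ T = ∫ x in (0 : ℝ)..T, (k x * ψ x + θ x * ψ' x) := by
    filter_upwards [eventually_ge_atTop 0] with T hT
    rw [integral_eq_of_hasDerivAt_off_countable_of_le (fun x => θ x * ψ x) _ hT hs
      (hθ.continuous.mul hψ.continuous).continuousOn
      (fun x hx => (hd x).mul (hψd x hx.1.1 hx.2))
      ((intervalIntegrable_iff_integrableOn_Ioc_of_le hT).2
        (hsum.mono_set Set.Ioc_subset_Ioi_self)), hψ0]
    ring
  have hzero := tendsto_nhds_unique
    ((hθ.polyGrowth_mul hψ).tendsto_zero.congr' hfinite)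
    (intervalIntegral_tendsto_integral_Ioi 0 hsum tendsto_id)
  rw [integral_add hkψ hint] at hzero
  exact eq_neg_of_add_eq_zero_left hzero.symm

end IntegrationByParts

section OddPow

variable {θ k : ℝ → ℝ} {a s h : ℝ}

/-- The odd power function `sign(x) |x|^s`, up to a constant the derivative of `|x|^(s+1)`. -/
noncomputable def oddPow (s x : ℝ) : ℝ := SignType.sign x * |x| ^ s

lemma oddPow_of_pos {x : ℝ} (hx : 0 < x) : oddPow s x = x ^ s := by
  simp [oddPow, sign_pos hx, abs_of_pos hx]

lemma oddPow_neg (s x : ℝ) : oddPow s (-x) = -oddPow s x := by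
  simp [oddPow, Left.sign_neg]

lemma hasDerivAt_abs_rpow_const (a : ℝ) {x : ℝ} (hx : x ≠ 0) :
    HasDerivAt (fun x => |x| ^ a) (a * oddPow (a - 1) x) x := by
  convert! (hasDerivAt_abs hx).rpow_const (p := a) (Or.inl (abs_ne_zero.2 hx)) using 1
  rw [oddPow]
  ring

lemma hasDerivAt_secondDiff_abs_rpow (a : ℝ) {w : ℝ} (hsub : h - w ≠ 0) (hadd : h + w ≠ 0) :
    HasDerivAt (secondDiff (fun x => |x| ^ a) h)
      (a * oddPow (a - 1) (h + w) - a * oddPow (a - 1) (h - w)) w := by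
  convert! (((hasDerivAt_abs_rpow_const a hsub).comp_const_sub h w).add
    ((hasDerivAt_abs_rpow_const a hadd).comp_const_add h w)).sub_const (2 * |h| ^ a) using 1
  ring

lemma integrableOn_Ioi_comp_add_right {f : ℝ → ℝ} (c d : ℝ)
    (hf : IntegrableOn f (Set.Ioi (c + d))) : IntegrableOn (fun x => f (x + d)) (Set.Ioi c) := by
  have := ((measurePreserving_add_right volume d).integrableOn_comp_preimage
    (measurableEmbedding_addRight d)).2 hf
  rwa [Set.preimage_add_const_Ioi, add_sub_cancel_right] at this

lemma integrableOn_rpow_mul_comp_sub (hθ : ExpDecay θ) (hs : -1 < s) (hh : 0 ≤ h) :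
    IntegrableOn (fun u => u ^ s * θ (u - h)) (Set.Ioi h) :=
  ((hθ.comp_add_right (-h)).integrableOn_rpow_mul hs).mono_set (Set.Ioi_subset_Ioi hh)

lemma integrableOn_rpow_mul_comp_const_sub (hθ : Continuous θ) (hs : -1 < s) (hh : 0 ≤ h) :
    IntegrableOn (fun u => u ^ s * θ (h - u)) (Set.Ioc 0 h) :=
  (intervalIntegrable_iff_integrableOn_Ioc_of_le hh).1
    ((intervalIntegral.intervalIntegrable_rpow' hs).mul_continuousOn (by fun_prop))

lemma mul_oddPow_add_eqOn (θ : ℝ → ℝ) (s : ℝ) (hh : 0 ≤ h) :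
    Set.EqOn (fun w => θ w * oddPow s (h + w)) (fun w => (w + h) ^ s * θ (w + h - h))
      (Set.Ioi 0) := fun w hw => by
  dsimp only
  rw [add_sub_cancel_right, add_comm, oddPow_of_pos (add_pos_of_pos_of_nonneg hw hh), mul_comm]

lemma integrableOn_mul_oddPow_add (hθ : ExpDecay θ) (hs : -1 < s) (hh : 0 ≤ h) :
    IntegrableOn (fun w => θ w * oddPow s (h + w)) (Set.Ioi 0) := by
  have hshift : IntegrableOn (fun u => u ^ s * θ (u - h)) (Set.Ioi (0 + h)) := by
    simpa only [zero_add] using integrableOn_rpow_mul_comp_sub hθ hs hh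
  exact (integrableOn_Ioi_comp_add_right 0 h hshift).congr_fun
    (mul_oddPow_add_eqOn θ s hh).symm measurableSet_Ioi

lemma integral_mul_oddPow_add (θ : ℝ → ℝ) (s : ℝ) (hh : 0 ≤ h) :
    ∫ w in Set.Ioi (0 : ℝ), θ w * oddPow s (h + w) = ∫ u in Set.Ioi h, u ^ s * θ (u - h) := by
  rw [setIntegral_congr_fun measurableSet_Ioi (mul_oddPow_add_eqOn θ s hh),
    setIntegral_Ioi_comp_add_right (fun u => u ^ s * θ (u - h)), zero_add]

lemma mul_oddPow_sub_eqOn_Ioi (θ : ℝ → ℝ) (s h : ℝ) :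
    Set.EqOn (fun w => θ w * oddPow s (h - w)) (fun w => -((w + -h) ^ s * θ (w + -h + h)))
      (Set.Ioi h) := fun w hw => by
  dsimp only
  rw [neg_add_cancel_right, ← neg_sub w h, oddPow_neg, oddPow_of_pos (sub_pos.2 hw),
    ← sub_eq_add_neg]
  ring

lemma mul_oddPow_sub_eqOn_Ioo (θ : ℝ → ℝ) (s h : ℝ) :
    Set.EqOn (fun w => θ w * oddPow s (h - w)) (fun w => (h - w) ^ s * θ (h - (h - w)))
      (Set.Ioo 0 h) := fun w hw => by
  dsimp only
  rw [sub_sub_cancel, oddPow_of_pos (sub_pos.2 hw.2), mul_comm]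

lemma integrableOn_mul_oddPow_sub_Ioi (hθ : ExpDecay θ) (hs : -1 < s) (h : ℝ) :
    IntegrableOn (fun w => θ w * oddPow s (h - w)) (Set.Ioi h) := by
  have hshift : IntegrableOn (fun u => u ^ s * θ (u + h)) (Set.Ioi (h + -h)) := by
    simpa only [add_neg_cancel] using (hθ.comp_add_right h).integrableOn_rpow_mul hs
  exact (integrableOn_Ioi_comp_add_right h (-h) hshift).neg.congr_fun
    (mul_oddPow_sub_eqOn_Ioi θ s h).symm measurableSet_Ioi

lemma integrableOn_mul_oddPow_sub_Ioc (hθ : Continuous θ) (hs : -1 < s) (hh : 0 ≤ h) :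
    IntegrableOn (fun w => θ w * oddPow s (h - w)) (Set.Ioc 0 h) := by
  have hreflect := (((intervalIntegrable_iff_integrableOn_Ioc_of_le hh).2
    (integrableOn_rpow_mul_comp_const_sub hθ hs hh)).comp_sub_left h).symm
  rw [sub_self, sub_zero, intervalIntegrable_iff_integrableOn_Ioo_of_le hh] at hreflect
  rw [integrableOn_Ioc_iff_integrableOn_Ioo]
  exact hreflect.congr_fun (mul_oddPow_sub_eqOn_Ioo θ s h).symm measurableSet_Ioo

lemma integrableOn_mul_oddPow_sub (hθ : ExpDecay θ) (hs : -1 < s) (hh : 0 ≤ h) :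
    IntegrableOn (fun w => θ w * oddPow s (h - w)) (Set.Ioi 0) := by
  rw [← Set.Ioc_union_Ioi_eq_Ioi hh]
  exact (integrableOn_mul_oddPow_sub_Ioc hθ.continuous hs hh).union
    (integrableOn_mul_oddPow_sub_Ioi hθ hs h)

lemma integral_mul_oddPow_sub (hθ : ExpDecay θ) (hs : -1 < s) (hh : 0 ≤ h) :
    ∫ w in Set.Ioi (0 : ℝ), θ w * oddPow s (h - w) =
      (∫ u in Set.Ioc 0 h, u ^ s * θ (h - u)) - ∫ u in Set.Ioi (0 : ℝ), u ^ s * θ (u + h) := by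
  have hIoc : ∫ w in Set.Ioc 0 h, θ w * oddPow s (h - w) =
      ∫ u in Set.Ioc 0 h, u ^ s * θ (h - u) := by
    rw [integral_Ioc_eq_integral_Ioo,
      setIntegral_congr_fun measurableSet_Ioo (mul_oddPow_sub_eqOn_Ioo θ s h),
      ← integral_Ioc_eq_integral_Ioo, ← intervalIntegral.integral_of_le hh,
      ← intervalIntegral.integral_of_le hh,
      intervalIntegral.integral_comp_sub_left (fun u => u ^ s * θ (h - u)), sub_self, sub_zero]
  have hIoi : ∫ w in Set.Ioi h, θ w * oddPow s (h - w) =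
      -∫ u in Set.Ioi (0 : ℝ), u ^ s * θ (u + h) := by
    rw [setIntegral_congr_fun measurableSet_Ioi (mul_oddPow_sub_eqOn_Ioi θ s h), integral_neg,
      setIntegral_Ioi_comp_add_right (fun u => u ^ s * θ (u + h)), add_neg_cancel]
  rw [← Set.Ioc_union_Ioi_eq_Ioi hh, setIntegral_union Set.Ioc_disjoint_Ioi_same measurableSet_Ioi
    (integrableOn_mul_oddPow_sub_Ioc hθ.continuous hs hh)
    (integrableOn_mul_oddPow_sub_Ioi hθ hs h), hIoc, hIoi, Set.Ioc_union_Ioi_eq_Ioi hh,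
    sub_eq_add_neg]

lemma kernelCov_abs_rpow_eq_sub_sub (ha : 0 < a) (hθ : ExpDecay θ) (hk : ExpDecay k)
    (hd : ∀ t, HasDerivAt θ (k t) t) (hh : 0 ≤ h) :
    kernelCov (fun x => |x| ^ a) k h =
      a / 2 * (∫ u in Set.Ioc 0 h, u ^ (a - 1) * θ (h - u)) -
        a / 2 * (∫ u in Set.Ioi h, u ^ (a - 1) * θ (u - h)) -
        a / 2 * ∫ u in Set.Ioi (0 : ℝ), u ^ (a - 1) * θ (u + h) := by
  have hs : -1 < a - 1 := by linarith
  have hadd := (integrableOn_mul_oddPow_add hθ hs hh).const_mul a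
  have hsub := (integrableOn_mul_oddPow_sub hθ hs hh).const_mul a
  have hsplit (w : ℝ) : θ w * (a * oddPow (a - 1) (h + w) - a * oddPow (a - 1) (h - w)) =
      a * (θ w * oddPow (a - 1) (h + w)) - a * (θ w * oddPow (a - 1) (h - w)) := by ring
  have hparts := integral_mul_eq_neg_integral_mul_deriv (Set.countable_singleton h) hθ hk hd
    (polyGrowth_secondDiff (.abs_rpow ha) h) (by simp only [secondDiff, sub_zero, add_zero]; ring)
    (fun w hw hwh => hasDerivAt_secondDiff_abs_rpow a (sub_ne_zero.2 (Ne.symm hwh))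
      (add_pos_of_nonneg_of_pos hh hw).ne')
    (by simp only [hsplit]; exact hadd.sub hsub)
  simp only [hsplit] at hparts
  rw [integral_sub hadd hsub, integral_const_mul, integral_const_mul,
    integral_mul_oddPow_add θ _ hh, integral_mul_oddPow_sub hθ hs hh] at hparts
  rw [kernelCov, hparts]
  ring

end OddPow

section SecondDifference

variable {φ : ℝ → ℝ} {b c : ℝ}

lemma tendsto_secondDiff_div_sq {f f' : ℝ → ℝ} {f'' : ℝ}
    (hf : ∀ᶠ x in 𝓝 c, HasDerivAt f (f' x) x) (hf' : HasDerivAt f' f'' c) :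
    Tendsto (fun x => secondDiff f c x / x ^ 2) (𝓝[>] 0) (𝓝 f'') := by
  have hcont : ContinuousAt f c := hf.self_of_nhds.continuousAt
  have hsub : Tendsto (fun x : ℝ => c - x) (𝓝 0) (𝓝 c) :=
    (continuous_sub_left c).tendsto' 0 c (sub_zero c)
  have hadd : Tendsto (fun x : ℝ => c + x) (𝓝 0) (𝓝 c) :=
    (continuous_const_add c).tendsto' 0 c (add_zero c)
  refine HasDerivAt.lhopital_zero_nhdsGT (f' := fun x => -f' (c - x) + f' (c + x))
    (g' := fun x => 2 * x) ?_ ?_ ?_ ?_ ?_ ?_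
  · filter_upwards [(hsub.eventually hf).filter_mono nhdsWithin_le_nhds,
      (hadd.eventually hf).filter_mono nhdsWithin_le_nhds] with x hx hx'
    exact ((hx.comp_const_sub c x).add (hx'.comp_const_add c x)).sub_const (2 * f c)
  · filter_upwards with x
    simpa using hasDerivAt_pow 2 x
  · filter_upwards [self_mem_nhdsWithin] with x hx
    exact (mul_pos two_pos hx).ne'
  · have hlim := ((hcont.tendsto.comp hsub).add (hcont.tendsto.comp hadd)).sub_const (2 * f c)
    rw [← two_mul, sub_self] at hlim
    exact hlim.mono_left nhdsWithin_le_nhds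
  · refine Tendsto.mono_left ?_ nhdsWithin_le_nhds
    simpa using (continuous_pow 2).tendsto (0 : ℝ)
  · have hd : HasDerivAt (fun x => -f' (c - x) + f' (c + x)) (2 * f'') 0 := by
      have h1 : HasDerivAt f' f'' (c - 0) := by rwa [sub_zero]
      have h2 : HasDerivAt f' f'' (c + 0) := by rwa [add_zero]
      convert! ((h1.comp_const_sub c 0).neg).add (h2.comp_const_add c 0) using 1
      ring
    have hslope := hd.tendsto_slope_zero_right.const_mul (1 / 2)
    simp only [zero_add, sub_zero, add_zero, neg_add_cancel, smul_eq_mul] at hslope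
    convert! hslope using 2 <;> ring

/-- `φ` is positively homogeneous of degree `b`. -/
def IsPosHomogeneous (b : ℝ) (φ : ℝ → ℝ) : Prop :=
  ∀ t, 0 < t → ∀ x, φ (t * x) = t ^ b * φ x

namespace IsPosHomogeneous

lemma secondDiff_eq (hφ : IsPosHomogeneous b φ) {h : ℝ} (hh : 0 < h) (w : ℝ) :
    secondDiff φ h w = h ^ b * secondDiff φ 1 (w / h) := by
  have hsub := hφ h hh (1 - w / h)
  have hadd := hφ h hh (1 + w / h)
  have hone := hφ h hh 1
  rw [mul_sub, mul_one, mul_div_cancel₀ _ hh.ne'] at hsub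
  rw [mul_add, mul_one, mul_div_cancel₀ _ hh.ne'] at hadd
  rw [mul_one] at hone
  rw [secondDiff, secondDiff, hsub, hadd, hone]
  ring

lemma tendsto_secondDiff_div_sq (hφ : IsPosHomogeneous b φ) :
    Tendsto (fun x => secondDiff φ 1 x / x ^ 2) (𝓝[>] 0) (𝓝 (φ 1 * (b * (b - 1)))) := by
  have hpos : ∀ᶠ x : ℝ in 𝓝 1, 0 < x := lt_mem_nhds one_pos
  have heq (x : ℝ) (hx : 0 < x) : φ x = φ 1 * x ^ b := by
    rw [mul_comm, ← hφ x hx, mul_one]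
  have hd (s x : ℝ) (hx : 0 < x) : HasDerivAt (fun x : ℝ => x ^ s) (s * x ^ (s - 1)) x :=
    Real.hasDerivAt_rpow_const (Or.inl hx.ne')
  refine Carfima.tendsto_secondDiff_div_sq (f' := fun x => φ 1 * (b * x ^ (b - 1))) ?_ ?_
  · filter_upwards [hpos.eventually_nhds, hpos] with x hx hx0
    exact ((hd b x hx0).const_mul (φ 1)).congr_of_eventuallyEq (hx.mono heq)
  · simpa using ((hd (b - 1) 1 one_pos).const_mul b).const_mul (φ 1)

end IsPosHomogeneous

lemma exists_abs_le_sq_mul_pow_of_tendsto {f : ℝ → ℝ} {L : ℝ} (hf : PolyGrowth f)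
    (hlim : Tendsto (fun x => f x / x ^ 2) (𝓝[>] 0) (𝓝 L)) :
    ∃ C, 0 ≤ C ∧ ∃ n : ℕ, ∀ x, 0 < x → |f x| ≤ C * (x ^ 2 * (1 + x) ^ n) := by
  obtain ⟨D, hD, n, hn⟩ := hf.exists_nonneg_bound
  obtain ⟨d, hd, hsmall⟩ := mem_nhdsGT_iff_exists_Ioc_subset.1
    (hlim.abs.eventually (gt_mem_nhds (lt_add_one |L|)))
  have hd0 : 0 < d := hd
  refine ⟨|L| + 1 + D / d ^ 2, by positivity, n, fun x hx => ?_⟩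
  have hpow : 1 ≤ (1 + x) ^ n := one_le_pow₀ (by linarith)
  rcases le_total x d with hxd | hxd
  · have hle : |f x / x ^ 2| < |L| + 1 := hsmall ⟨hx, hxd⟩
    rw [abs_div, abs_of_pos (pow_pos hx 2), div_lt_iff₀ (pow_pos hx 2)] at hle
    calc |f x| ≤ (|L| + 1) * (x ^ 2 * 1) := by rw [mul_one]; exact hle.le
      _ ≤ (|L| + 1 + D / d ^ 2) * (x ^ 2 * (1 + x) ^ n) :=
        mul_le_mul (le_add_of_nonneg_right (by positivity)) (by gcongr) (by positivity)
          (by positivity)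
  · calc |f x| ≤ D * (1 + x) ^ n := by simpa only [abs_of_pos hx] using hn x
      _ = D / d ^ 2 * (d ^ 2 * (1 + x) ^ n) := by field_simp
      _ ≤ (|L| + 1 + D / d ^ 2) * (x ^ 2 * (1 + x) ^ n) := by
        gcongr
        linarith [abs_nonneg L]

lemma exists_abs_secondDiff_le (hφ : PolyGrowth φ) :
    ∃ C, 0 ≤ C ∧ ∃ n : ℕ, ∀ h w, |secondDiff φ h w| ≤ C * ((1 + |h|) ^ n * (1 + |w|) ^ n) := by
  obtain ⟨C, hC, n, hn⟩ := hφ.exists_nonneg_bound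
  refine ⟨4 * C, by positivity, n, fun h w => ?_⟩
  have hsub : |φ (h - w)| ≤ C * ((1 + |h|) ^ n * (1 + |w|) ^ n) := by
    refine (hn _).trans ?_
    rw [← mul_pow]
    gcongr
    exact one_add_abs_sub_le h w
  have hadd : |φ (h + w)| ≤ C * ((1 + |h|) ^ n * (1 + |w|) ^ n) := by
    refine (hn _).trans ?_
    rw [← mul_pow]
    gcongr
    exact one_add_abs_add_le h w
  have hmid : |φ h| ≤ C * ((1 + |h|) ^ n * (1 + |w|) ^ n) := by
    refine (hn h).trans ?_
    gcongr
    exact le_mul_of_one_le_right (by positivity) (one_le_pow₀ (by linarith [abs_nonneg w]))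
  rw [abs_le] at hsub hadd hmid
  rw [secondDiff, abs_le]
  constructor <;> linarith

lemma continuous_uncurry_secondDiff (hφ : Continuous φ) :
    Continuous fun z : ℝ × ℝ => secondDiff φ z.1 z.2 := by
  unfold secondDiff
  fun_prop

end SecondDifference

section Asymptotics

variable {φ k : ℝ → ℝ} {a b : ℝ}

lemma exists_integrableOn_bound_mul_secondDiff_div {L : ℝ} (hφ : PolyGrowth φ) (hk : ExpDecay k)
    (hlim : Tendsto (fun x => secondDiff φ 1 x / x ^ 2) (𝓝[>] 0) (𝓝 L)) :
    ∃ D : ℝ → ℝ, IntegrableOn D (Set.Ioi 0) ∧ ∀ h, 1 ≤ h → ∀ w, 0 < w →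
      ‖k w * (h ^ 2 * secondDiff φ 1 (w / h))‖ ≤ D w := by
  obtain ⟨C, hC, n, hn⟩ := exists_abs_le_sq_mul_pow_of_tendsto (polyGrowth_secondDiff hφ 1) hlim
  refine ⟨fun w => C * |(1 + |w|) ^ n * (w ^ 2 * k w)|, ((hk.polyGrowth_mul (.pow 2)).polyGrowth_mul
    (.one_add_abs_pow n)).integrableOn.abs.const_mul C, fun h hh w hw => ?_⟩
  have hh0 : 0 < h := one_pos.trans_le hh
  calc ‖k w * (h ^ 2 * secondDiff φ 1 (w / h))‖
      = |k w| * (h ^ 2 * |secondDiff φ 1 (w / h)|) := by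
        simp only [norm_mul, Real.norm_eq_abs, abs_pow, sq_abs]
    _ ≤ |k w| * (h ^ 2 * (C * ((w / h) ^ 2 * (1 + w / h) ^ n))) := by
      gcongr
      exact hn _ (div_pos hw hh0)
    _ = |k w| * (C * (w ^ 2 * (1 + w / h) ^ n)) := by field_simp
    _ ≤ |k w| * (C * (w ^ 2 * (1 + w) ^ n)) := by
      gcongr
      exact div_le_self hw.le hh
    _ = C * |(1 + |w|) ^ n * (w ^ 2 * k w)| := by
      rw [abs_mul, abs_mul, abs_of_pos hw, abs_of_pos (by positivity : 0 < (1 + w) ^ n),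
        abs_of_pos (by positivity : 0 < w ^ 2)]
      ring

lemma tendsto_integral_mul_secondDiff_div {L : ℝ} (hφ : PolyGrowth φ) (hk : ExpDecay k)
    (hlim : Tendsto (fun x => secondDiff φ 1 x / x ^ 2) (𝓝[>] 0) (𝓝 L)) :
    Tendsto (fun h => ∫ w in Set.Ioi (0 : ℝ), k w * (h ^ 2 * secondDiff φ 1 (w / h))) atTop
      (𝓝 (L * ∫ w in Set.Ioi (0 : ℝ), w ^ 2 * k w)) := by
  obtain ⟨D, hD, hbound⟩ := exists_integrableOn_bound_mul_secondDiff_div hφ hk hlim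
  rw [← integral_const_mul]
  refine tendsto_integral_filter_of_dominated_convergence D ?_ ?_ hD ?_
  · filter_upwards with h
    have := hk.continuous
    have := (polyGrowth_secondDiff hφ 1).continuous
    exact Continuous.aestronglyMeasurable (by fun_prop)
  · filter_upwards [eventually_ge_atTop 1] with h hh
    filter_upwards [ae_restrict_mem measurableSet_Ioi] with w hw using hbound h hh w hw
  · filter_upwards [ae_restrict_mem measurableSet_Ioi] with w (hw : 0 < w)
    have hzero : Tendsto (fun h : ℝ => w / h) atTop (𝓝[>] 0) :=
      tendsto_nhdsWithin_iff.2 ⟨tendsto_const_nhds.div_atTop tendsto_id,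
        (eventually_gt_atTop 0).mono fun h hh => div_pos hw hh⟩
    refine ((hlim.comp hzero).mul_const (w ^ 2 * k w)).congr' ?_
    filter_upwards [eventually_gt_atTop 0] with h hh
    simp only [Function.comp_apply]
    field_simp

lemma tendsto_kernelCov (hφ : PolyGrowth φ) (hhom : IsPosHomogeneous b φ) (hk : ExpDecay k) :
    Tendsto (fun h => h ^ (2 - b) * kernelCov φ k h) atTop
      (𝓝 (1 / 2 * (φ 1 * (b * (b - 1)) * ∫ w in Set.Ioi (0 : ℝ), w ^ 2 * k w))) := by
  refine ((tendsto_integral_mul_secondDiff_div hφ hk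
    hhom.tendsto_secondDiff_div_sq).const_mul (1 / 2)).congr' ?_
  filter_upwards [eventually_gt_atTop 0] with h hh
  have hpow : h ^ (2 - b) * h ^ b = h ^ 2 := by
    rw [← Real.rpow_add hh, sub_add_cancel, Real.rpow_two]
  rw [kernelCov, mul_left_comm, ← integral_const_mul (h ^ (2 - b))]
  congr 2
  funext w
  rw [hhom.secondDiff_eq hh, ← hpow]
  ring

lemma integrable_mul_secondDiff_prod (hφ : PolyGrowth φ) (hk : ExpDecay k) (T : ℝ) :
    Integrable (fun z : ℝ × ℝ => k z.2 * secondDiff φ z.1 z.2)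
      ((volume.restrict (Set.uIoc 0 T)).prod halfLine) := by
  obtain ⟨C, hC, n, hn⟩ := exists_abs_secondDiff_le hφ
  have hweight : IntegrableOn (fun h : ℝ => C * (1 + |h|) ^ n) (Set.uIoc 0 T) :=
    intervalIntegrable_iff.1 (Continuous.intervalIntegrable (by fun_prop) 0 T)
  have hdom : Integrable (fun z : ℝ × ℝ => C * (1 + |z.1|) ^ n * ((1 + |z.2|) ^ n * k z.2))
      ((volume.restrict (Set.uIoc 0 T)).prod halfLine) :=
    Integrable.mul_prod hweight (hk.polyGrowth_mul (.one_add_abs_pow n)).integrableOn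
  refine hdom.mono ((hk.continuous.comp continuous_snd).mul
    (continuous_uncurry_secondDiff hφ.continuous)).aestronglyMeasurable (ae_of_all _ fun z => ?_)
  calc ‖k z.2 * secondDiff φ z.1 z.2‖ = |k z.2| * |secondDiff φ z.1 z.2| := norm_mul _ _
    _ ≤ |k z.2| * (C * ((1 + |z.1|) ^ n * (1 + |z.2|) ^ n)) := by
      gcongr
      exact hn _ _
    _ = ‖C * (1 + |z.1|) ^ n * ((1 + |z.2|) ^ n * k z.2)‖ := by
      simp only [norm_mul, norm_pow, Real.norm_eq_abs, abs_of_nonneg hC]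
      rw [abs_of_pos (by positivity : 0 < 1 + |z.1|), abs_of_pos (by positivity : 0 < 1 + |z.2|)]
      ring

lemma integral_secondDiff {Φ : ℝ → ℝ} (hφ : Continuous φ) (hd : ∀ x, HasDerivAt Φ (φ x) x)
    (T w : ℝ) : ∫ h in (0 : ℝ)..T, secondDiff φ h w = secondDiff Φ T w - secondDiff Φ 0 w := by
  refine intervalIntegral.integral_eq_sub_of_hasDerivAt (f := fun h => secondDiff Φ h w)
    (fun h _ => ?_) (Continuous.intervalIntegrable (by unfold secondDiff; fun_prop) _ _)
  exact (((hd (h - w)).comp_sub_const h w).add ((hd (h + w)).comp_add_const h w)).sub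
    ((hd h).const_mul 2)

lemma integral_kernelCov {Φ : ℝ → ℝ} (hφ : PolyGrowth φ) (hΦ : PolyGrowth Φ)
    (hd : ∀ x, HasDerivAt Φ (φ x) x) (hk : ExpDecay k) (T : ℝ) :
    ∫ h in (0 : ℝ)..T, kernelCov φ k h = kernelCov Φ k T - kernelCov Φ k 0 := by
  simp only [kernelCov]
  rw [intervalIntegral.integral_const_mul,
    intervalIntegral_integral_swap (integrable_mul_secondDiff_prod hφ hk T), ← mul_sub,
    ← integral_sub (integrableOn_mul_secondDiff hΦ hk T) (integrableOn_mul_secondDiff hΦ hk 0)]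
  simp only [intervalIntegral.integral_const_mul, integral_secondDiff hφ.continuous hd, mul_sub]

lemma locallyIntegrable_kernelCov (hφ : PolyGrowth φ) (hk : ExpDecay k) :
    LocallyIntegrable (kernelCov φ k) := by
  have hint (T : ℝ) : IntervalIntegrable (kernelCov φ k) volume 0 T := intervalIntegrable_iff.2
    ((integrable_mul_secondDiff_prod hφ hk T).integral_prod_left.const_mul (1 / 2))
  exact fun x => ⟨Set.Ioc (x - 1) (x + 1), Ioc_mem_nhds (by linarith) (by linarith),
    ((hint (x - 1)).symm.trans (hint (x + 1))).1⟩

lemma PolyGrowth.primitive (hφ : PolyGrowth φ) : PolyGrowth fun x => ∫ t in (0 : ℝ)..x, φ t := by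
  obtain ⟨C, hC, n, hn⟩ := hφ.exists_nonneg_bound
  refine ⟨intervalIntegral.continuous_primitive
    (fun a b => hφ.continuous.intervalIntegrable a b) 0, C, n + 1, fun x => ?_⟩
  have hbound : ∀ t ∈ Set.uIoc 0 x, ‖φ t‖ ≤ C * (1 + |x|) ^ n := fun t ht => by
    refine (hn t).trans ?_
    have : |t| ≤ |x| := by simpa using Set.abs_sub_left_of_mem_uIcc (Set.uIoc_subset_uIcc ht)
    gcongr
  calc |∫ t in (0 : ℝ)..x, φ t| ≤ C * (1 + |x|) ^ n * |x - 0| :=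
        intervalIntegral.norm_integral_le_of_norm_le_const hbound
    _ ≤ C * (1 + |x|) ^ n * (1 + |x|) := by
      rw [sub_zero]
      gcongr
      linarith
    _ = C * (1 + |x|) ^ (n + 1) := by ring

lemma IsPosHomogeneous.primitive (hφ : IsPosHomogeneous b φ) :
    IsPosHomogeneous (b + 1) fun x => ∫ t in (0 : ℝ)..x, φ t := by
  intro t ht x
  have hscale := intervalIntegral.integral_comp_mul_left (a := 0) (b := x) φ ht.ne'
  simp only [hφ t ht, mul_zero, intervalIntegral.integral_const_mul, smul_eq_mul] at hscale
  rw [Real.rpow_add_one ht.ne', mul_right_comm, hscale]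
  field_simp

lemma tendsto_integral_kernelCov (hφ : PolyGrowth φ) (heven : ∀ x, φ (-x) = φ x)
    (hhom : IsPosHomogeneous b φ) (hk : ExpDecay k) :
    Tendsto (fun T => T ^ (1 - b) * ∫ h in (0 : ℝ)..T, kernelCov φ k h) atTop
      (𝓝 (1 / 2 * ((∫ t in (0 : ℝ)..1, φ t) * ((b + 1) * b) *
        ∫ w in Set.Ioi (0 : ℝ), w ^ 2 * k w))) := by
  have hodd (x : ℝ) : ∫ t in (0 : ℝ)..-x, φ t = -∫ t in (0 : ℝ)..x, φ t := by
    have := intervalIntegral.integral_comp_neg (a := 0) (b := x) φ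
    simp only [heven, neg_zero] at this
    rw [this, intervalIntegral.integral_symm]
  have hzero : kernelCov (fun x => ∫ t in (0 : ℝ)..x, φ t) k 0 = 0 := by
    simp [kernelCov, secondDiff, hodd]
  have hlim := tendsto_kernelCov hφ.primitive hhom.primitive hk
  rw [add_sub_cancel_right, add_comm b 1, ← sub_sub, show (2 : ℝ) - 1 = 1 by norm_num] at hlim
  rw [add_comm b 1]
  refine hlim.congr fun T => ?_
  rw [integral_kernelCov hφ hφ.primitive (fun x => hφ.continuous.integral_hasStrictDerivAt 0 x
    |>.hasDerivAt) hk, hzero, sub_zero]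

end Asymptotics

section Memory

variable {k : ℝ → ℝ} {a : ℝ}

lemma isPosHomogeneous_abs_rpow (a : ℝ) : IsPosHomogeneous a fun x => |x| ^ a := fun t ht x => by
  dsimp only
  rw [abs_mul, abs_of_pos ht, Real.mul_rpow ht.le (abs_nonneg x)]

lemma isBigO_kernelCov_abs_rpow (ha : 0 < a) (hk : ExpDecay k) :
    kernelCov (fun x => |x| ^ a) k =O[atTop] fun h => h ^ (a - 2) := by
  have hbounded := (tendsto_kernelCov (.abs_rpow ha) (isPosHomogeneous_abs_rpow a) hk).isBigO_one ℝ
  refine ((Asymptotics.isBigO_refl (fun h : ℝ => h ^ (a - 2)) atTop).mul hbounded).congr' ?_ ?_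
  · filter_upwards [eventually_gt_atTop 0] with h hh
    rw [← mul_assoc, ← Real.rpow_add hh, sub_add_sub_cancel, sub_self, Real.rpow_zero, one_mul]
  · simp

lemma integrableOn_kernelCov_abs_rpow (ha0 : 0 < a) (ha : a < 1) (hk : ExpDecay k) :
    IntegrableOn (kernelCov (fun x => |x| ^ a) k) (Set.Ioi 0) := by
  have hloc := (locallyIntegrable_kernelCov (.abs_rpow ha0) hk).locallyIntegrableOn (Set.Ici 0)
  exact (hloc.integrableOn_of_isBigO_atTop (isBigO_kernelCov_abs_rpow ha0 hk)
    (integrableAtFilter_rpow_atTop_iff.2 (by linarith))).mono_set Set.Ioi_subset_Ici_self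

lemma eventually_lt_zero_of_tendsto_rpow_mul {γ : ℝ → ℝ} {s L : ℝ}
    (h : Tendsto (fun x => x ^ s * γ x) atTop (𝓝 L)) (hL : L < 0) : ∀ᶠ x in atTop, γ x < 0 := by
  filter_upwards [h.eventually (gt_mem_nhds hL), eventually_gt_atTop 0] with x hx hx0
  exact neg_of_mul_neg_right hx (Real.rpow_nonneg hx0.le s)

lemma eventually_pos_of_tendsto_rpow_mul {γ : ℝ → ℝ} {s L : ℝ}
    (h : Tendsto (fun x => x ^ s * γ x) atTop (𝓝 L)) (hL : 0 < L) : ∀ᶠ x in atTop, 0 < γ x := by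
  filter_upwards [h.eventually (lt_mem_nhds hL), eventually_gt_atTop 0] with x hx hx0
  exact pos_of_mul_pos_right hx (Real.rpow_nonneg hx0.le s)

lemma isAntipersistent_kernelCov (ha0 : 0 < a) (ha : a < 1) (hk : ExpDecay k)
    (hpos : 0 < ∫ w in Set.Ioi (0 : ℝ), w ^ 2 * k w) :
    IsAntipersistent (kernelCov (fun x => |x| ^ a) k) := by
  have hφ : PolyGrowth fun x => |x| ^ a := .abs_rpow ha0
  have hinteg := integrableOn_kernelCov_abs_rpow ha0 ha hk
  refine ⟨hinteg, ?_, eventually_lt_zero_of_tendsto_rpow_mul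
    (tendsto_kernelCov hφ (isPosHomogeneous_abs_rpow a) hk) ?_⟩
  · have hlim := (tendsto_rpow_neg_atTop (sub_pos.2 ha)).mul
      (tendsto_integral_kernelCov hφ (fun x => by rw [abs_neg]) (isPosHomogeneous_abs_rpow a) hk)
    rw [zero_mul] at hlim
    refine tendsto_nhds_unique (intervalIntegral_tendsto_integral_Ioi 0 hinteg tendsto_id)
      (hlim.congr' ?_)
    filter_upwards [eventually_gt_atTop 0] with T hT
    rw [← mul_assoc, ← Real.rpow_add hT, neg_add_cancel, Real.rpow_zero, one_mul, id_eq]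
  · rw [abs_one, Real.one_rpow, one_mul]
    exact mul_neg_of_pos_of_neg one_half_pos (mul_neg_of_neg_of_pos
      (mul_neg_of_pos_of_neg ha0 (sub_neg.2 ha)) hpos)

lemma isLongMemory_kernelCov (ha : 1 < a) (hk : ExpDecay k)
    (hpos : 0 < ∫ w in Set.Ioi (0 : ℝ), w ^ 2 * k w) :
    IsLongMemory (kernelCov (fun x => |x| ^ a) k) := by
  have ha0 : 0 < a := one_pos.trans ha
  have ha1 : 0 < a - 1 := sub_pos.2 ha
  have hφ : PolyGrowth fun x => |x| ^ a := .abs_rpow ha0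
  refine ⟨eventually_pos_of_tendsto_rpow_mul
    (tendsto_kernelCov hφ (isPosHomogeneous_abs_rpow a) hk) ?_, ?_⟩
  · rw [abs_one, Real.one_rpow]
    positivity
  · have hprim : 0 < ∫ t in (0 : ℝ)..1, |t| ^ a :=
      intervalIntegral.intervalIntegral_pos_of_pos_on (hφ.continuous.intervalIntegrable 0 1)
        (fun t ht => Real.rpow_pos_of_pos (abs_pos.2 ht.1.ne') a) one_pos
    refine ((tendsto_rpow_atTop ha1).atTop_mul_pos (by positivity) (tendsto_integral_kernelCov hφ
      (fun x => by rw [abs_neg]) (isPosHomogeneous_abs_rpow a) hk)).congr' ?_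
    filter_upwards [eventually_gt_atTop 0] with T hT
    rw [← mul_assoc, ← Real.rpow_add hT, sub_add_sub_cancel, sub_self, Real.rpow_zero, one_mul]

end Memory

section MatrixIntegral

variable {p : ℕ} {F : ℝ → Matrix (Fin p) (Fin p) ℝ} {S : Set ℝ}

lemma dotProduct_matIntegral_mulVec (hF : MatIntegrableOn F S) (x y : Fin p → ℝ) :
    x ⬝ᵥ matIntegral F S *ᵥ y = ∫ u in S, x ⬝ᵥ F u *ᵥ y := by
  have hi (i j) : IntegrableOn (fun u => x i * (F u i j * y j)) S :=
    ((hF i j).mul_const _).const_mul _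
  simp only [dotProduct, Matrix.mulVec, Finset.mul_sum, matIntegral, Matrix.of_apply]
  rw [integral_finsetSum _ fun i _ => integrable_finsetSum _ fun j _ => hi i j]
  refine Finset.sum_congr rfl fun i _ => ?_
  rw [integral_finsetSum _ fun j _ => hi i j]
  refine Finset.sum_congr rfl fun j _ => ?_
  rw [integral_const_mul, integral_mul_const]

lemma dotProduct_mul_matIntegral_mul_mulVec (hF : MatIntegrableOn F S) (x y : Fin p → ℝ)
    (M N : Matrix (Fin p) (Fin p) ℝ) :
    x ⬝ᵥ (M * matIntegral F S * N) *ᵥ y = ∫ u in S, x ⬝ᵥ (M * F u * N) *ᵥ y := by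
  simp only [← Matrix.mulVec_mulVec, Matrix.dotProduct_mulVec x M]
  exact dotProduct_matIntegral_mulVec hF _ _

end MatrixIntegral

section StationaryVariance

variable {p : ℕ} {A : Matrix (Fin p) (Fin p) ℝ}

lemma vStarIntegrand_eq (A : Matrix (Fin p) (Fin p) ℝ) (σ u : ℝ) :
    vStarIntegrand A σ u =
      σ ^ 2 • Matrix.vecMulVec (expA A u *ᵥ delta p) (expA A u *ᵥ delta p) := by
  rw [vStarIntegrand, expA_transpose, Matrix.mul_vecMulVec, Matrix.vecMulVec_mul,
    Matrix.vecMul_transpose]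

lemma matIntegrableOn_vStarIntegrand (hA : IsStable A) (σ : ℝ) :
    MatIntegrableOn (vStarIntegrand A σ) (Set.Ioi 0) := by
  intro i j
  have hmul := (hA.expDecay_expForm (Pi.single i 1) (delta p)).mul
    (hA.expDecay_expForm (Pi.single j 1) (delta p))
  simpa [vStarIntegrand_eq, Matrix.vecMulVec_apply, expForm] using
    (hmul.const_mul (σ ^ 2)).integrableOn

lemma dotProduct_vStar_mulVec (hA : IsStable A) (σ : ℝ) (x y : Fin p → ℝ) :
    x ⬝ᵥ vStar A σ *ᵥ y =
      σ ^ 2 * ∫ u in Set.Ioi (0 : ℝ), expForm A x (delta p) u * expForm A y (delta p) u := by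
  rw [vStar, dotProduct_matIntegral_mulVec (matIntegrableOn_vStarIntegrand hA σ),
    ← integral_const_mul]
  congr 1 with u
  rw [vStarIntegrand_eq, Matrix.smul_mulVec, Matrix.vecMulVec_mulVec, dotProduct_smul,
    dotProduct_smul, expForm, expForm, dotProduct_comm y]
  rfl

lemma expForm_mulVec_vStar_mulVec (hA : IsStable A) (σ : ℝ) (b : Fin p → ℝ)
    {M : Matrix (Fin p) (Fin p) ℝ} (hM : Commute M A) (w : ℝ) :
    expForm A b (M *ᵥ vStar A σ *ᵥ b) w =
      σ ^ 2 * ∫ u in Set.Ioi (0 : ℝ),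
        expForm A b (M *ᵥ delta p) (u + w) * expForm A b (delta p) u := by
  have hshift (u : ℝ) : expForm A (b ᵥ* (expA A w * M)) (delta p) u =
      expForm A b (M *ᵥ delta p) (u + w) := by
    rw [add_comm, expForm, expForm, ← Matrix.dotProduct_mulVec, Matrix.mulVec_mulVec,
      Matrix.mulVec_mulVec, mul_assoc, (commute_expA hM u).eq, ← mul_assoc, ← expA_add]
  rw [expForm, Matrix.mulVec_mulVec, Matrix.dotProduct_mulVec, dotProduct_vStar_mulVec hA]
  simp only [hshift]

end StationaryVariance

section AutocovarianceKernel

variable {p : ℕ} {A : Matrix (Fin p) (Fin p) ℝ}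

lemma ExpDecay.integral_sq_mul_deriv {f f₁ f₂ f₃ : ℝ → ℝ} (hf : ExpDecay f) (hf₁ : ExpDecay f₁)
    (hf₂ : ExpDecay f₂) (hf₃ : ExpDecay f₃) (hd : ∀ t, HasDerivAt f (f₁ t) t)
    (hd₁ : ∀ t, HasDerivAt f₁ (f₂ t) t) (hd₂ : ∀ t, HasDerivAt f₂ (f₃ t) t) :
    ∫ w in Set.Ioi (0 : ℝ), w ^ 2 * f₃ w = -(2 * f 0) := by
  have hlim : Tendsto (fun w => w ^ 2 * f₂ w - 2 * (w ^ 1 * f₁ w) + 2 * f w) atTop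
      (𝓝 (0 - 2 * 0 + 2 * 0)) :=
    (((hf₂.polyGrowth_mul (.pow 2)).tendsto_zero).sub
      ((hf₁.polyGrowth_mul (.pow 1)).tendsto_zero.const_mul 2)).add (hf.tendsto_zero.const_mul 2)
  rw [integral_Ioi_of_hasDerivAt_of_tendsto' (fun w _ => ?_)
    (hf₃.polyGrowth_mul (.pow 2)).integrableOn hlim]
  · ring
  · convert! (((hasDerivAt_pow 2 w).mul (hd₂ w)).sub
      (((hasDerivAt_pow 1 w).mul (hd₁ w)).const_mul 2)).add ((hd w).const_mul 2) using 1
    push_cast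
    ring

lemma integral_expForm_mul_expForm_mulVec (hA : IsStable A) (b x : Fin p → ℝ) :
    ∫ u in Set.Ioi (0 : ℝ), expForm A b (A *ᵥ x) u * expForm A b x u = -((b ⬝ᵥ x) ^ 2 / 2) := by
  have hx := hA.expDecay_expForm b x
  have hAx := hA.expDecay_expForm b (A *ᵥ x)
  rw [((hx.mul hx).const_mul (1 / 2)).integral_deriv (hAx.mul hx), expForm_zero]
  · ring
  · intro t
    have hd := hasDerivAt_expForm A b x t
    convert! (hd.mul hd).const_mul (1 / 2) using 1
    ring

lemma integral_expForm_mulVec_mul_comp_add (hA : IsStable A) (b x : Fin p → ℝ) (w : ℝ) :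
    ∫ u in Set.Ioi (0 : ℝ), expForm A b (A *ᵥ x) u * expForm A b (A *ᵥ x) (u + w) =
      -(b ⬝ᵥ x * expForm A b (A *ᵥ x) w) -
        ∫ u in Set.Ioi (0 : ℝ), expForm A b (A *ᵥ A *ᵥ x) (u + w) * expForm A b x u := by
  have hx := hA.expDecay_expForm b x
  have hAx := hA.expDecay_expForm b (A *ᵥ x)
  have hfst := (hAx.mul (hAx.comp_add_right w)).integrableOn
  have hsnd := (((hA.expDecay_expForm b (A *ᵥ A *ᵥ x)).comp_add_right w).mul hx).integrableOn
  rw [eq_sub_iff_add_eq, ← integral_add hfst hsnd]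
  refine (integral_Ioi_of_hasDerivAt_of_tendsto'
    (fun u _ => ?_) (hfst.add hsnd) (hx.mul (hAx.comp_add_right w)).tendsto_zero).trans ?_
  · convert! (hasDerivAt_expForm A b x u).mul
      ((hasDerivAt_expForm A b (A *ᵥ x) (u + w)).comp_add_const u w) using 1
    simp only [Pi.add_apply]
    ring
  · rw [expForm_zero, zero_add, zero_sub]

/-- The derivative of the impulse response `u ↦ σ b' e^{Au} δ_p` of the model. -/
noncomputable def impulseDeriv (A : Matrix (Fin p) (Fin p) ℝ) (σ : ℝ) (b : Fin p → ℝ) (u : ℝ) :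
    ℝ :=
  σ * expForm A b (A *ᵥ delta p) u

/-- The second derivative of `w ↦ b' e^{Aw} V* b`, the autocovariance function of the model driven
by Brownian motion. -/
noncomputable def autocovKernel (A : Matrix (Fin p) (Fin p) ℝ) (σ : ℝ) (b : Fin p → ℝ) : ℝ → ℝ :=
  expForm A b (A *ᵥ A *ᵥ vStar A σ *ᵥ b)

lemma expDecay_impulseDeriv (hA : IsStable A) (σ : ℝ) (b : Fin p → ℝ) :
    ExpDecay (impulseDeriv A σ b) :=
  (hA.expDecay_expForm _ _).const_mul σ

lemma expDecay_autocovKernel (hA : IsStable A) (σ : ℝ) (b : Fin p → ℝ) :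
    ExpDecay (autocovKernel A σ b) :=
  hA.expDecay_expForm _ _

lemma integral_impulseDeriv (hA : IsStable A) (σ : ℝ) (b : Fin p → ℝ) :
    ∫ u in Set.Ioi (0 : ℝ), impulseDeriv A σ b u = -(σ * b ⬝ᵥ delta p) := by
  simp only [impulseDeriv]
  rw [integral_const_mul, (hA.expDecay_expForm b (delta p)).integral_deriv
    (hA.expDecay_expForm b _) (hasDerivAt_expForm A b _), expForm_zero, mul_neg]

lemma integral_autocovKernel (hA : IsStable A) (σ : ℝ) (b : Fin p → ℝ) :
    2 * ∫ w in Set.Ioi (0 : ℝ), autocovKernel A σ b w = (σ * b ⬝ᵥ delta p) ^ 2 := by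
  have hzero := expForm_mulVec_vStar_mulVec hA σ b (Commute.refl A) 0
  simp only [add_zero, integral_expForm_mul_expForm_mulVec hA b (delta p)] at hzero
  rw [(hA.expDecay_expForm b (A *ᵥ vStar A σ *ᵥ b)).integral_deriv (expDecay_autocovKernel hA σ b)
    (hasDerivAt_expForm A b _), hzero]
  ring

lemma integral_impulseDeriv_mul_comp_add (hA : IsStable A) (σ : ℝ) (b : Fin p → ℝ) (w : ℝ) :
    ∫ v in Set.Ioi (0 : ℝ), impulseDeriv A σ b v * impulseDeriv A σ b (v + w) =
      -(σ * b ⬝ᵥ delta p * impulseDeriv A σ b w) - autocovKernel A σ b w := by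
  have hkernel := expForm_mulVec_vStar_mulVec hA σ b ((Commute.refl A).mul_left (Commute.refl A)) w
  simp only [← Matrix.mulVec_mulVec] at hkernel
  simp only [impulseDeriv, mul_mul_mul_comm σ _ σ]
  rw [integral_const_mul, integral_expForm_mulVec_mul_comp_add hA, autocovKernel, hkernel]
  ring

lemma integral_quadrant_impulseDeriv {φ : ℝ → ℝ} (hφ : PolyGrowth φ) (hA : IsStable A) (σ : ℝ)
    (b : Fin p → ℝ) (h : ℝ) :
    ∫ z, impulseDeriv A σ b z.1 * impulseDeriv A σ b z.2 * incrementCov φ h z.1 z.2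
      ∂(halfLine.prod halfLine) = kernelCov φ (autocovKernel A σ b) h :=
  integral_quadrant_incrementCov_eq_kernelCov hφ (expDecay_impulseDeriv hA σ b)
    (expDecay_autocovKernel hA σ b) (integral_impulseDeriv hA σ b) (integral_autocovKernel hA σ b)
    (fun w _ => integral_impulseDeriv_mul_comp_add hA σ b w) h

lemma integral_sq_mul_autocovKernel (hA : IsStable A) (σ : ℝ) (b : Fin p → ℝ) :
    ∫ w in Set.Ioi (0 : ℝ), w ^ 2 * autocovKernel A σ b w =
      σ ^ 2 * (b ⬝ᵥ A⁻¹ *ᵥ delta p) ^ 2 := by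
  have hinv (y : Fin p → ℝ) : A *ᵥ A⁻¹ *ᵥ y = y := by
    rw [Matrix.mulVec_mulVec, Matrix.mul_nonsing_inv A hA.isUnit_det, Matrix.one_mulVec]
  have hcomm : Commute A⁻¹ A := (Matrix.nonsing_inv_mul A hA.isUnit_det).trans
    (Matrix.mul_nonsing_inv A hA.isUnit_det).symm
  have hG := integral_expForm_mul_expForm_mulVec hA b (A⁻¹ *ᵥ delta p)
  have hzero := expForm_mulVec_vStar_mulVec hA σ b hcomm 0
  rw [hinv] at hG
  simp only [add_zero, mul_comm (expForm A b (A⁻¹ *ᵥ delta p) _), hG] at hzero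
  have hd := hasDerivAt_expForm A b (A⁻¹ *ᵥ vStar A σ *ᵥ b)
  rw [hinv] at hd
  rw [ExpDecay.integral_sq_mul_deriv (hA.expDecay_expForm b _) (hA.expDecay_expForm b _)
    (hA.expDecay_expForm b _) (expDecay_autocovKernel hA σ b) hd (hasDerivAt_expForm A b _)
    (hasDerivAt_expForm A b _), hzero]
  ring

lemma matIntegrableOn_rpow_smul_expA_neg (A : Matrix (Fin p) (Fin p) ℝ) {s : ℝ} (hs : -1 < s)
    {h : ℝ} (hh : 0 ≤ h) : MatIntegrableOn (fun u => u ^ s • expA A (-u)) (Set.Ioc 0 h) := by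
  intro i j
  have hcont : Continuous fun u => expA A (-u) i j := by
    simpa only [expForm_single, Function.comp_def] using
      (continuous_expForm A (Pi.single i 1) (Pi.single j 1)).comp continuous_neg
  exact (intervalIntegrable_iff_integrableOn_Ioc_of_le hh).1
    ((intervalIntegral.intervalIntegrable_rpow' hs).mul_continuousOn hcont.continuousOn)

lemma matIntegrableOn_rpow_smul_expA (hA : IsStable A) {s : ℝ} (hs : -1 < s) :
    MatIntegrableOn (fun u => u ^ s • expA A u) (Set.Ioi 0) := by
  intro i j
  simpa [expForm_single] using
    (hA.expDecay_expForm (Pi.single i 1) (Pi.single j 1)).integrableOn_rpow_mul hs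

lemma kernelCov_autocovKernel_eq_matIntegral (hA : IsStable A) (σ : ℝ) (b : Fin p → ℝ)
    {H : ℝ} (hH : 0 < H) {h : ℝ} (hh : 0 ≤ h) :
    kernelCov (fun x => |x| ^ (2 * H)) (autocovKernel A σ b) h =
      H * b ⬝ᵥ (A * expA A h *
        matIntegral (fun u => u ^ (2 * H - 1) • expA A (-u)) (Set.Ioc 0 h) * vStar A σ) *ᵥ b
      - H * b ⬝ᵥ (A * expA A (-h) *
        matIntegral (fun u => u ^ (2 * H - 1) • expA A u) (Set.Ioi h) * vStar A σ) *ᵥ b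
      - H * b ⬝ᵥ (A * expA A h *
        matIntegral (fun u => u ^ (2 * H - 1) • expA A u) (Set.Ioi 0) * vStar A σ) *ᵥ b := by
  have hs : -1 < 2 * H - 1 := by linarith
  have hform (c s t : ℝ) : b ⬝ᵥ (A * expA A s * (c • expA A t) * vStar A σ) *ᵥ b =
      c * expForm A b (A *ᵥ vStar A σ *ᵥ b) (s + t) := by
    rw [expForm, Matrix.mulVec_mulVec, Matrix.mulVec_mulVec, Matrix.mul_smul, Matrix.smul_mul,
      Matrix.smul_mulVec, dotProduct_smul, mul_assoc A, ← expA_add,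
       (commute_expA (Commute.refl A) _).eq, smul_eq_mul]
  have hi := matIntegrableOn_rpow_smul_expA hA hs
  have hi_tail : MatIntegrableOn (fun u => u ^ (2 * H - 1) • expA A u) (Set.Ioi h) := fun i j =>
    (hi i j).mono_set (Set.Ioi_subset_Ioi hh)
  rw [kernelCov_abs_rpow_eq_sub_sub (by positivity)
    (hA.expDecay_expForm b (A *ᵥ vStar A σ *ᵥ b)) (expDecay_autocovKernel hA σ b)
    (hasDerivAt_expForm A b _) hh,
    dotProduct_mul_matIntegral_mul_mulVec (matIntegrableOn_rpow_smul_expA_neg A hs hh),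
    dotProduct_mul_matIntegral_mul_mulVec hi, dotProduct_mul_matIntegral_mul_mulVec hi_tail]
  simp only [hform, mul_div_cancel_left₀ H (two_ne_zero' ℝ), sub_eq_add_neg, add_comm h,
    add_comm (-h)]

end AutocovarianceKernel

section ContinuousModification

variable {Ω T : Type*} [MeasurableSpace Ω] {P : Measure Ω} [TopologicalSpace T]
  [FirstCountableTopology T] [TopologicalSpace.SeparableSpace T]

lemma measurable_of_continuous_of_measurable_denseSeq [Nonempty T] {Z : T → Ω → ℝ}
    (hZ : ∀ ω, Continuous fun t => Z t ω)
    (hm : ∀ n, Measurable (Z (TopologicalSpace.denseSeq T n))) (t : T) : Measurable (Z t) := by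
  have : (comap (TopologicalSpace.denseSeq T) (𝓝 t)).NeBot :=
    comap_neBot_iff_frequently.2
      (mem_closure_iff_frequently.1 (TopologicalSpace.denseRange_denseSeq T t))
  refine measurable_of_tendsto_metrizable' (comap (TopologicalSpace.denseSeq T) (𝓝 t)) hm ?_
  exact tendsto_pi_nhds.2 fun ω => ((hZ ω).tendsto t).comp tendsto_comap

lemma exists_measurable_continuous_modification {Z : T → Ω → ℝ}
    (hm : ∀ t, AEMeasurable (Z t) P) (hc : ∀ᵐ ω ∂P, Continuous fun t => Z t ω) :
    ∃ Z' : T → Ω → ℝ, (∀ t, Measurable (Z' t)) ∧ (∀ ω, Continuous fun t => Z' t ω) ∧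
      ∀ᵐ ω ∂P, ∀ t, Z' t ω = Z t ω := by
  classical
  rcases isEmpty_or_nonempty T with hT | hT
  · exact ⟨Z, hT.elim, fun _ => continuous_of_const fun t => hT.elim t, by simp⟩
  let d : ℕ → T := TopologicalSpace.denseSeq T
  have hgood : ∀ᵐ ω ∂P, (Continuous fun t => Z t ω) ∧ ∀ n, Z (d n) ω = (hm (d n)).mk _ ω :=
    hc.and (ae_all_iff.2 fun n => (hm (d n)).ae_eq_mk)
  obtain ⟨N, hsub, hNm, hN0⟩ := exists_measurable_superset_of_null hgood
  have hN : ∀ ω ∉ N, (Continuous fun t => Z t ω) ∧ ∀ n, Z (d n) ω = (hm (d n)).mk _ ω :=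
    fun ω hω => not_not.1 fun h => hω (hsub h)
  have hcont : ∀ ω, Continuous fun t => if ω ∈ N then 0 else Z t ω := by
    intro ω
    by_cases hω : ω ∈ N
    · simpa only [hω, if_true] using continuous_const
    · simpa only [hω, if_false] using (hN ω hω).1
  refine ⟨fun t ω => if ω ∈ N then 0 else Z t ω,
    measurable_of_continuous_of_measurable_denseSeq hcont fun n => ?_, hcont, ?_⟩
  · have hmk : (fun ω => if ω ∈ N then 0 else Z (d n) ω) =
        fun ω => if ω ∈ N then 0 else (hm (d n)).mk _ ω := by
      funext ω
      by_cases hω : ω ∈ N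
      · simp only [hω, if_true]
      · simp only [hω, if_false, (hN ω hω).2 n]
    exact hmk ▸ Measurable.ite hNm measurable_const (hm (d n)).measurable_mk
  · filter_upwards [measure_eq_zero_iff_ae_notMem.1 hN0] with ω hω t
    simp only [hω, if_false]

end ContinuousModification

section IntegratedProcesses

variable {S Ω : Type*} [MeasurableSpace S] [MeasurableSpace Ω] {μ : Measure S} {P : Measure Ω}
  {D : S → Ω → ℝ}

lemma memLp_uncurry_of_integral_sq_le [SFinite P] {K : S → ℝ}
    (hD : AEStronglyMeasurable (Function.uncurry D) (μ.prod P))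
    (hL2 : ∀ᵐ u ∂μ, MemLp (D u) 2 P) (hK : Integrable K μ)
    (hle : ∀ᵐ u ∂μ, ∫ ω, D u ω ^ 2 ∂P ≤ K u) : MemLp (Function.uncurry D) 2 (μ.prod P) := by
  refine (memLp_two_iff_integrable_sq hD).2 ((integrable_prod_iff (hD.pow 2)).2
    ⟨hL2.mono fun u hu => hu.integrable_sq, hK.mono' (hD.pow 2).norm.integral_prod_right' ?_⟩)
  filter_upwards [hle] with u hu
  simp only [Pi.pow_apply, Function.uncurry, norm_pow, Real.norm_eq_abs, sq_abs]
  rwa [abs_of_nonneg (by positivity)]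

variable [IsFiniteMeasure μ]

lemma sq_integral_le {φ : S → ℝ} (hφ : MemLp φ 2 μ) :
    (∫ u, φ u ∂μ) ^ 2 ≤ μ.real Set.univ * ∫ u, φ u ^ 2 ∂μ := by
  have hφ1 : Integrable φ μ := hφ.integrable one_le_two
  have hquad : ∀ x : ℝ, 0 ≤ μ.real Set.univ * (x * x) + 2 * (∫ u, φ u ∂μ) * x +
      ∫ u, φ u ^ 2 ∂μ := by
    intro x
    calc 0 ≤ ∫ u, (x + φ u) ^ 2 ∂μ := integral_nonneg fun u => sq_nonneg _
      _ = ∫ u, (x * x + 2 * x * φ u + φ u ^ 2) ∂μ := by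
        congr 1; funext u; ring
      _ = _ := by
        have hlin : Integrable (fun u => 2 * x * φ u) μ := hφ1.const_mul _
        have hconst_lin : Integrable (fun u => x * x + 2 * x * φ u) μ :=
          (integrable_const _).add hlin
        rw [integral_add hconst_lin hφ.integrable_sq, integral_add (integrable_const _) hlin,
          integral_const, integral_const_mul, smul_eq_mul]
        ring
  have hdiscrim := discrim_le_zero hquad
  rw [discrim] at hdiscrim
  nlinarith

lemma memLp_integral_of_memLp_uncurry [SFinite P]
    (hD : MemLp (Function.uncurry D) 2 (μ.prod P)) : MemLp (fun ω => ∫ u, D u ω ∂μ) 2 P := by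
  have hm : AEStronglyMeasurable (fun ω => ∫ u, D u ω ∂μ) P :=
    hD.aestronglyMeasurable.prod_swap.integral_prod_right'
  rw [memLp_two_iff_integrable_sq hm]
  refine (hD.integrable_sq.integral_prod_right.const_mul (μ.real Set.univ)).mono' (hm.pow 2) ?_
  filter_upwards [hD.integrable_sq.prod_left_ae, hD.aestronglyMeasurable.prod_swap.prodMk_left]
    with ω hω hmω
  rw [Real.norm_of_nonneg (sq_nonneg _)]
  exact sq_integral_le ((memLp_two_iff_integrable_sq hmω).2 hω)

lemma integral_integral_mul_of_memLp_uncurry [SFinite P] {W : Ω → ℝ}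
    (hD : MemLp (Function.uncurry D) 2 (μ.prod P)) (hW : MemLp W 2 P) :
    ∫ ω, (∫ u, D u ω ∂μ) * W ω ∂P = ∫ u, ∫ ω, D u ω * W ω ∂P ∂μ := by
  have hprod : Integrable (fun z : S × Ω => D z.1 z.2 * W z.2) (μ.prod P) :=
    hD.integrable_mul (hW.comp_snd μ)
  calc ∫ ω, (∫ u, D u ω ∂μ) * W ω ∂P = ∫ ω, ∫ u, D u ω * W ω ∂μ ∂P := by
        simp only [integral_mul_const]
    _ = _ := (integral_integral_swap hprod).symm

end IntegratedProcesses

section Covariance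

variable {Ω : Type*} [MeasurableSpace Ω] {P : Measure Ω}

lemma covariance_congr_ae {U U' W W' : Ω → ℝ} (hU : U =ᵐ[P] U') (hW : W =ᵐ[P] W') :
    covariance U W P = covariance U' W' P := by
  rw [covariance, covariance, integral_congr_ae hU, integral_congr_ae hW]
  refine integral_congr_ae ?_
  filter_upwards [hU, hW] with ω hUω hWω
  rw [hUω, hWω]

variable [IsProbabilityMeasure P]

lemma sq_covariance_le {U W : Ω → ℝ} (hU : MemLp U 2 P) (hW : MemLp W 2 P) :
    covariance U W P ^ 2 ≤ variance U P * variance W P := by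
  have hquad : ∀ x : ℝ, 0 ≤ variance W P * (x * x) + 2 * covariance U W P * x + variance U P := by
    intro x
    have hvar := variance_nonneg (U + x • W) P
    rw [variance_add hU (hW.const_smul x), variance_smul, covariance_smul_right] at hvar
    nlinarith
  have hdiscrim := discrim_le_zero hquad
  rw [discrim] at hdiscrim
  nlinarith

variable {ι : Type*} {l : Filter ι}

lemma tendsto_covariance_zero {U W : ι → Ω → ℝ} {L : ℝ} (hU : ∀ᶠ t in l, MemLp (U t) 2 P)
    (hW : ∀ᶠ t in l, MemLp (W t) 2 P) (hUv : Tendsto (fun t => variance (U t) P) l (𝓝 L))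
    (hWv : Tendsto (fun t => variance (W t) P) l (𝓝 0)) :
    Tendsto (fun t => covariance (U t) (W t) P) l (𝓝 0) := by
  have hvar : Tendsto (fun t => variance (U t) P * variance (W t) P) l (𝓝 0) :=
    mul_zero L ▸ hUv.mul hWv
  have hsq : Tendsto (fun t => covariance (U t) (W t) P ^ 2) l (𝓝 0) := by
    refine squeeze_zero' (Eventually.of_forall fun t => sq_nonneg _) ?_ hvar
    filter_upwards [hU, hW] with t hUt hWt using sq_covariance_le hUt hWt
  have habs := hsq.sqrt
  simp only [Real.sqrt_sq_eq_abs, Real.sqrt_zero] at habs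
  exact (tendsto_zero_iff_abs_tendsto_zero _).2 habs

lemma tendsto_variance_add_zero {U W : ι → Ω → ℝ} (hU : ∀ᶠ t in l, MemLp (U t) 2 P)
    (hW : ∀ᶠ t in l, MemLp (W t) 2 P) (hUv : Tendsto (fun t => variance (U t) P) l (𝓝 0))
    (hWv : Tendsto (fun t => variance (W t) P) l (𝓝 0)) :
    Tendsto (fun t => variance (U t + W t) P) l (𝓝 0) := by
  have hlim := (hUv.add ((tendsto_covariance_zero hU hW hUv hWv).const_mul 2)).add hWv
  simp only [mul_zero, add_zero] at hlim
  refine hlim.congr' ?_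
  filter_upwards [hU, hW] with t hUt hWt
  rw [variance_add hUt hWt]

lemma tendsto_covariance_add_of_variance_zero {U₁ U₂ R₁ R₂ : ι → Ω → ℝ} {L₁ L₂ c : ℝ}
    (hU₁ : ∀ᶠ t in l, MemLp (U₁ t) 2 P) (hU₂ : ∀ᶠ t in l, MemLp (U₂ t) 2 P)
    (hR₁ : ∀ᶠ t in l, MemLp (R₁ t) 2 P) (hR₂ : ∀ᶠ t in l, MemLp (R₂ t) 2 P)
    (hUv₁ : Tendsto (fun t => variance (U₁ t) P) l (𝓝 L₁))
    (hUv₂ : Tendsto (fun t => variance (U₂ t) P) l (𝓝 L₂))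
    (hRv₁ : Tendsto (fun t => variance (R₁ t) P) l (𝓝 0))
    (hRv₂ : Tendsto (fun t => variance (R₂ t) P) l (𝓝 0))
    (hc : Tendsto (fun t => covariance (U₁ t) (U₂ t) P) l (𝓝 c)) :
    Tendsto (fun t => covariance (U₁ t + R₁ t) (U₂ t + R₂ t) P) l (𝓝 c) := by
  have hlim := ((hc.add (tendsto_covariance_zero hU₁ hR₂ hUv₁ hRv₂)).add
    (tendsto_covariance_zero hU₂ hR₁ hUv₂ hRv₁)).add (tendsto_covariance_zero hR₁ hR₂ hRv₁ hRv₂)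
  simp only [add_zero] at hlim
  refine hlim.congr' ?_
  filter_upwards [hU₁, hU₂, hR₁, hR₂] with t u₁ u₂ r₁ r₂
  rw [covariance_add_left u₁ r₁ (u₂.add r₂), covariance_add_right u₁ u₂ r₂,
    covariance_add_right r₁ u₂ r₂, covariance_comm (U₂ t) (R₁ t)]
  ring

/-- The linear parameters `x` for which the random variable `L x` has finite variance; the
covariance is a bilinear form on them. -/
def finiteVarianceSubmodule {E : Type*} [AddCommGroup E] [Module ℝ E] (P : Measure Ω)
    (L : E →ₗ[ℝ] Ω → ℝ) : Submodule ℝ E where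
  carrier := {x | MemLp (L x) 2 P}
  zero_mem' := by simp
  add_mem' hx hy := by
    simp only [Set.mem_ofPred_eq, map_add] at *
    exact hx.add hy
  smul_mem' c x hx := by
    simp only [Set.mem_ofPred_eq, map_smul] at *
    exact hx.const_smul c

lemma isBilinearMap_covariance {E : Type*} [AddCommGroup E] [Module ℝ E]
    (L : E →ₗ[ℝ] Ω → ℝ) :
    IsBilinearMap ℝ fun x y : finiteVarianceSubmodule P L => covariance (L x) (L y) P where
  add_left x y z := by
    simpa only [Submodule.coe_add, map_add] using covariance_add_left x.2 y.2 z.2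
  smul_left c x y := by
    simpa only [Submodule.coe_smul, map_smul, smul_eq_mul] using covariance_smul_left c
  add_right x y z := by
    simpa only [Submodule.coe_add, map_add] using covariance_add_right x.2 y.2 z.2
  smul_right c x y := by
    simpa only [Submodule.coe_smul, map_smul, smul_eq_mul] using covariance_smul_right c

-- A quadratic form on a finite-dimensional space is continuous, so no moment of `L` outside the
-- finite-variance submodule is needed.
lemma tendsto_variance_zero_of_tendsto_zero {E : Type*} [NormedAddCommGroup E]
    [NormedSpace ℝ E] [FiniteDimensional ℝ E] (L : E →ₗ[ℝ] Ω → ℝ) {x : ι → E}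
    (hx : Tendsto x l (𝓝 0))
    (hL2 : ∀ᶠ t in l, MemLp (L (x t)) 2 P) :
    Tendsto (fun t => variance (L (x t)) P) l (𝓝 0) := by
  classical
  let y : ι → finiteVarianceSubmodule P L :=
    fun t => if h : MemLp (L (x t)) 2 P then ⟨x t, h⟩ else 0
  have hyx : ∀ᶠ t in l, (y t : E) = x t := hL2.mono fun t ht => by simp only [y, dif_pos ht]
  have hy : Tendsto y l (𝓝 0) :=
    tendsto_subtype_rng.2 (hx.congr' (hyx.mono fun t ht => ht.symm))
  let C := (isBilinearMap_covariance (P := P) L).toContinuousBilinearMap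
  have hC : Continuous fun z : finiteVarianceSubmodule P L => C z z :=
    C.continuous.clm_apply continuous_id
  have hlim : Tendsto (fun t => C (y t) (y t)) l (𝓝 0) := by
    simpa only [map_zero, Function.comp_def] using (hC.tendsto 0).comp hy
  refine hlim.congr' ?_
  filter_upwards [hL2, hyx] with t ht hyt
  rw [IsBilinearMap.toContinuousBilinearMap_apply, hyt, covariance_self ht.aemeasurable]

end Covariance

section VariationOfConstants

variable {p : ℕ} (A : Matrix (Fin p) (Fin p) ℝ) (b : Fin p → ℝ)

lemma expForm_add_right (x y : Fin p → ℝ) (t : ℝ) :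
    expForm A b (x + y) t = expForm A b x t + expForm A b y t := by
  simp only [expForm, Matrix.mulVec_add, dotProduct_add]

lemma expForm_sub_right (x y : Fin p → ℝ) (t : ℝ) :
    expForm A b (x - y) t = expForm A b x t - expForm A b y t := by
  simp only [expForm, Matrix.mulVec_sub, dotProduct_sub]

lemma expForm_smul_right (c : ℝ) (x : Fin p → ℝ) (t : ℝ) :
    expForm A b (c • x) t = c * expForm A b x t := by
  simp only [expForm, Matrix.mulVec_smul, dotProduct_smul, smul_eq_mul]

lemma expForm_eq_sum (y : Fin p → ℝ) (t : ℝ) :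
    expForm A b y t = ∑ j, expForm A b (Pi.single j 1) t * y j := by
  simp only [expForm, Matrix.dotProduct_mulVec, dotProduct_single_one]
  rfl

lemma continuousOn_expForm {S : Set ℝ} {y : ℝ → Fin p → ℝ} {r : ℝ → ℝ} (hy : ContinuousOn y S)
    (hr : ContinuousOn r S) : ContinuousOn (fun s => expForm A b (y s) (r s)) S := by
  simp only [expForm_eq_sum A b (y _)]
  exact continuousOn_finsetSum _ fun j _ => ((continuous_expForm A b _).comp_continuousOn hr).mul
    ((continuous_apply j).comp_continuousOn hy)

lemma hasDerivAt_expForm_comp_sub {y : ℝ → Fin p → ℝ} {y' : Fin p → ℝ} {s : ℝ}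
    (hy : HasDerivAt y y' s) (t : ℝ) :
    HasDerivAt (fun s => expForm A b (y s) (t - s)) (expForm A b (y' - A *ᵥ y s) (t - s)) s := by
  have hexp (z : Fin p → ℝ) :
      HasDerivAt (fun s => expForm A b z (t - s)) (-expForm A b (A *ᵥ z) (t - s)) s :=
    HasDerivAt.comp_const_sub t s (hasDerivAt_expForm A b z (t - s))
  have hsum := HasDerivAt.fun_sum (u := Finset.univ) fun j _ =>
    (hexp (Pi.single j 1)).mul (hasDerivAt_pi.1 hy j)
  have hfrozen := (hexp (y s)).unique (by
    simpa only [expForm_eq_sum A b (y s)] using HasDerivAt.fun_sum (u := Finset.univ)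
      fun j _ => (hexp (Pi.single j 1)).mul_const (y s j))
  simp only [expForm_eq_sum A b (y _)]
  convert! hsum using 1
  rw [Finset.sum_add_distrib, ← hfrozen, ← expForm_eq_sum, expForm_sub_right]
  ring

/-- `x` solves `dx_t = (A x_t + a) dt + d dB_t` on `[0, ∞)`, in the integrated form, for a driving
path `B` that need not have bounded variation. -/
def IsForcedSolution (A : Matrix (Fin p) (Fin p) ℝ) (a d : Fin p → ℝ) (B : ℝ → ℝ)
    (x : ℝ → Fin p → ℝ) : Prop :=
  ∀ t, 0 ≤ t → ∀ i,
    x t i = x 0 i + (∫ s in (0 : ℝ)..t, ((A *ᵥ x s) i + a i)) + d i * (B t - B 0)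

variable {A} {b} {x : ℝ → Fin p → ℝ} {B : ℝ → ℝ} {a d : Fin p → ℝ}

lemma IsForcedSolution.hasDerivAt_sub_smul (heq : IsForcedSolution A a d B x)
    (hx : ContinuousOn x (Set.Ici 0)) {s : ℝ} (hs : 0 < s) :
    HasDerivAt (fun s => x s - (B s - B 0) • d) (A *ᵥ x s + a) s := by
  refine hasDerivAt_pi.2 fun i => ?_
  have hAx : ContinuousOn (fun s => (A *ᵥ x s) i + a i) (Set.Ici 0) :=
    ((continuous_apply i).comp_continuousOn
      ((Continuous.matrix_mulVec continuous_const continuous_id).comp_continuousOn hx)).add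
        continuousOn_const
  have hFTC : HasDerivAt (fun s => ∫ r in (0 : ℝ)..s, ((A *ᵥ x r) i + a i))
      ((A *ᵥ x s) i + a i) s :=
    intervalIntegral.integral_hasDerivAt_right
      (hAx.mono (by rw [Set.uIcc_of_le hs.le]; exact Set.Icc_subset_Ici_self)).intervalIntegrable
      ((hAx.mono Set.Ioi_subset_Ici_self).stronglyMeasurableAtFilter isOpen_Ioi s hs)
      (hAx.continuousAt (Ici_mem_nhds hs))
  refine (hFTC.const_add (x 0 i)).congr_of_eventuallyEq ?_
  filter_upwards [lt_mem_nhds hs] with r hr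
  simp only [Pi.sub_apply, Pi.smul_apply, smul_eq_mul, heq r hr.le i]
  ring

lemma IsForcedSolution.dotProduct_sub_smul_sub_expForm (heq : IsForcedSolution A a d B x)
    (hx : ContinuousOn x (Set.Ici 0)) (hB : ContinuousOn B (Set.Ici 0)) {t : ℝ} (ht : 0 ≤ t) :
    b ⬝ᵥ (x t - (B t - B 0) • d) - expForm A b (x 0) t =
      ∫ s in (0 : ℝ)..t, (expForm A b a (t - s) + (B s - B 0) * expForm A b (A *ᵥ d) (t - s)) := by
  have hsub (s : ℝ) : A *ᵥ x s + a - A *ᵥ (x s - (B s - B 0) • d) =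
      a + (B s - B 0) • (A *ᵥ d) := by
    rw [Matrix.mulVec_sub, Matrix.mulVec_smul]
    abel
  have hBt : ContinuousOn (fun s => B s - B 0) (Set.Icc 0 t) :=
    (hB.mono Set.Icc_subset_Ici_self).sub continuousOn_const
  have hD : ContinuousOn (fun s => x s - (B s - B 0) • d) (Set.Icc 0 t) :=
    (hx.mono Set.Icc_subset_Ici_self).sub (hBt.smul continuousOn_const)
  have hr : ContinuousOn (fun s => t - s) (Set.Icc 0 t) := by fun_prop
  have hFTC := intervalIntegral.integral_eq_sub_of_hasDerivAt_of_le ht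
    (continuousOn_expForm A b hD hr)
    (fun s hs => hasDerivAt_expForm_comp_sub A b
      (heq.hasDerivAt_sub_smul hx hs.1) t)
    (by
      simp only [hsub]
      refine ContinuousOn.intervalIntegrable ?_
      rw [Set.uIcc_of_le ht]
      exact continuousOn_expForm A b (continuousOn_const.add (hBt.smul continuousOn_const)) hr)
  simpa only [hsub, sub_self, sub_zero, zero_smul, expForm_zero, expForm_add_right,
    expForm_smul_right] using hFTC.symm

lemma integral_sub_mul_expForm_mulVec (hB : ContinuousOn B (Set.Ici 0)) {t : ℝ} (ht : 0 ≤ t) :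
    ∫ s in (0 : ℝ)..t, (B s - B 0) * expForm A b (A *ᵥ d) (t - s) =
      (∫ u in Set.Ioc 0 t, expForm A b (A *ᵥ d) u * (B (t - u) - B t))
        + (B t - B 0) * (expForm A b d t - b ⬝ᵥ d) := by
  have hsubst := intervalIntegral.integral_comp_sub_left (a := 0) (b := t)
    (fun s => (B s - B 0) * expForm A b (A *ᵥ d) (t - s)) t
  simp only [sub_self, sub_zero, sub_sub_cancel] at hsubst
  have hBt : ContinuousOn (fun u => B (t - u)) (Set.uIcc 0 t) := by
    rw [Set.uIcc_of_le ht]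
    exact hB.comp (by fun_prop) fun u hu => sub_nonneg.2 hu.2
  have hintegrable : IntervalIntegrable (fun u => expForm A b (A *ᵥ d) u * (B (t - u) - B t))
      volume 0 t :=
    ((continuous_expForm A b _).continuousOn.mul (hBt.sub continuousOn_const)).intervalIntegrable
  have hprimitive : ∫ u in (0 : ℝ)..t, expForm A b (A *ᵥ d) u = expForm A b d t - b ⬝ᵥ d := by
    rw [intervalIntegral.integral_eq_sub_of_hasDerivAt (fun u _ => hasDerivAt_expForm A b d u)
      ((continuous_expForm A b _).intervalIntegrable _ _), expForm_zero]
  rw [← hsubst, ← hprimitive, ← intervalIntegral.integral_const_mul,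
    ← intervalIntegral.integral_of_le ht, ← intervalIntegral.integral_add hintegrable
      (((continuous_expForm A b _).const_mul _).intervalIntegrable _ _)]
  congr 1
  funext u
  ring

lemma IsForcedSolution.dotProduct_eq (heq : IsForcedSolution A a d B x)
    (hx : ContinuousOn x (Set.Ici 0)) (hB : ContinuousOn B (Set.Ici 0)) {t : ℝ} (ht : 0 ≤ t) :
    b ⬝ᵥ x t = (∫ u in Set.Ioc 0 t, expForm A b (A *ᵥ d) u * (B (t - u) - B t))
      + (expForm A b (x 0) t + expForm A b d t * (B t - B 0))
      + ∫ s in (0 : ℝ)..t, expForm A b a (t - s) := by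
  have hr : Continuous fun s : ℝ => t - s := by fun_prop
  have haexp : IntervalIntegrable (fun s => expForm A b a (t - s)) volume 0 t :=
    ((continuous_expForm A b a).comp hr).intervalIntegrable _ _
  have hBexp : IntervalIntegrable (fun s => (B s - B 0) * expForm A b (A *ᵥ d) (t - s))
      volume 0 t := by
    refine ContinuousOn.intervalIntegrable ?_
    rw [Set.uIcc_of_le ht]
    exact ((hB.mono Set.Icc_subset_Ici_self).sub continuousOn_const).mul
      ((continuous_expForm A b _).comp hr).continuousOn
  have hsolution := heq.dotProduct_sub_smul_sub_expForm (b := b) hx hB ht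
  rw [intervalIntegral.integral_add haexp hBexp, integral_sub_mul_expForm_mulVec hB ht,
    dotProduct_sub, dotProduct_smul, smul_eq_mul] at hsolution
  linear_combination hsolution

end VariationOfConstants

section StationaryIncrements

variable {Ω : Type*} [MeasurableSpace Ω]

/-- A centred square-integrable process on `[0, ∞)` with continuous paths and stationary
increments: `φ` is the variance function `φ (t - s) = E (B_t - B_s)²`, normalised by `B_0 = 0`.
Fractional Brownian motion is the Gaussian case with `φ x = |x| ^ (2 * H)`. -/
structure HasStationaryIncrements (φ : ℝ → ℝ) (B : ℝ → Ω → ℝ) (P : Measure Ω) : Prop where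
  memLp : ∀ t, 0 ≤ t → MemLp (B t) 2 P
  mean : ∀ t, 0 ≤ t → ∫ ω, B t ω ∂P = 0
  kernel : ∀ s t, 0 ≤ s → 0 ≤ t →
    ∫ ω, B t ω * B s ω ∂P = 1 / 2 * (φ t + φ s - φ (t - s))
  paths : ∀ᵐ ω ∂P, ContinuousOn (fun t => B t ω) (Set.Ici 0)

lemma IsFractionalBrownianMotion.hasStationaryIncrements {H : ℝ} {B : ℝ → Ω → ℝ} {P : Measure Ω}
    (hB : IsFractionalBrownianMotion H B P) :
    HasStationaryIncrements (fun x => |x| ^ (2 * H)) B P where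
  memLp t ht := (hB.gaussian.hasGaussianLaw_eval ⟨t, ht⟩).memLp_two
  mean := hB.mean
  kernel := hB.kernel
  paths := hB.paths

variable {P : Measure Ω} {φ f : ℝ → ℝ} {B : ℝ → Ω → ℝ}

namespace HasStationaryIncrements

lemma congr {B' : ℝ → Ω → ℝ} (hB : HasStationaryIncrements φ B P)
    (h : ∀ᵐ ω ∂P, ∀ t, 0 ≤ t → B' t ω = B t ω) : HasStationaryIncrements φ B' P := by
  have hae (t : ℝ) (ht : 0 ≤ t) : B' t =ᵐ[P] B t := h.mono fun ω hω => hω t ht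
  refine ⟨fun t ht => (hB.memLp t ht).ae_eq (hae t ht).symm, fun t ht => ?_,
    fun s t hs ht => ?_, ?_⟩
  · rw [← hB.mean t ht, integral_congr_ae (hae t ht)]
  · rw [← hB.kernel s t hs ht]
    exact integral_congr_ae ((hae t ht).mul (hae s hs))
  · filter_upwards [hB.paths, h] with ω hc hω
    exact hc.congr fun t ht => hω t ht

lemma integral_increment_mul_increment (hB : HasStationaryIncrements φ B P) {s h u v : ℝ}
    (hs : 0 ≤ s) (hsh : 0 ≤ s + h) (hu : u ≤ s + h) (hv : v ≤ s) :
    ∫ ω, (B (s + h - u) ω - B (s + h) ω) * (B (s - v) ω - B s ω) ∂P = incrementCov φ h u v := by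
  have hu' : 0 ≤ s + h - u := by linarith
  have hv' : 0 ≤ s - v := by linarith
  have hi {x y : ℝ} (hx : 0 ≤ x) (hy : 0 ≤ y) : Integrable (fun ω => B x ω * B y ω) P :=
    (hB.memLp x hx).integrable_mul (hB.memLp y hy)
  have hi' {x : ℝ} (hx : 0 ≤ x) : Integrable (fun ω => B x ω * B (s - v) ω - B x ω * B s ω) P :=
    (hi hx hv').sub (hi hx hs)
  simp only [sub_mul]
  simp only [mul_sub]
  rw [integral_sub (hi' hu') (hi' hsh), integral_sub (hi hu' hv') (hi hu' hs),
    integral_sub (hi hsh hv') (hi hsh hs), hB.kernel _ _ hv' hu', hB.kernel _ _ hs hu',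
    hB.kernel _ _ hv' hsh, hB.kernel _ _ hs hsh, incrementCov]
  ring_nf

lemma integral_sq_increment (hB : HasStationaryIncrements φ B P) {s u : ℝ} (hs : 0 ≤ s)
    (hu : u ≤ s) : ∫ ω, (B (s - u) ω - B s ω) ^ 2 ∂P = incrementCov φ 0 u u := by
  simpa only [add_zero, sq] using
    hB.integral_increment_mul_increment (h := 0) hs (by simpa) (by simpa) hu

lemma memLp_increment (hB : HasStationaryIncrements φ B P) {s u : ℝ} (hs : 0 ≤ s) (hu : u ≤ s) :
    MemLp (fun ω => B (s - u) ω - B s ω) 2 P :=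
  (hB.memLp _ (sub_nonneg.2 hu)).sub (hB.memLp _ hs)

lemma integral_increment [IsFiniteMeasure P] (hB : HasStationaryIncrements φ B P) {s u : ℝ}
    (hs : 0 ≤ s) (hu : u ≤ s) : ∫ ω, (B (s - u) ω - B s ω) ∂P = 0 := by
  have hu' : 0 ≤ s - u := sub_nonneg.2 hu
  rw [integral_sub ((hB.memLp _ hu').integrable one_le_two) ((hB.memLp _ hs).integrable one_le_two),
    hB.mean _ hu', hB.mean _ hs, sub_zero]

end HasStationaryIncrements

/-- The moving average `∫_0^s f(u) (B_{s-u} - B_s) du` of backward increments, the part of a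
solution of a linear equation driven by `B` that survives in the stationary limit. -/
noncomputable def backwardIntegral (f : ℝ → ℝ) (B : ℝ → Ω → ℝ) (s : ℝ) (ω : Ω) : ℝ :=
  ∫ u in Set.Ioc 0 s, f u * (B (s - u) ω - B s ω)

namespace HasStationaryIncrements

section ContinuousPaths

variable (hB : HasStationaryIncrements φ B P) (hφ : Continuous φ) (hf : Continuous f)
  (hBm : ∀ t, Measurable (B t)) (hBc : ∀ ω, Continuous fun t => B t ω)

include hB hφ hf hBm hBc

lemma memLp_uncurry_backwardIncrement [SFinite P] {s : ℝ} (hs : 0 ≤ s) :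
    MemLp (Function.uncurry fun u ω => f u * (B (s - u) ω - B s ω)) 2
      ((volume.restrict (Set.Ioc 0 s)).prod P) := by
  have hmeas : Measurable (Function.uncurry fun u ω => f u * (B (s - u) ω - B s ω)) :=
    measurable_uncurry_of_continuous_of_measurable
      (fun ω => hf.mul (((hBc ω).comp (continuous_const.sub continuous_id)).sub continuous_const))
      fun u => ((hBm (s - u)).sub (hBm s)).const_mul (f u)
  have hK : Continuous fun u => f u ^ 2 * incrementCov φ 0 u u := by
    unfold incrementCov
    fun_prop
  refine memLp_uncurry_of_integral_sq_le hmeas.aestronglyMeasurable ?_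
    hK.integrableOn_Ioc ?_
  · filter_upwards [ae_restrict_mem measurableSet_Ioc] with u hu
    exact (hB.memLp_increment hs hu.2).const_mul (f u)
  · filter_upwards [ae_restrict_mem measurableSet_Ioc] with u hu
    simp only [mul_pow]
    rw [integral_const_mul, hB.integral_sq_increment hs hu.2]

lemma memLp_backwardIntegral [SFinite P] {s : ℝ} (hs : 0 ≤ s) :
    MemLp (backwardIntegral f B s) 2 P :=
  memLp_integral_of_memLp_uncurry (hB.memLp_uncurry_backwardIncrement hφ hf hBm hBc hs)

lemma integral_backwardIntegral_mul [SFinite P] {s : ℝ} (hs : 0 ≤ s) {W : Ω → ℝ}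
    (hW : MemLp W 2 P) :
    ∫ ω, backwardIntegral f B s ω * W ω ∂P =
      ∫ u in Set.Ioc 0 s, f u * ∫ ω, (B (s - u) ω - B s ω) * W ω ∂P := by
  simpa only [backwardIntegral, mul_assoc, integral_const_mul] using
    integral_integral_mul_of_memLp_uncurry (hB.memLp_uncurry_backwardIncrement hφ hf hBm hBc hs) hW

lemma integral_backwardIntegral [IsFiniteMeasure P] {s : ℝ} (hs : 0 ≤ s) :
    ∫ ω, backwardIntegral f B s ω ∂P = 0 := by
  have h := hB.integral_backwardIntegral_mul hφ hf hBm hBc hs (memLp_const 1)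
  simp only [mul_one] at h
  rw [h]
  exact setIntegral_eq_zero_of_forall_eq_zero fun u hu => by
    rw [hB.integral_increment hs hu.2, mul_zero]

lemma covariance_backwardIntegral [IsProbabilityMeasure P] {s h : ℝ} (hs : 0 ≤ s) (hh : 0 ≤ h) :
    covariance (backwardIntegral f B (s + h)) (backwardIntegral f B s) P =
      ∫ u in Set.Ioc 0 (s + h), ∫ v in Set.Ioc 0 s, f u * f v * incrementCov φ h u v := by
  have hsh : 0 ≤ s + h := add_nonneg hs hh
  have hJ {r : ℝ} (hr : 0 ≤ r) := hB.memLp_backwardIntegral hφ hf hBm hBc hr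
  rw [covariance_eq_sub (hJ hsh) (hJ hs), hB.integral_backwardIntegral hφ hf hBm hBc hs,
    mul_zero, sub_zero]
  refine (hB.integral_backwardIntegral_mul hφ hf hBm hBc hsh (hJ hs)).trans
    (setIntegral_congr_fun measurableSet_Ioc fun u hu => ?_)
  simp only [mul_comm _ (backwardIntegral f B s _)]
  rw [hB.integral_backwardIntegral_mul hφ hf hBm hBc hs (hB.memLp_increment hsh hu.2),
    ← integral_const_mul]
  refine setIntegral_congr_fun measurableSet_Ioc fun v hv => ?_
  rw [← hB.integral_increment_mul_increment hs hsh hu.2 hv.2, mul_assoc]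
  simp only [mul_comm (B (s - v) _ - B s _)]

end ContinuousPaths

lemma tendsto_covariance_backwardIntegral [IsProbabilityMeasure P]
    (hB : HasStationaryIncrements φ B P) (hφ : PolyGrowth φ) (hf : ExpDecay f)
    (hBm : ∀ t, Measurable (B t)) (hBc : ∀ ω, Continuous fun t => B t ω) {h : ℝ} (hh : 0 ≤ h) :
    Tendsto (fun s => covariance (backwardIntegral f B (s + h)) (backwardIntegral f B s) P) atTop
      (𝓝 (∫ z, f z.1 * f z.2 * incrementCov φ h z.1 z.2 ∂(halfLine.prod halfLine))) := by
  have hint := integrable_quadrant_incrementCov hφ hf h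
  rw [Measure.prod_restrict] at hint ⊢
  have hUnion : (⋃ s : ℝ, Set.Ioc (0 : ℝ) (s + h) ×ˢ Set.Ioc (0 : ℝ) s) =
      Set.Ioi (0 : ℝ) ×ˢ Set.Ioi (0 : ℝ) := by
    ext z
    simp only [Set.mem_iUnion, Set.mem_prod, Set.mem_Ioc, Set.mem_Ioi]
    exact ⟨fun ⟨s, h₁, h₂⟩ => ⟨h₁.1, h₂.1⟩, fun ⟨h₁, h₂⟩ => ⟨max z.1 z.2,
      ⟨h₁, by linarith [le_max_left z.1 z.2]⟩, h₂, le_max_right _ _⟩⟩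
  have hlim := tendsto_setIntegral_of_monotone (μ := volume.prod volume)
    (s := fun s : ℝ => Set.Ioc (0 : ℝ) (s + h) ×ˢ Set.Ioc (0 : ℝ) s)
    (fun s => measurableSet_Ioc.prod measurableSet_Ioc)
    (fun s s' hss => Set.prod_mono (Set.Ioc_subset_Ioc_right (by linarith))
      (Set.Ioc_subset_Ioc_right hss)) (by rwa [hUnion])
  rw [hUnion] at hlim
  refine hlim.congr' ?_
  filter_upwards [eventually_ge_atTop 0] with s hs
  rw [hB.covariance_backwardIntegral hφ.continuous hf.continuous hBm hBc hs hh]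
  exact setIntegral_prod _ (IntegrableOn.mono_set hint
    (Set.prod_mono Set.Ioc_subset_Ioi_self Set.Ioc_subset_Ioi_self))

end HasStationaryIncrements

end StationaryIncrements

section StationarySolution

variable {Ω : Type*} [MeasurableSpace Ω] {P : Measure Ω} {p : ℕ}
  {A : Matrix (Fin p) (Fin p) ℝ} {a b d : Fin p → ℝ} {φ : ℝ → ℝ} {B Y : ℝ → Ω → ℝ}
  {X : ℝ → Ω → Fin p → ℝ}

lemma HasStationaryIncrements.exists_continuous_modification (hB : HasStationaryIncrements φ B P) :
    ∃ B' : ℝ → Ω → ℝ, (∀ t, Measurable (B' t)) ∧ (∀ ω, Continuous fun t => B' t ω) ∧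
      ∀ᵐ ω ∂P, ∀ t, 0 ≤ t → B' t ω = B t ω := by
  obtain ⟨B', hm, hc, h⟩ := exists_measurable_continuous_modification
    (Z := fun t => B (max t 0)) (P := P)
    (fun t => (hB.memLp _ (le_max_right t 0)).aestronglyMeasurable.aemeasurable)
    (hB.paths.mono fun ω hω => hω.comp_continuous (continuous_id.max continuous_const)
      fun t => le_max_right t 0)
  exact ⟨B', hm, hc, h.mono fun ω hω t ht => (hω t).trans (by simp only [max_eq_left ht])⟩

lemma HasStationaryIncrements.tendsto_variance_mul_increment [IsFiniteMeasure P]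
    (hB : HasStationaryIncrements φ B P) (hφ : PolyGrowth φ) {g : ℝ → ℝ} (hg : ExpDecay g) :
    Tendsto (fun s => variance (fun ω => g s * (B s ω - B 0 ω)) P) atTop (𝓝 0) := by
  have hgrowth : PolyGrowth fun s => incrementCov φ 0 s s := by
    unfold incrementCov
    simpa only [zero_sub, zero_add, neg_add_cancel, sub_eq_add_neg] using
      (PolyGrowth.const _).mul (((hφ.comp_neg.add hφ).add (.const _)).add (.const _))
  refine ((hg.polyGrowth_mul hgrowth).mul hg).tendsto_zero.congr' ?_
  filter_upwards [eventually_ge_atTop 0] with s hs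
  have hsq := hB.integral_sq_increment hs le_rfl
  have hmean := hB.integral_increment hs le_rfl
  have hL2 := hB.memLp_increment hs le_rfl
  simp only [sub_self] at hsq hmean hL2
  simp only [fun ω => (neg_sub (B 0 ω) (B s ω)).symm, mul_neg, ← neg_mul]
  rw [variance_const_mul, variance_of_integral_eq_zero hL2.aestronglyMeasurable.aemeasurable hmean,
    hsq]
  ring

lemma IsStable.tendsto_variance_expForm [IsProbabilityMeasure P] (hA : IsStable A)
    {X₀ : Ω → Fin p → ℝ} (hX₀ : ∀ᶠ s in atTop, MemLp (fun ω => expForm A b (X₀ ω) s) 2 P) :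
    Tendsto (fun s => variance (fun ω => expForm A b (X₀ ω) s) P) atTop (𝓝 0) := by
  let L : (Fin p → ℝ) →ₗ[ℝ] Ω → ℝ := LinearMap.pi fun ω => (dotProductBilin ℝ ℝ).flip (X₀ ω)
  have hL (s : ℝ) : (fun ω => expForm A b (X₀ ω) s) =
      L fun j => expForm A b (Pi.single j 1) s :=
    funext fun ω => expForm_eq_sum A b (X₀ ω) s
  simp only [hL] at hX₀ ⊢
  exact tendsto_variance_zero_of_tendsto_zero L
    (tendsto_pi_nhds.2 fun j => (hA.expDecay_expForm b (Pi.single j 1)).tendsto_zero) hX₀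

/-- The part of `b' X_s` that depends on the initial value `X₀` and on the current value of the
noise; its variance vanishes as `s → ∞`. -/
noncomputable def transientPart (A : Matrix (Fin p) (Fin p) ℝ) (b d : Fin p → ℝ)
    (X₀ : Ω → Fin p → ℝ) (B : ℝ → Ω → ℝ) (s : ℝ) : Ω → ℝ :=
  (fun ω => expForm A b (X₀ ω) s) + fun ω => expForm A b d s * (B s ω - B 0 ω)

lemma ae_eq_backwardIntegral_add_transientPart (hBc : ∀ ω, Continuous fun t => B t ω)
    (hX : ∀ᵐ ω ∂P, ContinuousOn (fun t => X t ω) (Set.Ici 0))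
    (heq : ∀ᵐ ω ∂P, IsForcedSolution A a d (fun t => B t ω) fun t => X t ω)
    (hY : ∀ t, 0 ≤ t → ∀ᵐ ω ∂P, Y t ω = b ⬝ᵥ X t ω) {s : ℝ} (hs : 0 ≤ s) :
    Y s =ᵐ[P] fun ω => (backwardIntegral (expForm A b (A *ᵥ d)) B s
      + transientPart A b d (X 0) B s) ω + ∫ r in (0 : ℝ)..s, expForm A b a (s - r) := by
  filter_upwards [hX, heq, hY s hs] with ω hc hsol hYω
  rw [hYω]
  exact hsol.dotProduct_eq hc (hBc ω).continuousOn hs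

variable [IsProbabilityMeasure P]

lemma memLp_and_tendsto_variance_transientPart (hA : IsStable A) (hφ : PolyGrowth φ)
    (hB : HasStationaryIncrements φ B P) {X₀ : Ω → Fin p → ℝ} {U V : ℝ → Ω → ℝ} {m : ℝ → ℝ}
    (hU : ∀ s, 0 ≤ s → MemLp (U s) 2 P) (hV : ∀ s, 0 ≤ s → MemLp (V s) 2 P)
    (hUV : ∀ s, 0 ≤ s → U s =ᵐ[P] fun ω => (V s + transientPart A b d X₀ B s) ω + m s) :
    (∀ s, 0 ≤ s → MemLp (transientPart A b d X₀ B s) 2 P) ∧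
      Tendsto (fun s => variance (transientPart A b d X₀ B s) P) atTop (𝓝 0) := by
  have hR (s : ℝ) (hs : 0 ≤ s) : MemLp (transientPart A b d X₀ B s) 2 P := by
    refine (((hU s hs).sub (hV s hs)).sub (memLp_const (m s))).ae_eq ?_
    filter_upwards [hUV s hs] with ω hω
    simp only [Pi.sub_apply, hω, Pi.add_apply]
    ring
  have hnoise (s : ℝ) (hs : 0 ≤ s) : MemLp (fun ω => expForm A b d s * (B s ω - B 0 ω)) 2 P :=
    ((hB.memLp s hs).sub (hB.memLp 0 le_rfl)).const_mul _
  have hinit (s : ℝ) (hs : 0 ≤ s) : MemLp (fun ω => expForm A b (X₀ ω) s) 2 P := by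
    simpa only [transientPart, add_sub_cancel_right] using (hR s hs).sub (hnoise s hs)
  have hinit' := (eventually_ge_atTop 0).mono hinit
  exact ⟨hR, tendsto_variance_add_zero hinit' ((eventually_ge_atTop 0).mono hnoise)
    (hA.tendsto_variance_expForm hinit')
    (hB.tendsto_variance_mul_increment hφ (hA.expDecay_expForm b d))⟩

lemma autocov_eq_integral_quadrant_of_continuous (hA : IsStable A) (hφ : PolyGrowth φ)
    (hB : HasStationaryIncrements φ B P) (hBm : ∀ t, Measurable (B t))
    (hBc : ∀ ω, Continuous fun t => B t ω)
    (hX : ∀ᵐ ω ∂P, ContinuousOn (fun t => X t ω) (Set.Ici 0))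
    (heq : ∀ᵐ ω ∂P, IsForcedSolution A a d (fun t => B t ω) fun t => X t ω)
    (hY : ∀ t, 0 ≤ t → ∀ᵐ ω ∂P, Y t ω = b ⬝ᵥ X t ω) (hstat : IsStationary Y P) {t h : ℝ}
    (ht : 0 ≤ t) (hh : 0 ≤ h) :
    autocov P Y t h = ∫ z, expForm A b (A *ᵥ d) z.1 * expForm A b (A *ᵥ d) z.2 *
      incrementCov φ h z.1 z.2 ∂(halfLine.prod halfLine) := by
  have hf := hA.expDecay_expForm b (A *ᵥ d)
  have hrep (s : ℝ) (hs : 0 ≤ s) := ae_eq_backwardIntegral_add_transientPart hBc hX heq hY hs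
  have hJ (s : ℝ) (hs : 0 ≤ s) :=
    hB.memLp_backwardIntegral hφ.continuous hf.continuous hBm hBc hs
  obtain ⟨hR, hRv⟩ := memLp_and_tendsto_variance_transientPart hA hφ hB hstat.memLp hJ hrep
  have hJR (s : ℝ) (hs : 0 ≤ s) := ((hJ s hs).add (hR s hs)).integrable one_le_two
  have hJv := (hB.tendsto_covariance_backwardIntegral hφ hf hBm hBc le_rfl).congr'
    ((eventually_ge_atTop 0).mono fun s hs => by
      rw [add_zero, covariance_self (hJ s hs).aestronglyMeasurable.aemeasurable])
  have hshift : Tendsto (fun s : ℝ => s + h) atTop atTop :=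
    tendsto_atTop_add_const_right _ _ tendsto_id
  have hlim := tendsto_covariance_add_of_variance_zero
    (hshift.eventually ((eventually_ge_atTop 0).mono hJ)) ((eventually_ge_atTop 0).mono hJ)
    (hshift.eventually ((eventually_ge_atTop 0).mono hR)) ((eventually_ge_atTop 0).mono hR)
    (hJv.comp hshift) hJv (hRv.comp hshift) hRv
    (hB.tendsto_covariance_backwardIntegral hφ hf hBm hBc hh)
  refine tendsto_nhds_unique (tendsto_const_nhds.congr' ?_) hlim
  filter_upwards [eventually_ge_atTop 0] with s hs
  rw [hstat.cov t h ht hh, ← hstat.cov s h hs hh, autocov,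
    covariance_congr_ae (hrep (s + h) (add_nonneg hs hh)) (hrep s hs),
    covariance_add_const_left (hJR _ (add_nonneg hs hh)), covariance_add_const_right (hJR s hs)]

lemma autocov_eq_integral_quadrant (hA : IsStable A) (hφ : PolyGrowth φ)
    (hB : HasStationaryIncrements φ B P)
    (hX : ∀ᵐ ω ∂P, ContinuousOn (fun t => X t ω) (Set.Ici 0))
    (heq : ∀ᵐ ω ∂P, IsForcedSolution A a d (fun t => B t ω) fun t => X t ω)
    (hY : ∀ t, 0 ≤ t → ∀ᵐ ω ∂P, Y t ω = b ⬝ᵥ X t ω) (hstat : IsStationary Y P) {t h : ℝ}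
    (ht : 0 ≤ t) (hh : 0 ≤ h) :
    autocov P Y t h = ∫ z, expForm A b (A *ᵥ d) z.1 * expForm A b (A *ᵥ d) z.2 *
      incrementCov φ h z.1 z.2 ∂(halfLine.prod halfLine) := by
  obtain ⟨B', hBm, hBc, hBB⟩ := hB.exists_continuous_modification
  refine autocov_eq_integral_quadrant_of_continuous (a := a) hA hφ (hB.congr hBB) hBm hBc hX ?_ hY
    hstat ht hh
  filter_upwards [heq, hBB] with ω hsol hω s hs i
  simp only [hω s hs, hω 0 le_rfl]
  exact hsol s hs i

lemma autocov_eq_kernelCov {q : ℕ} {α β : ℕ → ℝ} {σ : ℝ} (hA : IsStable (companion p α))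
    (hφ : PolyGrowth φ) (hB : HasStationaryIncrements φ B P) (hY : IsCarfima p q α β σ B P Y)
    (hstat : IsStationary Y P) {t h : ℝ} (ht : 0 ≤ t) (hh : 0 ≤ h) :
    autocov P Y t h = kernelCov φ (autocovKernel (companion p α) σ (maVec p q β)) h := by
  obtain ⟨X, hX, hYX⟩ := hY
  rw [← integral_quadrant_impulseDeriv hφ hA, autocov_eq_integral_quadrant
    (a := α 0 • delta p) (d := σ • delta p) hA hφ hB hX.paths hX.equation hYX hstat ht hh]
  simp only [impulseDeriv, Matrix.mulVec_smul, expForm_smul_right]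

end StationarySolution

section GammaIntegral

variable {a s : ℝ} {z : ℂ}

lemma norm_rpow_mul_cexp {t : ℝ} (ht : 0 < t) (s : ℝ) (z : ℂ) :
    ‖((t ^ s : ℝ) : ℂ) * Complex.exp (z * t)‖ = t ^ s * Real.exp (z.re * t) := by
  rw [norm_mul, Complex.norm_real, Complex.norm_exp, Complex.re_mul_ofReal,
    Real.norm_of_nonneg (Real.rpow_nonneg ht.le s)]

lemma integrableOn_rpow_mul_cexp (hs : -1 < s) (hz : z.re < 0) :
    IntegrableOn (fun t : ℝ => ((t ^ s : ℝ) : ℂ) * Complex.exp (z * t)) (Set.Ioi 0) := by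
  have hreal : IntegrableOn (fun t : ℝ => t ^ s * Real.exp (-(-z.re) * t)) (Set.Ioi 0) := by
    simpa only [Real.rpow_one] using
      integrableOn_rpow_mul_exp_neg_mul_rpow hs one_pos (neg_pos.2 hz)
  refine hreal.mono' (Measurable.aestronglyMeasurable (by fun_prop)) ?_
  filter_upwards [ae_restrict_mem measurableSet_Ioi] with t ht
  rw [norm_rpow_mul_cexp ht, neg_neg]

lemma integrableOn_Ioc_rpow_mul_cexp (hs : -1 < s) (z : ℂ) {h : ℝ} (hh : 0 ≤ h) :
    IntegrableOn (fun t : ℝ => ((t ^ s : ℝ) : ℂ) * Complex.exp (z * t)) (Set.Ioc 0 h) := by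
  rw [← intervalIntegrable_iff_integrableOn_Ioc_of_le hh]
  have hpow : IntervalIntegrable (fun t : ℝ => t ^ s) volume 0 h :=
    intervalIntegral.intervalIntegrable_rpow' hs
  exact IntervalIntegrable.mul_continuousOn ⟨hpow.1.ofReal, hpow.2.ofReal⟩ (by fun_prop)

lemma differentiableAt_integral_rpow_mul_cexp (hs : -1 < s) (hz : z.re < 0) :
    DifferentiableAt ℂ
      (fun w : ℂ => ∫ t in Set.Ioi (0 : ℝ), ((t ^ s : ℝ) : ℂ) * Complex.exp (w * t)) z := by
  have hnhds : {w : ℂ | w.re < z.re / 2} ∈ 𝓝 z :=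
    (isOpen_lt Complex.continuous_re continuous_const).mem_nhds (by
      rw [Set.mem_ofPred_eq]; linarith)
  have hdom : IntegrableOn (fun t : ℝ => t ^ (s + 1) * Real.exp (-(-(z.re / 2)) * t))
      (Set.Ioi 0) := by
    simpa only [Real.rpow_one] using
      integrableOn_rpow_mul_exp_neg_mul_rpow (by linarith) one_pos (by linarith)
  refine (hasDerivAt_integral_of_dominated_loc_of_deriv_le hnhds
    (F := fun w (t : ℝ) => ((t ^ s : ℝ) : ℂ) * Complex.exp (w * t))
    (F' := fun w (t : ℝ) => ((t ^ s : ℝ) : ℂ) * (Complex.exp (w * t) * t))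
    (.of_forall fun w => Measurable.aestronglyMeasurable (by fun_prop))
    (integrableOn_rpow_mul_cexp hs hz) (Measurable.aestronglyMeasurable (by fun_prop))
    ?_ hdom ?_).2.differentiableAt
  · filter_upwards [ae_restrict_mem measurableSet_Ioi] with t (ht : 0 < t) w (hw : w.re < z.re / 2)
    rw [← mul_assoc, norm_mul, norm_rpow_mul_cexp ht, Real.rpow_add_one ht.ne', Complex.norm_real,
      Real.norm_of_nonneg ht.le, neg_neg, mul_right_comm]
    gcongr
  · exact .of_forall fun t w _ => ((hasDerivAt_mul_const (t : ℂ)).cexp).const_mul _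

lemma integral_rpow_mul_cexp_neg_ofReal (ha : 0 < a) {x : ℝ} (hx : 0 < x) :
    ∫ t in Set.Ioi (0 : ℝ), ((t ^ (a - 1) : ℝ) : ℂ) * Complex.exp (-(x : ℂ) * t) =
      (x : ℂ) ^ (-(a : ℂ)) * (Real.Gamma a : ℂ) := by
  have hreal := congrArg Complex.ofReal (Real.integral_rpow_mul_exp_neg_mul_Ioi ha hx)
  rw [← integral_complex_ofReal, one_div, Real.inv_rpow hx.le, ← Real.rpow_neg hx.le] at hreal
  simpa [Complex.ofReal_cpow hx.le] using hreal

lemma integral_rpow_mul_cexp_neg (ha : 0 < a) (hz : 0 < z.re) :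
    ∫ t in Set.Ioi (0 : ℝ), ((t ^ (a - 1) : ℝ) : ℂ) * Complex.exp (-z * t) =
      z ^ (-(a : ℂ)) * (Real.Gamma a : ℂ) := by
  have hopen : IsOpen {w : ℂ | 0 < w.re} := isOpen_lt continuous_const Complex.continuous_re
  have hleft : AnalyticOnNhd ℂ (fun w : ℂ => ∫ t in Set.Ioi (0 : ℝ),
      ((t ^ (a - 1) : ℝ) : ℂ) * Complex.exp (-w * t)) {w : ℂ | 0 < w.re} :=
    DifferentiableOn.analyticOnNhd (fun w (hw : 0 < w.re) =>
      ((differentiableAt_integral_rpow_mul_cexp (by linarith)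
        (by rwa [Complex.neg_re, neg_lt_zero])).comp w
          differentiableAt_fun_id.fun_neg).differentiableWithinAt) hopen
  have hright : AnalyticOnNhd ℂ (fun w : ℂ => w ^ (-(a : ℂ)) * (Real.Gamma a : ℂ))
      {w : ℂ | 0 < w.re} :=
    DifferentiableOn.analyticOnNhd (fun w hw =>
      ((differentiableAt_id.cpow_const (.inl hw)).mul_const _).differentiableWithinAt) hopen
  have hreal : ∀ᶠ x : ℝ in 𝓝[≠] 1, ∫ t in Set.Ioi (0 : ℝ),
      ((t ^ (a - 1) : ℝ) : ℂ) * Complex.exp (-(x : ℂ) * t) =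
        (x : ℂ) ^ (-(a : ℂ)) * (Real.Gamma a : ℂ) :=
    nhdsWithin_le_nhds ((eventually_gt_nhds one_pos).mono fun x hx =>
      integral_rpow_mul_cexp_neg_ofReal ha hx)
  have hembed : Tendsto Complex.ofReal (𝓝[≠] 1) (𝓝[≠] (1 : ℂ)) :=
    Complex.continuous_ofReal.continuousWithinAt.tendsto_nhdsWithin fun x hx =>
      Complex.ofReal_ne_one.2 hx
  exact hleft.eqOn_of_preconnected_of_frequently_eq hright
    (convex_halfSpace_re_gt 0).isPreconnected (Set.mem_ofPred_eq ▸ one_pos)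
    (hembed.frequently hreal.frequently) hz

lemma incGammaP_mul_ofReal (a : ℝ) (hz : z ≠ 0) {h : ℝ} (hh : 0 ≤ h) :
    incGammaP a (z * h) = z ^ (a : ℂ) *
      (∫ u in Set.Ioc 0 h, ((u ^ (a - 1) : ℝ) : ℂ) * Complex.exp (-z * u)) /
        (Real.Gamma a : ℂ) := by
  have hscale (u : ℝ) (hu : 0 < u) :
      Complex.exp (-((u : ℂ) * z)) * ((u : ℂ) * z) ^ ((a : ℂ) - 1) * z =
        z ^ (a : ℂ) * (((u ^ (a - 1) : ℝ) : ℂ) * Complex.exp (-z * u)) := by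
    have hpow : z ^ (a : ℂ) = z ^ ((a : ℂ) - 1) * z := by
      rw [Complex.cpow_sub _ _ hz, Complex.cpow_one, div_mul_cancel₀ _ hz]
    have hmul : ((u : ℂ) * z) ^ ((a : ℂ) - 1) = ((u ^ (a - 1) : ℝ) : ℂ) * z ^ ((a : ℂ) - 1) := by
      rw [Complex.cpow_def_of_ne_zero (mul_ne_zero (Complex.ofReal_ne_zero.2 hu.ne') hz),
        Complex.log_ofReal_mul hu hz, add_mul, Complex.exp_add, Complex.cpow_def_of_ne_zero hz,
        Real.rpow_def_of_pos hu]
      push_cast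
      rfl
    rw [hmul, hpow, neg_mul, mul_comm z (u : ℂ)]
    ring
  have hsub := intervalIntegral.smul_integral_comp_mul_right (a := 0) (b := 1)
    (fun u : ℝ => Complex.exp (-((u : ℂ) * z)) * ((u : ℂ) * z) ^ ((a : ℂ) - 1) * z) h
  rw [zero_mul, one_mul, intervalIntegral.integral_of_le hh,
    setIntegral_congr_fun measurableSet_Ioc fun u hu => hscale u hu.1, integral_const_mul] at hsub
  rw [incGammaP, ← hsub, ← intervalIntegral.integral_smul]
  congr 2 with u
  rw [Complex.real_smul, Complex.ofReal_mul]
  ring_nf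

end GammaIntegral

section ExponentialKernel

variable {H h : ℝ} {z : ℂ}

lemma gamma_mul_cpow_mul_incGammaP {a : ℝ} (ha : 0 < a) (hz : z ≠ 0) (hh : 0 ≤ h) :
    (Real.Gamma a : ℂ) * (z ^ (1 - (a : ℂ)) * incGammaP a (z * h)) =
      z * ∫ u in Set.Ioc 0 h, ((u ^ (a - 1) : ℝ) : ℂ) * Complex.exp (-z * u) := by
  have hΓ : (Real.Gamma a : ℂ) ≠ 0 := Complex.ofReal_ne_zero.2 (Real.Gamma_pos_of_pos ha).ne'
  rw [incGammaP_mul_ofReal a hz hh, mul_div_assoc', mul_div_cancel₀ _ hΓ, ← mul_assoc,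
    ← Complex.cpow_add _ _ hz, sub_add_cancel, Complex.cpow_one]

lemma gamma_mul_neg_cpow {a : ℝ} (ha : 0 < a) (hz : z.re < 0) :
    (Real.Gamma a : ℂ) * (-z) ^ (1 - (a : ℂ)) =
      -z * ∫ u in Set.Ioi (0 : ℝ), ((u ^ (a - 1) : ℝ) : ℂ) * Complex.exp (z * u) := by
  have hz₀ : -z ≠ 0 := fun h0 => by simp [neg_eq_zero.1 h0] at hz
  have hΓ := integral_rpow_mul_cexp_neg ha (z := -z) (by rwa [Complex.neg_re, neg_pos])
  rw [neg_neg] at hΓ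
  rw [hΓ, sub_eq_add_neg, Complex.cpow_add _ _ hz₀, Complex.cpow_one]
  ring

lemma gamma_mul_uFun (hH : 0 < H) (hz : z.re < 0) (hh : 0 ≤ h) :
    (Real.Gamma (2 * H) : ℂ) * uFun H z h =
      z * (Complex.exp (z * h) *
          (∫ u in Set.Ioc 0 h, ((u ^ (2 * H - 1) : ℝ) : ℂ) * Complex.exp (-z * u))
        - Complex.exp (-(z * h)) *
          (∫ u in Set.Ioi h, ((u ^ (2 * H - 1) : ℝ) : ℂ) * Complex.exp (z * u))
        - Complex.exp (z * h) *
          ∫ u in Set.Ioi (0 : ℝ), ((u ^ (2 * H - 1) : ℝ) : ℂ) * Complex.exp (z * u)) := by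
  have ha : 0 < 2 * H := by positivity
  have hs : -1 < 2 * H - 1 := by linarith
  have hz₀ : z ≠ 0 := fun h0 => by simp [h0] at hz
  have hpos := gamma_mul_cpow_mul_incGammaP ha hz₀ hh
  have hneg := gamma_mul_cpow_mul_incGammaP ha (neg_ne_zero.2 hz₀) hh
  have hfull := gamma_mul_neg_cpow ha hz
  have hsplit := setIntegral_union (Set.Ioc_disjoint_Ioi le_rfl) measurableSet_Ioi
    (integrableOn_Ioc_rpow_mul_cexp hs z hh)
    ((integrableOn_rpow_mul_cexp hs hz).mono_set (Set.Ioi_subset_Ioi hh))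
  rw [Set.Ioc_union_Ioi_eq_Ioi hh] at hsplit
  simp only [neg_mul, neg_neg] at hneg hpos ⊢
  push_cast at hpos hneg hfull
  rw [hsplit] at hfull ⊢
  rw [uFun, Complex.cosh]
  linear_combination Complex.exp (z * h) * hpos - Complex.exp (-(z * h)) * hneg +
    (Complex.exp (z * h) + Complex.exp (-(z * h))) * hfull

variable {ι : Type*} [Fintype ι] {l c : ι → ℂ} {θ : ℝ → ℝ}

lemma integral_rpow_mul_comp_of_eq_sum_cexp (hθ : ∀ w, (θ w : ℂ) = ∑ i, c i * Complex.exp (l i * w))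
    {s x r : ℝ} {S : Set ℝ} {f : ℝ → ℝ} (hf : ∀ u, f u = x + r * u)
    (hint : ∀ i, IntegrableOn
      (fun u : ℝ => ((u ^ s : ℝ) : ℂ) * Complex.exp (r * l i * u)) S) :
    ((∫ u in S, u ^ s * θ (f u) : ℝ) : ℂ) = ∑ i, c i * (Complex.exp (l i * x) *
      ∫ u in S, ((u ^ s : ℝ) : ℂ) * Complex.exp (r * l i * u)) := by
  have hsum (u : ℝ) : ((u ^ s * θ (f u) : ℝ) : ℂ) = ∑ i, c i * Complex.exp (l i * x) *
      (((u ^ s : ℝ) : ℂ) * Complex.exp (r * l i * u)) := by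
    rw [hf, Complex.ofReal_mul, hθ, Finset.mul_sum]
    refine Finset.sum_congr rfl fun i _ => ?_
    push_cast
    rw [mul_add, Complex.exp_add, mul_left_comm (l i), ← mul_assoc (r : ℂ)]
    ring
  simp only [← integral_complex_ofReal, hsum]
  rw [integral_finsetSum _ fun i _ => (hint i).const_mul _]
  simp only [integral_const_mul, mul_assoc]

lemma kernelCov_abs_rpow_of_eq_sum_cexp {k : ℝ → ℝ} (hH : 0 < H) (hk : ExpDecay k)
    (hθ : ExpDecay θ) (hd : ∀ t, HasDerivAt θ (k t) t) (hre : ∀ i, (l i).re < 0)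
    (hsum : ∀ w, (θ w : ℂ) = ∑ i, c i * l i * Complex.exp (l i * w)) (hh : 0 ≤ h) :
    (kernelCov (fun x => |x| ^ (2 * H)) k h : ℂ) =
      (Real.Gamma (2 * H + 1) : ℂ) / 2 * ∑ i, c i * uFun H (l i) h := by
  have ha : 0 < 2 * H := by positivity
  have hs : -1 < 2 * H - 1 := by linarith
  have hi (i : ι) := integrableOn_rpow_mul_cexp hs (hre i)
  have hnear := integral_rpow_mul_comp_of_eq_sum_cexp hsum (f := fun u => h - u) (x := h) (r := -1)
    (fun u => by ring) fun i => integrableOn_Ioc_rpow_mul_cexp hs _ hh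
  have hfar := integral_rpow_mul_comp_of_eq_sum_cexp hsum (f := fun u => u - h) (x := -h) (r := 1)
    (fun u => by ring) fun i => by
      simpa only [Complex.ofReal_one, one_mul] using (hi i).mono_set (Set.Ioi_subset_Ioi hh)
  have hfull := integral_rpow_mul_comp_of_eq_sum_cexp hsum (f := fun u => u + h) (x := h) (r := 1)
    (fun u => by ring) fun i => by simpa only [Complex.ofReal_one, one_mul] using hi i
  have hΓ : (Real.Gamma (2 * H + 1) : ℂ) = 2 * H * (Real.Gamma (2 * H) : ℂ) := by
    rw [Real.Gamma_add_one ha.ne']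
    push_cast
    rfl
  rw [kernelCov_abs_rpow_eq_sub_sub ha hθ hk hd hh, mul_div_cancel_left₀ H (two_ne_zero' ℝ), hΓ]
  push_cast [hnear, hfar, hfull]
  simp only [Finset.mul_sum, ← Finset.sum_sub_distrib, one_mul, neg_mul, mul_neg]
  refine Finset.sum_congr rfl fun i _ => ?_
  have hu := gamma_mul_uFun hH (hre i) hh
  simp only [neg_mul] at hu
  linear_combination (-(H : ℂ) * c i) * hu

end ExponentialKernel

section Congruence

variable {γ γ' : ℝ → ℝ}

lemma IsAntipersistent.congr (h : IsAntipersistent γ) (heq : Set.EqOn γ γ' (Set.Ici 0)) :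
    IsAntipersistent γ' := by
  have hpos : Set.EqOn γ γ' (Set.Ioi 0) := heq.mono Set.Ioi_subset_Ici_self
  obtain ⟨hint, hzero, hneg⟩ := h
  refine ⟨hint.congr_fun hpos measurableSet_Ioi,
    (setIntegral_congr_fun measurableSet_Ioi hpos).symm.trans hzero, ?_⟩
  filter_upwards [hneg, eventually_ge_atTop 0] with x hx hx₀
  rwa [← heq hx₀]

lemma IsLongMemory.congr (h : IsLongMemory γ) (heq : Set.EqOn γ γ' (Set.Ici 0)) :
    IsLongMemory γ' := by
  refine ⟨?_, h.2.congr' ?_⟩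
  · filter_upwards [h.1, eventually_ge_atTop 0] with x hx hx₀
    rwa [← heq hx₀]
  · filter_upwards [eventually_ge_atTop 0] with T hT
    refine intervalIntegral.integral_congr fun x hx => heq ?_
    rw [Set.uIcc_of_le hT] at hx
    exact hx.1

end Congruence

section Companion

variable {p q : ℕ} {α β : ℕ → ℝ} {z : ℂ}

/-- The vector `(1, z, …, z^{p-1})`, the eigenvector of the companion matrix at a root `z` of
`α`. -/
def powVec (p : ℕ) (z : ℂ) : Fin p → ℂ := fun i => z ^ (i : ℕ)

lemma aeval_arPoly (p : ℕ) (α : ℕ → ℝ) (z : ℂ) :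
    Polynomial.aeval z (arPoly p α) = z ^ p - ∑ j : Fin p, (α ((j : ℕ) + 1) : ℂ) * z ^ (j : ℕ) := by
  rw [Fin.sum_univ_eq_sum_range (fun j => (α (j + 1) : ℂ) * z ^ j) p]
  simp [arPoly]

lemma maVec_dotProduct_powVec (hqp : q < p) (β : ℕ → ℝ) (z : ℂ) :
    (Complex.ofReal ∘ maVec p q β) ⬝ᵥ powVec p z = Polynomial.aeval z (maPoly q β) := by
  have hvec : (Complex.ofReal ∘ maVec p q β) ⬝ᵥ powVec p z =
      ∑ j ∈ Finset.range p, (maCoeff q β j : ℂ) * z ^ j :=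
    Fin.sum_univ_eq_sum_range (fun j => (maCoeff q β j : ℂ) * z ^ j) p
  have hpoly : Polynomial.aeval z (maPoly q β) =
      ∑ j ∈ Finset.range (q + 1), (maCoeff q β j : ℂ) * z ^ j := by
    simp [maPoly]
  rw [hvec, hpoly]
  refine (Finset.sum_subset (Finset.range_mono hqp) fun j _ hj => ?_).symm
  have hqj : q < j := by simpa [Nat.lt_succ_iff] using hj
  rw [maCoeff, if_neg (by omega), if_neg (by omega), Complex.ofReal_zero, zero_mul]

lemma companionC_mulVec_of_lt (α : ℕ → ℝ) (x : Fin p → ℂ) (i : Fin p) (hi : (i : ℕ) + 1 < p) :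
    (companionC p α *ᵥ x) i = x ⟨i + 1, hi⟩ := by
  rw [Matrix.mulVec, dotProduct, Finset.sum_eq_single ⟨i + 1, hi⟩]
  · simp [companionC, companion, hi.ne]
  · intro j _ hj
    have : (j : ℕ) ≠ i + 1 := fun e => hj (Fin.ext e)
    simp [companionC, companion, hi.ne, this]
  · simp

lemma companionC_mulVec_of_eq (α : ℕ → ℝ) (x : Fin p → ℂ) (i : Fin p) (hi : (i : ℕ) + 1 = p) :
    (companionC p α *ᵥ x) i = ∑ j : Fin p, (α ((j : ℕ) + 1) : ℂ) * x j := by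
  simp [Matrix.mulVec, dotProduct, companionC, companion, hi]

lemma companionC_mulVec_powVec (hz : Polynomial.aeval z (arPoly p α) = 0) :
    companionC p α *ᵥ powVec p z = z • powVec p z := by
  funext i
  rw [Pi.smul_apply, smul_eq_mul, powVec, ← pow_succ']
  rcases (Nat.succ_le_of_lt i.2).lt_or_eq with hi | hi
  · exact companionC_mulVec_of_lt α _ i hi
  · rw [aeval_arPoly, sub_eq_zero] at hz
    rw [companionC_mulVec_of_eq α _ i hi, ← Nat.succ_eq_add_one, hi, hz]
    rfl

lemma eq_smul_powVec_of_companionC_mulVec_eq_smul {p : ℕ} {x : Fin (p + 1) → ℂ}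
    (hx : companionC (p + 1) α *ᵥ x = z • x) : x = x 0 • powVec (p + 1) z := by
  have hpow : ∀ n (hn : n < p + 1), x ⟨n, hn⟩ = x 0 * z ^ n := by
    intro n
    induction n with
    | zero => intro _; rw [pow_zero, mul_one]; rfl
    | succ n ih =>
      intro hn
      have hrow := congrFun hx ⟨n, by omega⟩
      rw [companionC_mulVec_of_lt α x ⟨n, by omega⟩ hn, Pi.smul_apply, ih (by omega)] at hrow
      rw [hrow, smul_eq_mul, pow_succ']
      ring
  exact funext fun i => hpow i i.2

lemma aeval_arPoly_of_mem_spectrum (hz : z ∈ spectrum ℂ (companionC p α)) :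
    Polynomial.aeval z (arPoly p α) = 0 := by
  rw [← Matrix.spectrum_toLin', ← Module.End.hasEigenvalue_iff_mem_spectrum] at hz
  obtain ⟨x, hx, hx₀⟩ := hz.exists_hasEigenvector
  rw [Module.End.mem_eigenspace_iff, Matrix.toLin'_apply] at hx
  cases p with
  | zero => exact absurd (Subsingleton.elim x 0) hx₀
  | succ p =>
    have hxpow := eq_smul_powVec_of_companionC_mulVec_eq_smul hx
    have hx0 : x 0 ≠ 0 := fun h => hx₀ (by rw [hxpow, h, zero_smul])
    rw [hxpow, Matrix.mulVec_smul, smul_comm] at hx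
    have hlast := congrFun (smul_right_injective _ hx0 hx) (Fin.last p)
    rw [companionC_mulVec_of_eq α _ _ (by simp), Pi.smul_apply, smul_eq_mul, powVec,
      ← pow_succ'] at hlast
    rw [aeval_arPoly, sub_eq_zero]
    exact hlast.symm

lemma companion_mulVec_single_zero (p : ℕ) (α : ℕ → ℝ) :
    companion (p + 1) α *ᵥ Pi.single 0 1 = α 1 • delta (p + 1) := by
  funext i
  simp only [Matrix.mulVec_single_one, Matrix.col_apply, companion, Matrix.of_apply, delta,
    Pi.smul_apply, smul_eq_mul]
  split_ifs <;> simp_all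

lemma coeff_one_ne_zero_of_isUnit_det {p : ℕ} (hdet : IsUnit (companion (p + 1) α).det) :
    α 1 ≠ 0 := by
  intro h
  have hzero := companion_mulVec_single_zero p α
  rw [h, zero_smul] at hzero
  have := Matrix.eq_zero_of_mulVec_eq_zero hdet.ne_zero hzero
  simpa using congrFun this 0

lemma eval_zero_maPoly (q : ℕ) (β : ℕ → ℝ) : (maPoly q β).eval 0 = 1 := by
  rw [maPoly, Polynomial.eval_finsetSum, Finset.sum_range_succ']
  simp [maCoeff]

lemma eval_zero_arPoly (p : ℕ) (α : ℕ → ℝ) : (arPoly (p + 1) α).eval 0 = -α 1 := by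
  rw [arPoly, Polynomial.eval_sub, Polynomial.eval_finsetSum, Finset.sum_range_succ']
  simp

lemma eval_zero_arPoly_ne_zero (hp : 0 < p) (hdet : IsUnit (companion p α).det) :
    (arPoly p α).eval 0 ≠ 0 := by
  obtain ⟨n, rfl⟩ := Nat.exists_eq_succ_of_ne_zero hp.ne'
  rw [eval_zero_arPoly, neg_ne_zero]
  exact coeff_one_ne_zero_of_isUnit_det hdet

lemma maVec_dotProduct_inv_mulVec_delta (q : ℕ) (β : ℕ → ℝ) (hp : 0 < p)
    (hdet : IsUnit (companion p α).det) :
    maVec p q β ⬝ᵥ (companion p α)⁻¹ *ᵥ delta p =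
      -((maPoly q β).eval 0 / (arPoly p α).eval 0) := by
  obtain ⟨n, rfl⟩ := Nat.exists_eq_succ_of_ne_zero hp.ne'
  have hdelta : delta (n + 1) =
      companion (n + 1) α *ᵥ ((α 1)⁻¹ • Pi.single 0 (1 : ℝ)) := by
    rw [Matrix.mulVec_smul, companion_mulVec_single_zero,
      inv_smul_smul₀ (coeff_one_ne_zero_of_isUnit_det hdet)]
  rw [hdelta, Matrix.mulVec_mulVec, Matrix.nonsing_inv_mul _ hdet, Matrix.one_mulVec,
    eval_zero_maPoly, eval_zero_arPoly, dotProduct_smul, dotProduct_single_one]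
  simp [maVec, maCoeff, inv_neg]

end Companion

section PartialFractions

variable {p q : ℕ} {α β : ℕ → ℝ} {l : Fin p → ℂ}

lemma degree_sum_C_mul_X_pow_lt {R : Type*} [Semiring R] (c : ℕ → R) (n : ℕ) :
    (∑ j ∈ Finset.range n, Polynomial.C (c j) * Polynomial.X ^ j : Polynomial R).degree < n := by
  rw [← Polynomial.mem_degreeLT]
  refine Submodule.sum_mem _ fun j hj => Polynomial.mem_degreeLT.2 ?_
  refine (Polynomial.degree_C_mul_X_pow_le j _).trans_lt ?_
  exact_mod_cast Finset.mem_range.1 hj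

lemma monic_arPoly (p : ℕ) (α : ℕ → ℝ) : (arPoly p α).Monic :=
  Polynomial.monic_X_pow_sub (degree_sum_C_mul_X_pow_lt (fun j => α (j + 1)) p)

lemma degree_arPoly (p : ℕ) (α : ℕ → ℝ) : (arPoly p α).degree = p := by
  rw [arPoly, Polynomial.degree_sub_eq_left_of_degree_lt, Polynomial.degree_X_pow]
  rw [Polynomial.degree_X_pow]
  exact degree_sum_C_mul_X_pow_lt (fun j => α (j + 1)) p

lemma map_arPoly_eq_nodal (hl : Function.Injective l)
    (hroot : ∀ i, Polynomial.aeval (l i) (arPoly p α) = 0) :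
    (arPoly p α).map (algebraMap ℝ ℂ) = Lagrange.nodal Finset.univ l := by
  have hmonic : ((arPoly p α).map (algebraMap ℝ ℂ)).Monic := (monic_arPoly p α).map _
  have hdeg : ((arPoly p α).map (algebraMap ℝ ℂ)).degree = p := by
    rw [Polynomial.degree_map, degree_arPoly]
  have hnodal : (Lagrange.nodal Finset.univ l).degree = p := by
    rw [Lagrange.degree_nodal, Finset.card_fin]
  refine Polynomial.eq_of_degree_sub_lt_of_eval_index_eq Finset.univ hl.injOn ?_ fun i hi => ?_
  · rw [Finset.card_fin, ← hdeg]
    exact Polynomial.degree_sub_lt_left (hdeg.trans hnodal.symm) hmonic.ne_zero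
      (hmonic.leadingCoeff.trans Lagrange.nodal_monic.leadingCoeff.symm)
  · rw [Polynomial.eval_map_algebraMap, hroot, Lagrange.eval_nodal_at_node hi]

lemma nodalWeight_eq_inv_aeval_derivative_arPoly (hl : Function.Injective l)
    (hroot : ∀ i, Polynomial.aeval (l i) (arPoly p α) = 0) (i : Fin p) :
    Lagrange.nodalWeight Finset.univ l i =
      (Polynomial.aeval (l i) (Polynomial.derivative (arPoly p α)))⁻¹ := by
  rw [Lagrange.nodalWeight_eq_eval_derivative_nodal (Finset.mem_univ i),
    ← map_arPoly_eq_nodal hl hroot, Polynomial.derivative_map, Polynomial.eval_map_algebraMap]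

-- Comparing leading coefficients in the Lagrange interpolation of the monomials `z^j`, `j < p`.
lemma delta_eq_sum_powVec (hl : Function.Injective l)
    (hroot : ∀ i, Polynomial.aeval (l i) (arPoly p α) = 0) :
    Complex.ofReal ∘ delta p = ∑ i,
      (Polynomial.aeval (l i) (Polynomial.derivative (arPoly p α)))⁻¹ • powVec p (l i) := by
  funext j
  have hcoeff := Lagrange.coeff_eq_sum (s := Finset.univ) (v := l) hl.injOn
    (P := (Polynomial.X ^ (j : ℕ) : Polynomial ℂ))
    (by rw [Polynomial.degree_X_pow, Finset.card_fin]; exact_mod_cast j.2)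
  have hlast : ((j : ℕ) + 1 = p) ↔ (p - 1 = (j : ℕ)) := by have := j.2; omega
  rw [Finset.card_fin, Polynomial.coeff_X_pow] at hcoeff
  rw [Function.comp_apply, delta, apply_ite Complex.ofReal, Complex.ofReal_one,
    Complex.ofReal_zero, if_congr hlast rfl rfl, hcoeff, Finset.sum_apply]
  refine Finset.sum_congr rfl fun i _ => ?_
  rw [← nodalWeight_eq_inv_aeval_derivative_arPoly hl hroot, Lagrange.nodalWeight,
    Finset.prod_inv_distrib]
  simp [powVec, div_eq_mul_inv, mul_comm]

lemma sum_aeval_maPoly_div_sub (hqp : q < p) (hl : Function.Injective l)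
    (hroot : ∀ i, Polynomial.aeval (l i) (arPoly p α) = 0) {z : ℂ} (hz : ∀ i, z ≠ l i) :
    ∑ i, Polynomial.aeval (l i) (maPoly q β) /
      Polynomial.aeval (l i) (Polynomial.derivative (arPoly p α)) / (z - l i) =
      Polynomial.aeval z (maPoly q β) / Polynomial.aeval z (arPoly p α) := by
  have hdeg : ((maPoly q β).map (algebraMap ℝ ℂ)).degree < (Finset.univ : Finset (Fin p)).card := by
    rw [Polynomial.degree_map, Finset.card_fin]
    exact (degree_sum_C_mul_X_pow_lt (maCoeff q β) (q + 1)).trans_le (by exact_mod_cast hqp)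
  have hne : Polynomial.aeval z (arPoly p α) ≠ 0 := by
    rw [← Polynomial.eval_map_algebraMap, map_arPoly_eq_nodal hl hroot]
    exact Lagrange.eval_nodal_not_at_node fun i _ => hz i
  have hinterp := congrArg (Polynomial.eval z) (Lagrange.eq_interpolate hl.injOn hdeg)
  rw [Lagrange.eval_interpolate_not_at_node _ (fun i _ => hz i), ← map_arPoly_eq_nodal hl hroot,
    Polynomial.eval_map_algebraMap, Polynomial.eval_map_algebraMap] at hinterp
  rw [hinterp, mul_div_cancel_left₀ _ hne]
  refine Finset.sum_congr rfl fun i _ => ?_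
  rw [nodalWeight_eq_inv_aeval_derivative_arPoly hl hroot, Polynomial.eval_map_algebraMap]
  ring

end PartialFractions

section ExponentialSums

variable {ι : Type*} [Fintype ι] {l : ι → ℂ}

lemma integral_Ioi_sum_cexp_mul_sum_cexp (hre : ∀ i, (l i).re < 0) (a b : ι → ℂ) (w : ℝ) :
    ∫ u in Set.Ioi (0 : ℝ), (∑ i, a i * Complex.exp (l i * (u + w : ℝ))) *
        ∑ j, b j * Complex.exp (l j * u) =
      ∑ i, a i * Complex.exp (l i * w) * ∑ j, b j / (-l i - l j) := by
  have hre' (i j : ι) : (l i + l j).re < 0 := add_neg (hre i) (hre j)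
  have hprod (u : ℝ) : (∑ i, a i * Complex.exp (l i * (u + w : ℝ))) *
      ∑ j, b j * Complex.exp (l j * u) =
      ∑ i, ∑ j, a i * Complex.exp (l i * w) * b j * Complex.exp ((l i + l j) * u) := by
    rw [Finset.sum_mul_sum]
    refine Finset.sum_congr rfl fun i _ => Finset.sum_congr rfl fun j _ => ?_
    rw [Complex.ofReal_add, mul_add, add_mul, Complex.exp_add, Complex.exp_add]
    ring
  have hint (i j : ι) : IntegrableOn
      (fun u : ℝ => a i * Complex.exp (l i * w) * b j * Complex.exp ((l i + l j) * u))
      (Set.Ioi 0) := (integrableOn_exp_mul_complex_Ioi (hre' i j) 0).const_mul _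
  simp only [hprod]
  rw [integral_finsetSum _ fun i _ => integrable_finsetSum _ fun j _ => hint i j]
  refine Finset.sum_congr rfl fun i _ => ?_
  rw [integral_finsetSum _ fun j _ => hint i j, Finset.mul_sum]
  refine Finset.sum_congr rfl fun j _ => ?_
  rw [integral_const_mul, integral_exp_mul_complex_Ioi (hre' i j), Complex.ofReal_zero, mul_zero,
    Complex.exp_zero, ← neg_add', div_neg, neg_div, mul_neg, mul_neg, mul_one_div, mul_div_assoc]

end ExponentialSums

section CompanionExponentialSums

variable {p q : ℕ} {α : ℕ → ℝ} {l : Fin p → ℂ}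

lemma maVec_dotProduct_exp_mulVec_powVec (hqp : q < p) {z : ℂ}
    (hz : Polynomial.aeval z (arPoly p α) = 0) (β : ℕ → ℝ) (t : ℝ) :
    (Complex.ofReal ∘ maVec p q β) ⬝ᵥ
        NormedSpace.exp ((t : ℂ) • (companion p α).map Complex.ofReal) *ᵥ powVec p z =
      Polynomial.aeval z (maPoly q β) * Complex.exp (z * t) := by
  rw [exp_smul_mulVec_of_eigenvector ((companion p α).map Complex.ofReal)
    (companionC_mulVec_powVec hz), dotProduct_smul, maVec_dotProduct_powVec hqp, smul_eq_mul,
    mul_comm, mul_comm z]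

lemma ofReal_expForm_delta_eq_sum (hqp : q < p) (hl : Function.Injective l)
    (hroot : ∀ i, Polynomial.aeval (l i) (arPoly p α) = 0) (β : ℕ → ℝ) (t : ℝ) :
    (expForm (companion p α) (maVec p q β) (delta p) t : ℂ) =
      ∑ i, Polynomial.aeval (l i) (maPoly q β) /
        Polynomial.aeval (l i) (Polynomial.derivative (arPoly p α)) * Complex.exp (l i * t) := by
  rw [ofReal_expForm, delta_eq_sum_powVec hl hroot, Matrix.mulVec_sum, dotProduct_sum]
  refine Finset.sum_congr rfl fun i _ => ?_
  rw [Matrix.mulVec_smul, dotProduct_smul, maVec_dotProduct_exp_mulVec_powVec hqp (hroot i),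
    smul_eq_mul]
  ring

lemma ofReal_expForm_mulVec_delta_eq_sum (hqp : q < p) (hl : Function.Injective l)
    (hroot : ∀ i, Polynomial.aeval (l i) (arPoly p α) = 0) (β : ℕ → ℝ) (t : ℝ) :
    (expForm (companion p α) (maVec p q β) (companion p α *ᵥ delta p) t : ℂ) =
      ∑ i, Polynomial.aeval (l i) (maPoly q β) /
        Polynomial.aeval (l i) (Polynomial.derivative (arPoly p α)) * l i *
          Complex.exp (l i * t) := by
  have hexp (i : Fin p) : HasDerivAt (fun t : ℝ => Complex.exp (l i * t))
      (Complex.exp (l i * t) * l i) t := by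
    simpa using ((Complex.ofRealCLM.hasDerivAt (x := t)).const_mul (l i)).cexp
  have hform := (hasDerivAt_expForm (companion p α) (maVec p q β) (delta p) t).ofReal_comp
  simp only [ofReal_expForm_delta_eq_sum hqp hl hroot] at hform
  refine hform.unique ((HasDerivAt.fun_sum fun i _ => (hexp i).const_mul _).congr_deriv ?_)
  exact Finset.sum_congr rfl fun i _ => by ring

lemma ofReal_expForm_mulVec_vStar_mulVec_eq_sum (hA : IsStable (companion p α)) (hqp : q < p)
    (σ : ℝ) (β : ℕ → ℝ) (hl : Function.Injective l) (hre : ∀ i, (l i).re < 0)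
    (hroot : ∀ i, Polynomial.aeval (l i) (arPoly p α) = 0) (w : ℝ) :
    (expForm (companion p α) (maVec p q β)
        (companion p α *ᵥ vStar (companion p α) σ *ᵥ maVec p q β) w : ℂ) =
      ∑ i, (σ : ℂ) ^ 2 *
        (Polynomial.aeval (l i) (maPoly q β) * Polynomial.aeval (-l i) (maPoly q β) /
          (Polynomial.aeval (l i) (Polynomial.derivative (arPoly p α)) *
            Polynomial.aeval (-l i) (arPoly p α))) * l i * Complex.exp (l i * w) := by
  have hne (i j : Fin p) : -l i ≠ l j := fun h => by
    have hij := congrArg Complex.re h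
    rw [Complex.neg_re] at hij
    linarith [hre i, hre j]
  rw [expForm_mulVec_vStar_mulVec hA σ _ (Commute.refl _), Complex.ofReal_mul,
    ← integral_complex_ofReal, Complex.ofReal_pow]
  simp only [Complex.ofReal_mul, ofReal_expForm_delta_eq_sum hqp hl hroot,
    ofReal_expForm_mulVec_delta_eq_sum hqp hl hroot]
  rw [integral_Ioi_sum_cexp_mul_sum_cexp hre, Finset.mul_sum]
  refine Finset.sum_congr rfl fun i _ => ?_
  rw [sum_aeval_maPoly_div_sub hqp hl hroot (hne i)]
  ring

end CompanionExponentialSums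

lemma tendsto_div_of_tendsto_rpow_mul {γ : ℝ → ℝ} {s L : ℝ}
    (h : Tendsto (fun x => x ^ s * γ x) atTop (𝓝 L)) (hL : L ≠ 0) :
    Tendsto (fun x => γ x / (L * x ^ (-s))) atTop (𝓝 1) := by
  refine (div_self hL ▸ h.div_const L).congr' ?_
  filter_upwards [eventually_gt_atTop 0] with x hx
  rw [Real.rpow_neg hx.le, mul_comm L, ← div_div, div_inv_eq_mul, mul_comm (γ x)]

section CompanionCovariance

variable {p : ℕ} {α : ℕ → ℝ} {σ H : ℝ}

lemma integral_sq_mul_autocovKernel_companion (hp : 0 < p) (hA : IsStable (companion p α))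
    (q : ℕ) (β : ℕ → ℝ) (σ : ℝ) :
    ∫ w in Set.Ioi (0 : ℝ), w ^ 2 * autocovKernel (companion p α) σ (maVec p q β) w =
      σ ^ 2 * ((maPoly q β).eval 0 ^ 2 / (arPoly p α).eval 0 ^ 2) := by
  rw [integral_sq_mul_autocovKernel hA, maVec_dotProduct_inv_mulVec_delta q β hp hA.isUnit_det,
    neg_sq, div_pow]

lemma sq_eval_zero_maPoly_div_arPoly_pos (hp : 0 < p) (hA : IsStable (companion p α))
    (q : ℕ) (β : ℕ → ℝ) : 0 < (maPoly q β).eval 0 ^ 2 / (arPoly p α).eval 0 ^ 2 := by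
  have hα := eval_zero_arPoly_ne_zero hp hA.isUnit_det
  rw [eval_zero_maPoly]
  positivity

lemma tendsto_kernelCov_companion_div (hp : 0 < p) (hA : IsStable (companion p α))
    (q : ℕ) (β : ℕ → ℝ) (hσ : σ ≠ 0) (hH₀ : 0 < H) (hH : H ≠ 1 / 2) :
    Tendsto (fun h => kernelCov (fun x => |x| ^ (2 * H))
        (autocovKernel (companion p α) σ (maVec p q β)) h /
        (σ ^ 2 * H * (2 * H - 1) * ((maPoly q β).eval 0 ^ 2 / (arPoly p α).eval 0 ^ 2) *
          h ^ (2 * H - 2)))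
      atTop (𝓝 1) := by
  have hlim := tendsto_kernelCov (.abs_rpow (by positivity)) (isPosHomogeneous_abs_rpow (2 * H))
    (expDecay_autocovKernel hA σ (maVec p q β))
  have hratio := (sq_eval_zero_maPoly_div_arPoly_pos hp hA q β).ne'
  have hH' : 2 * H - 1 ≠ 0 := fun h => hH (by linarith)
  have hL : 1 / 2 * (|(1 : ℝ)| ^ (2 * H) * (2 * H * (2 * H - 1)) * ∫ w in Set.Ioi (0 : ℝ),
      w ^ 2 * autocovKernel (companion p α) σ (maVec p q β) w) =
      σ ^ 2 * H * (2 * H - 1) * ((maPoly q β).eval 0 ^ 2 / (arPoly p α).eval 0 ^ 2) := by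
    rw [integral_sq_mul_autocovKernel_companion hp hA, abs_one, Real.one_rpow]
    ring
  rw [hL] at hlim
  simpa only [neg_sub] using tendsto_div_of_tendsto_rpow_mul hlim
    (mul_ne_zero (mul_ne_zero (mul_ne_zero (pow_ne_zero 2 hσ) hH₀.ne') hH') hratio)

lemma kernelCov_companion_eq_sum_uFun (hqp : q < p) (hA : IsStable (companion p α)) (hH : 0 < H)
    (β : ℕ → ℝ) (σ : ℝ) {l : Fin p → ℂ} (hl : Function.Injective l)
    (hspec : ∀ i, l i ∈ spectrum ℂ (companionC p α)) {h : ℝ} (hh : 0 ≤ h) :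
    (kernelCov (fun x => |x| ^ (2 * H))
        (autocovKernel (companion p α) σ (maVec p q β)) h : ℂ) =
      (σ : ℂ) ^ 2 / 2 * (Real.Gamma (2 * H + 1) : ℂ) * ∑ i,
        Polynomial.aeval (l i) (maPoly q β) * Polynomial.aeval (-l i) (maPoly q β) /
          (Polynomial.aeval (l i) (Polynomial.derivative (arPoly p α)) *
            Polynomial.aeval (-l i) (arPoly p α)) * uFun H (l i) h := by
  have hre (i : Fin p) : (l i).re < 0 := hA _ (hspec i)
  rw [kernelCov_abs_rpow_of_eq_sum_cexp hH (expDecay_autocovKernel hA σ (maVec p q β))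
    (hA.expDecay_expForm _ _) (hasDerivAt_expForm _ _ _) hre
    (ofReal_expForm_mulVec_vStar_mulVec_eq_sum hA hqp σ β hl hre
      fun i => aeval_arPoly_of_mem_spectrum (hspec i)) hh]
  simp only [mul_assoc, ← Finset.mul_sum]
  ring

end CompanionCovariance

end Carfima

open Carfima in
open scoped Matrix in
theorem theorem2_general {Ω : Type*} [MeasurableSpace Ω] (P : Measure Ω) [IsProbabilityMeasure P]
    (p q : ℕ) (hqp : q < p) (α β : ℕ → ℝ) (σ H : ℝ) (hH : 0 < H) (hσ : σ ≠ 0)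
    (hA : IsStable (companion p α)) (B : ℝ → Ω → ℝ)
    (hB : HasStationaryIncrements (fun x => |x| ^ (2 * H)) B P)
    (Y : ℝ → Ω → ℝ) (hY : IsCarfima p q α β σ B P Y) (hstat : IsStationary Y P)
    (t : ℝ) (ht : 0 ≤ t) :
    (MatIntegrableOn (vStarIntegrand (companion p α) σ) (Set.Ioi 0) ∧
      ∀ h : ℝ, 0 ≤ h →
        MatIntegrableOn (fun u => u ^ (2 * H - 1) • expA (companion p α) (-u)) (Set.Ioc 0 h) ∧
        MatIntegrableOn (fun u => u ^ (2 * H - 1) • expA (companion p α) u) (Set.Ioi 0) ∧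
        autocov P Y t h =
          H * maVec p q β ⬝ᵥ (companion p α * expA (companion p α) h *
            matIntegral (fun u => u ^ (2 * H - 1) • expA (companion p α) (-u)) (Set.Ioc 0 h) *
            vStar (companion p α) σ) *ᵥ maVec p q β
          - H * maVec p q β ⬝ᵥ (companion p α * expA (companion p α) (-h) *
            matIntegral (fun u => u ^ (2 * H - 1) • expA (companion p α) u) (Set.Ioi h) *
            vStar (companion p α) σ) *ᵥ maVec p q β
          - H * maVec p q β ⬝ᵥ (companion p α * expA (companion p α) h *
            matIntegral (fun u => u ^ (2 * H - 1) • expA (companion p α) u) (Set.Ioi 0) *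
            vStar (companion p α) σ) *ᵥ maVec p q β) ∧
    (∀ l : Fin p → ℂ, Function.Injective l → Set.range l = spectrum ℂ (companionC p α) →
      ∀ h : ℝ, 0 ≤ h →
        (autocov P Y t h : ℂ) =
          (σ : ℂ) ^ 2 / 2 * (Real.Gamma (2 * H + 1) : ℂ) *
            ∑ i : Fin p,
              Polynomial.aeval (l i) (maPoly q β) *
                  Polynomial.aeval (-l i) (maPoly q β) /
                (Polynomial.aeval (l i) (Polynomial.derivative (arPoly p α)) *
                  Polynomial.aeval (-l i) (arPoly p α)) *
                uFun H (l i) h) ∧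
    (H ≠ 1 / 2 →
      Tendsto (fun h : ℝ => autocov P Y t h /
          (σ ^ 2 * H * (2 * H - 1) *
            ((maPoly q β).eval 0 ^ 2 / (arPoly p α).eval 0 ^ 2) *
            h ^ (2 * H - 2)))
        atTop (𝓝 1)) ∧
    (H < 1 / 2 → IsAntipersistent (autocov P Y t)) ∧
    (1 / 2 < H → IsLongMemory (autocov P Y t)) := by
  have hγ : Set.EqOn (kernelCov (fun x => |x| ^ (2 * H))
      (autocovKernel (companion p α) σ (maVec p q β))) (autocov P Y t) (Set.Ici 0) :=
    fun h hh => (autocov_eq_kernelCov hA (.abs_rpow (by positivity)) hB hY hstat ht hh).symm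
  have hp : 0 < p := q.zero_le.trans_lt hqp
  have hs : -1 < 2 * H - 1 := by linarith
  have hdecay := expDecay_autocovKernel hA σ (maVec p q β)
  have hpos : 0 < ∫ w in Set.Ioi 0, w ^ 2 * autocovKernel (companion p α) σ (maVec p q β) w := by
    rw [integral_sq_mul_autocovKernel_companion hp hA]
    exact mul_pos (by positivity) (sq_eval_zero_maPoly_div_arPoly_pos hp hA q β)
  refine ⟨⟨matIntegrableOn_vStarIntegrand hA σ, fun h hh =>
    ⟨matIntegrableOn_rpow_smul_expA_neg _ hs hh, matIntegrableOn_rpow_smul_expA hA hs, ?_⟩⟩,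
    fun l hl hspec h hh => ?_, fun hH' => ?_, fun hH' => ?_, fun hH' => ?_⟩
  · rw [← hγ hh, kernelCov_autocovKernel_eq_matIntegral hA σ _ hH hh]
  · rw [← hγ hh]
    exact kernelCov_companion_eq_sum_uFun hqp hA hH β σ hl
      (fun i => hspec ▸ Set.mem_range_self i) hh
  · refine (tendsto_kernelCov_companion_div hp hA q β hσ hH hH').congr' ?_
    filter_upwards [eventually_ge_atTop 0] with h hh
    rw [hγ hh]
  · exact (isAntipersistent_kernelCov (by positivity) (by linarith) hdecay hpos).congr hγ
  · exact (isLongMemory_kernelCov (by linarith) hdecay hpos).congr hγ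

theorem theorem2 {Ω : Type*} [MeasurableSpace Ω] (P : Measure Ω) [IsProbabilityMeasure P]
    (p q : ℕ) (hqp : q < p) (α β : ℕ → ℝ) (σ H : ℝ)
    (hH0 : 0 < H) (hH1 : H < 1) (hσ : 0 < σ) (hα : α 1 ≠ 0) (hβ : Carfima.maCoeff q β q ≠ 0)
    (hstable : ∀ z ∈ spectrum ℂ (Carfima.companionC p α), z.re < 0)
    (B : ℝ → Ω → ℝ) (hB : Carfima.IsFractionalBrownianMotion H B P)
    (Y : ℝ → Ω → ℝ) (hY : Carfima.IsCarfima p q α β σ B P Y)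
    (hstat : Carfima.IsStationary Y P)
    (A V : Matrix (Fin p) (Fin p) ℝ) (hA : A = Carfima.companion p α)
    (hV : V = Carfima.vStar A σ) (b : Fin p → ℝ) (hb : b = Carfima.maVec p q β)
    (t : ℝ) (ht : 0 ≤ t) :
    -- (a)
    (Carfima.MatIntegrableOn (Carfima.vStarIntegrand A σ) (Set.Ioi 0) ∧
      ∀ h : ℝ, 0 ≤ h →
        Carfima.MatIntegrableOn (fun u => u ^ (2 * H - 1) • Carfima.expA A (-u)) (Set.Ioc 0 h) ∧
        Carfima.MatIntegrableOn (fun u => u ^ (2 * H - 1) • Carfima.expA A u) (Set.Ioi 0) ∧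
        Carfima.autocov P Y t h =
          H * dotProduct b ((A * Carfima.expA A h *
            Carfima.matIntegral (fun u => u ^ (2 * H - 1) • Carfima.expA A (-u)) (Set.Ioc 0 h) *
            V).mulVec b)
          - H * dotProduct b ((A * Carfima.expA A (-h) *
            Carfima.matIntegral (fun u => u ^ (2 * H - 1) • Carfima.expA A u) (Set.Ioi h) *
            V).mulVec b)
          - H * dotProduct b ((A * Carfima.expA A h *
            Carfima.matIntegral (fun u => u ^ (2 * H - 1) • Carfima.expA A u) (Set.Ioi 0) *
            V).mulVec b)) ∧
    -- (b)
    (∀ l : Fin p → ℂ, Function.Injective l → Set.range l = spectrum ℂ (Carfima.companionC p α) →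
      ∀ h : ℝ, 0 ≤ h →
        (Carfima.autocov P Y t h : ℂ) =
          (σ : ℂ) ^ 2 / 2 * (Real.Gamma (2 * H + 1) : ℂ) *
            ∑ i : Fin p,
              Polynomial.aeval (l i) (Carfima.maPoly q β) *
                  Polynomial.aeval (-l i) (Carfima.maPoly q β) /
                (Polynomial.aeval (l i) (Polynomial.derivative (Carfima.arPoly p α)) *
                  Polynomial.aeval (-l i) (Carfima.arPoly p α)) *
                Carfima.uFun H (l i) h) ∧
    -- (c)
    (H ≠ 1 / 2 →
      Tendsto (fun h : ℝ => Carfima.autocov P Y t h /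
          (σ ^ 2 * H * (2 * H - 1) *
            ((Carfima.maPoly q β).eval 0 ^ 2 / (Carfima.arPoly p α).eval 0 ^ 2) *
            h ^ (2 * H - 2)))
        atTop (𝓝 1)) ∧
    (H < 1 / 2 → Carfima.IsAntipersistent (Carfima.autocov P Y t)) ∧
    (1 / 2 < H → Carfima.IsLongMemory (Carfima.autocov P Y t)) := by
  subst hA hV hb
  exact theorem2_general P p q hqp α β σ H hH0 hσ.ne' hstable B hB.hasStationaryIncrements Y hY
    hstat t ht
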